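/- An instance of the capacitated tree cover problem with edge loads consists of the complete graph $G=(V,E)$ on $n\ge 1$ vertices with $m=\binom n2$ edges, edge costs $c:E\to\mathbb R_{\ge 0}$ and edge loads $u:E\to\mathbb R_{\ge0}$ that both satisfy the triangle inequality and such that $u(e)<u(f)$ implies $c(e)\le c(f)$, vertex loads $b:V\to[0,1)$, and a facility opening cost $\gamma\ge0$. A feasible solution is a number $k\ge 1$ and a forest $F$ with vertex set $V$ consisting of $k$ trees such that every tree $T$ of $F$ satisfies $\sum_{e\in E(T)}u(e)+\sum_{v\in V(T)}b(v)\le1$; its cost is $\sum_{e\in E(F)}c(e)+\gamma k$. Theorem. There are a program for the unit-cost real RAM (elementary operations are arithmetic operations and comparisons on real numbers, addition, subtraction and comparison of natural numbers used as counters and addresses, and memory accesses) and a constant $C$ such that, for every instance, the program halts after at most $C\,m\log n$ elementary operations if $n\ge2$ (at most $C$ if $n=1$) and outputs a feasible solution whose cost is at most $3$ times the minimum cost of a feasible solution. Moreover, the cost of the output is at most $3$ times the optimum value of the linear programming relaxation \[ \begin{aligned} \min\ & \sum_{e\in E}c(e)x(e)+\gamma\Bigl(|V|-\sum_{e\in E}x(e)\Bigr)\\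 \text{s.t. } & \sum_{e\in E(G[A])}x(e)\le |A|-1 && \text{for all }\emptyset\ne A\subseteq V,\\ & \sum_{e\in E(G[A])}(1+u(e))x(e)\le |A|-\sum_{v\in A}b(v) && \text{for all }A\subseteq V,\\ & 0\le x(e)\le 1 && \text{for all }e\in E. \end{aligned} \] -/

import Mathlib

/-! ## The capacitated tree cover problem with edge loads

The underlying graph is the complete graph `(⊤ : SimpleGraph V)` on a finite vertex set `V`. An edge
is an element `e : Sym2 V` that is not a loop; values of `c`, `u`, `x` at loops are never used. -/

/-- An instance: edge costs `c`, edge loads `u`, vertex loads `b`, facility opening cost `γ`. -/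
structure TreeCoverInstance (V : Type*) where
  c : Sym2 V → ℝ
  u : Sym2 V → ℝ
  b : V → ℝ
  γ : ℝ
  c_nonneg : ∀ e : Sym2 V, ¬ e.IsDiag → 0 ≤ c e
  u_nonneg : ∀ e : Sym2 V, ¬ e.IsDiag → 0 ≤ u e
  c_triangle : ∀ x y z : V, x ≠ y → y ≠ z → x ≠ z → c s(x, z) ≤ c s(x, y) + c s(y, z)
  u_triangle : ∀ x y z : V, x ≠ y → y ≠ z → x ≠ z → u s(x, z) ≤ u s(x, y) + u s(y, z)
  c_le_of_u_lt : ∀ e f : Sym2 V, ¬ e.IsDiag → ¬ f.IsDiag → u e < u f → c e ≤ c f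
  b_nonneg : ∀ v : V, 0 ≤ b v
  b_lt_one : ∀ v : V, b v < 1
  γ_nonneg : 0 ≤ γ

namespace TreeCoverInstance

open Classical in
/-- Total load of the component `T` of `F`: the loads of its edges plus the loads of its vertices. -/
noncomputable def load {V : Type*} [Fintype V] (I : TreeCoverInstance V) (F : SimpleGraph V)
    (T : F.ConnectedComponent) : ℝ :=
  ∑ e ∈ F.edgeFinset with (∀ v ∈ e, F.connectedComponentMk v = T), I.u e
    + ∑ v : V with F.connectedComponentMk v = T, I.b v

/-- Feasible solutions: forests on all of `V` each of whose trees has total load at most `1`. -/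
def IsSolution {V : Type*} [Fintype V] (I : TreeCoverInstance V) (F : SimpleGraph V) : Prop :=
  F.IsAcyclic ∧ ∀ T : F.ConnectedComponent, I.load F T ≤ 1

open Classical in
/-- Cost of a forest: its total edge cost plus `γ` times its number of trees. -/
noncomputable def cost {V : Type*} [Fintype V] (I : TreeCoverInstance V) (F : SimpleGraph V) : ℝ :=
  ∑ e ∈ F.edgeFinset, I.c e + I.γ * (Nat.card F.ConnectedComponent : ℝ)

end TreeCoverInstance

/-! ## The linear programming relaxation -/

open Classical in
/-- The edges of the subgraph of the complete graph induced by `A`. -/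
noncomputable def edgesWithin {V : Type*} [Fintype V] (A : Finset V) : Finset (Sym2 V) :=
  {e ∈ (⊤ : SimpleGraph V).edgeFinset | ∀ v ∈ e, v ∈ A}

namespace TreeCoverInstance

/-- Feasible points of the linear program. -/
structure LPFeasible {V : Type*} [Fintype V] (I : TreeCoverInstance V) (x : Sym2 V → ℝ) :
    Prop where
  forest : ∀ A : Finset V, A.Nonempty → ∑ e ∈ edgesWithin A, x e ≤ (A.card : ℝ) - 1
  load : ∀ A : Finset V,
    ∑ e ∈ edgesWithin A, (1 + I.u e) * x e ≤ (A.card : ℝ) - ∑ v ∈ A, I.b v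
  bounds : ∀ e ∈ edgesWithin (Finset.univ : Finset V), 0 ≤ x e ∧ x e ≤ 1

/-- Objective function of the linear program. -/
noncomputable def lpCost {V : Type*} [Fintype V] (I : TreeCoverInstance V) (x : Sym2 V → ℝ) : ℝ :=
  ∑ e ∈ edgesWithin (Finset.univ : Finset V), I.c e * x e
    + I.γ * ((Fintype.card V : ℝ) - ∑ e ∈ edgesWithin (Finset.univ : Finset V), x e)

end TreeCoverInstance

/-! ## Unit-cost real random access machine

Structured programs over a memory consisting of arrays of natural numbers and arrays of real
numbers. Each elementary operation (array access, constant, arithmetic operation, comparison,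
assignment, branching) costs one time unit. Natural numbers, which serve as counters and addresses,
can only be added, subtracted (truncated at `0`) and compared. Real numbers can be added,
subtracted, multiplied, divided and compared; there is no rounding and no conversion between the
two kinds of numbers, and the only real constants are rational. -/

namespace RealRAM

/-- A memory state: cell `i` of array number `a`, for either kind of arrays. -/
structure State where
  nat : ℕ → ℕ → ℕ
  real : ℕ → ℕ → ℝ

/-- Write `z` into cell `i` of the array `a` of natural numbers. -/
def State.setNat (s : State) (a i z : ℕ) : State :=
  { s with nat := fun a' i' => if a' = a ∧ i' = i then z else s.nat a' i' }

/-- Write `z` into cell `i` of the array `a` of real numbers. -/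
noncomputable def State.setReal (s : State) (a i : ℕ) (z : ℝ) : State :=
  { s with real := fun a' i' => if a' = a ∧ i' = i then z else s.real a' i' }

/-- Expressions with natural number values; `get a i` reads cell `i` of array `a`. -/
inductive NExp where
  | const (k : ℕ)
  | get (a : ℕ) (i : NExp)
  | add (p q : NExp)
  | sub (p q : NExp)

/-- Value of an expression in a state. -/
def NExp.eval (s : State) : NExp → ℕ
  | const k => k
  | get a i => s.nat a (i.eval s)
  | add p q => p.eval s + q.eval s
  | sub p q => p.eval s - q.eval s

/-- Number of elementary operations of an evaluation. -/
def NExp.time : NExp → ℕ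
  | const _ => 1
  | get _ i => i.time + 1
  | add p q => p.time + q.time + 1
  | sub p q => p.time + q.time + 1

/-- Expressions with real values; `get a i` reads cell `i` of array `a`. -/
inductive RExp where
  | const (r : ℚ)
  | get (a : ℕ) (i : NExp)
  | add (p q : RExp)
  | sub (p q : RExp)
  | mul (p q : RExp)
  | div (p q : RExp)

/-- Value of an expression in a state (division by zero returns zero). -/
noncomputable def RExp.eval (s : State) : RExp → ℝ
  | const r => (r : ℝ)
  | get a i => s.real a (i.eval s)
  | add p q => p.eval s + q.eval s
  | sub p q => p.eval s - q.eval s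
  | mul p q => p.eval s * q.eval s
  | div p q => p.eval s / q.eval s

/-- Number of elementary operations of an evaluation. -/
def RExp.time : RExp → ℕ
  | const _ => 1
  | get _ i => i.time + 1
  | add p q => p.time + q.time + 1
  | sub p q => p.time + q.time + 1
  | mul p q => p.time + q.time + 1
  | div p q => p.time + q.time + 1

/-- Conditions. -/
inductive Test where
  | natLe (p q : NExp)
  | realLe (p q : RExp)
  | not (p : Test)
  | and (p q : Test)

/-- Truth of a condition in a state. -/
def Test.Holds (s : State) : Test → Prop
  | natLe p q => p.eval s ≤ q.eval s
  | realLe p q => p.eval s ≤ q.eval s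
  | not p => ¬ p.Holds s
  | and p q => p.Holds s ∧ q.Holds s

/-- Number of elementary operations of a test. -/
def Test.time : Test → ℕ
  | natLe p q => p.time + q.time + 1
  | realLe p q => p.time + q.time + 1
  | not p => p.time + 1
  | and p q => p.time + q.time + 1

/-- Programs. -/
inductive Program where
  | skip
  | setNat (a : ℕ) (i e : NExp)
  | setReal (a : ℕ) (i : NExp) (e : RExp)
  | seq (p q : Program)
  | ite (b : Test) (p q : Program)
  | while (b : Test) (p : Program)

/-- `Exec p s t s'`: started in the state `s`, the program `p` halts after exactly `t` elementary
operations in the state `s'`. -/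
inductive Exec : Program → State → ℕ → State → Prop where
  | skip (s : State) : Exec .skip s 1 s
  | setNat (a : ℕ) (i e : NExp) (s : State) :
      Exec (.setNat a i e) s (i.time + e.time + 1) (s.setNat a (i.eval s) (e.eval s))
  | setReal (a : ℕ) (i : NExp) (e : RExp) (s : State) :
      Exec (.setReal a i e) s (i.time + e.time + 1) (s.setReal a (i.eval s) (e.eval s))
  | seq {p q : Program} {s s₁ s₂ : State} {t₁ t₂ : ℕ} (hp : Exec p s t₁ s₁)
      (hq : Exec q s₁ t₂ s₂) : Exec (.seq p q) s (t₁ + t₂) s₂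
  | ite_true {b : Test} {p q : Program} {s s₁ : State} {t : ℕ} (hb : b.Holds s)
      (hp : Exec p s t s₁) : Exec (.ite b p q) s (b.time + 1 + t) s₁
  | ite_false {b : Test} {p q : Program} {s s₁ : State} {t : ℕ} (hb : ¬ b.Holds s)
      (hq : Exec q s t s₁) : Exec (.ite b p q) s (b.time + 1 + t) s₁
  | while_true {b : Test} {p : Program} {s s₁ s₂ : State} {t₁ t₂ : ℕ} (hb : b.Holds s)
      (hp : Exec p s t₁ s₁) (hw : Exec (.while b p) s₁ t₂ s₂) :
      Exec (.while b p) s (b.time + 1 + t₁ + t₂) s₂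
  | while_false {b : Test} {p : Program} {s : State} (hb : ¬ b.Holds s) :
      Exec (.while b p) s (b.time + 1) s

/-- The state `s` holds the instance `I` as input: the number `n` of vertices is in cell `0` of the
`nat` array `0`, `γ` is in cell `0` of the `real` array `0`, the `real` array `1` lists the vertex
loads, and the `real` arrays `2` and `3` hold the `n × n` matrices of edge costs and edge loads row
by row (with arbitrary entries on the diagonal). All other cells have arbitrary contents. -/
structure HoldsInput {n : ℕ} (I : TreeCoverInstance (Fin n)) (s : State) : Prop where
  size : s.nat 0 0 = n
  opening : s.real 0 0 = I.γ
  vertexLoad : ∀ i : Fin n, s.real 1 i = I.b i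
  edgeCost : ∀ i j : Fin n, s.real 2 (i * n + j) = I.c s(i, j)
  edgeLoad : ∀ i j : Fin n, s.real 3 (i * n + j) = I.u s(i, j)

/-- The state `s` holds the number `k` and the graph `F` as output: `k` is in cell `0` of the `nat`
array `1`, the number `l` of edges of `F` is in cell `1` of that array, and the first `l` cells of
the `nat` arrays `2` and `3` list the end points of the edges of `F`, each edge once. -/
structure HoldsOutput {n : ℕ} (k : ℕ) (F : SimpleGraph (Fin n)) (s : State) : Prop where
  components : s.nat 1 0 = k
  edgeCount : s.nat 1 1 = Nat.card F.edgeSet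
  inRange : ∀ r < s.nat 1 1, s.nat 2 r < n ∧ s.nat 3 r < n
  adj : ∀ v w : Fin n, F.Adj v w ↔ ∃ r < s.nat 1 1,
    (s.nat 2 r = v ∧ s.nat 3 r = w) ∨ (s.nat 2 r = w ∧ s.nat 3 r = v)

end RealRAM

/-! ## Reasoning about programs of the real RAM -/

namespace RealRAM

/-! Loads and costs order the edges consistently, so sorting by `u + c` sorts by load and by cost at
once (`edge_mono`), and one minimum spanning tree for `u + c`, found by Prim's algorithm, serves
both. Number the vertices by their insertion. Merging along tree edges with `c ≤ γ` in order of
increasing weight only ever creates intervals of positions, and every pair between two intervals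
being merged is at least as heavy as the tree edge that merges them.

Linear program (`GreedyInv`). A greedy vector `x` supported on these tree edges is optimal. A
merging edge gets value 1 if the loads of the two intervals and of the edge fit together; otherwise
it gets the value that makes the load constraint of the merged interval tight. Hence a forest or a
load constraint is tight on each merged interval. Subtracting a suitable multiple of it from a
weight function leaves, after truncation at 0, a function that vanishes between the two parts
(`sum_pairs_union_le`). By induction `x` beats every feasible point on every interval, for all
nonnegative weights that are antitone in load and cost simultaneously. The truncated profit `γ - c`
is such a weight (`GreedyInv.optimal`).

Rounding (`BudgetInv`). The value of an edge of load `u` that does not fit is the sum of two shares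
`(1 - l) / (1 + u)`, one for each side of load `l`. The edge is kept if it fits or if one share
exceeds `2/3`. Every vertex starts with budget 3, and processing an edge consumes `3 * x`. A kept
edge has `x ≥ 2/3`, so `3 * c * x` pays for it twice. The budgets `S` of the rounded trees sum to at
most `3 * (n - ∑ x)`, and a tree of load `L` satisfies `1 ≤ S`, `2 * L ≤ S` and `2 * L + 2 * b v - 1
≤ S` for each of its vertices `v`.

Splitting (`SplitInv`). These bounds suffice to split each rounded tree into at most `S` trees of
load at most 1. The vertices are treated bottom-up. As long as more than 1 remains of a tree,
subtrees of size at least `1/2` are cut off, and small pending subtrees below one vertex are strung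
together to groups by direct edges. By the triangle inequality such an edge costs at most the two
edges it bypasses, which is why each rounded edge was paid for twice. Usually each cut removes at
least `1/2`, so there are at most `2 * L` trees. The exception is a vertex so heavy that its light
children have to leave it; the third bound on `S` covers this case.

The total cost is then at most `3 * ∑ c * x + 3 * γ * (n - ∑ x)`, three times the optimum of the
linear program. Incidence vectors of feasible solutions are feasible points of the same cost, so the
comparison with integral solutions follows. Each phase consists of at most `2 * n` linear scans, and
the resulting quadratic time is `O(m)`, hence also `O(m * log n)`. Only the loads of the intervals
are stored; `x`, the budgets and the rank functions live in the invariants. -/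

@[simp] theorem State.nat_setNat_same (s : State) (a i z : ℕ) :
    (s.setNat a i z).nat a = Function.update (s.nat a) i z := by
  funext j; simp [State.setNat, Function.update_apply]

theorem State.nat_setNat_of_ne (s : State) {a a' : ℕ} (i z : ℕ) (h : a' ≠ a) :
    (s.setNat a i z).nat a' = s.nat a' := by
  funext j; simp [State.setNat, h]

@[simp] theorem State.real_setNat (s : State) (a i z : ℕ) : (s.setNat a i z).real = s.real := rfl

@[simp] theorem State.real_setReal_same (s : State) (a i : ℕ) (z : ℝ) :
    (s.setReal a i z).real a = Function.update (s.real a) i z := by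
  funext j; simp [State.setReal, Function.update_apply]

theorem State.real_setReal_of_ne (s : State) {a a' : ℕ} (i : ℕ) (z : ℝ) (h : a' ≠ a) :
    (s.setReal a i z).real a' = s.real a' := by
  funext j; simp [State.setReal, h]

@[simp] theorem State.nat_setReal (s : State) (a i : ℕ) (z : ℝ) :
    (s.setReal a i z).nat = s.nat := rfl

namespace Program

/-- Number of elementary operations of a program, every loop body being counted once. -/
def size : Program → ℕ
  | skip => 1
  | setNat _ i e => i.time + e.time + 1
  | setReal _ i e => i.time + e.time + 1
  | seq p q => p.size + q.size
  | ite b p q => b.time + 1 + p.size + q.size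
  | .while b p => b.time + 1 + p.size

/-- Nesting depth of the loops of a program. -/
def depth : Program → ℕ
  | skip => 0
  | setNat _ _ _ => 0
  | setReal _ _ _ => 0
  | seq p q => max p.depth q.depth
  | ite _ p q => max p.depth q.depth
  | .while _ p => p.depth + 1

/-- The arrays of natural numbers to which a program may write. -/
def natWrites : Program → List ℕ
  | skip => []
  | setNat a _ _ => [a]
  | setReal _ _ _ => []
  | seq p q => p.natWrites ++ q.natWrites
  | ite _ p q => p.natWrites ++ q.natWrites
  | .while _ p => p.natWrites

/-- The arrays of real numbers to which a program may write. -/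
def realWrites : Program → List ℕ
  | skip => []
  | setNat _ _ _ => []
  | setReal a _ _ => [a]
  | seq p q => p.realWrites ++ q.realWrites
  | ite _ p q => p.realWrites ++ q.realWrites
  | .while _ p => p.realWrites

/-- Programs without loops. -/
def LoopFree : Program → Prop
  | skip => True
  | setNat _ _ _ => True
  | setReal _ _ _ => True
  | seq p q => p.LoopFree ∧ q.LoopFree
  | ite _ p q => p.LoopFree ∧ q.LoopFree
  | .while _ _ => False

open Classical in
/-- Result of a program without loops. -/
noncomputable def run : Program → State → State
  | skip, s => s
  | setNat a i e, s => s.setNat a (i.eval s) (e.eval s)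
  | setReal a i e, s => s.setReal a (i.eval s) (e.eval s)
  | seq p q, s => q.run (p.run s)
  | ite b p q, s => if b.Holds s then p.run s else q.run s
  | .while _ _, s => s

end Program

/-- The set of written arrays is a syntactic list, so that preservation of an array across a whole
subprogram can later be settled by `decide`. -/
theorem Exec.nat_frame {p : Program} {s s' : State} {t : ℕ} (h : Exec p s t s') {a : ℕ}
    (ha : a ∉ p.natWrites) : s'.nat a = s.nat a := by
  induction h with
  | skip => rfl
  | setNat a' i e s =>
    exact s.nat_setNat_of_ne _ _ (by simpa [Program.natWrites] using ha)
  | setReal => rfl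
  | seq _ _ ih₁ ih₂ =>
    simp only [Program.natWrites, List.mem_append, not_or] at ha
    rw [ih₂ ha.2, ih₁ ha.1]
  | ite_true _ _ ih =>
    simp only [Program.natWrites, List.mem_append, not_or] at ha
    exact ih ha.1
  | ite_false _ _ ih =>
    simp only [Program.natWrites, List.mem_append, not_or] at ha
    exact ih ha.2
  | while_true _ _ _ ih₁ ih₂ =>
    rw [ih₂ ha, ih₁ ha]
  | while_false => rfl

theorem Exec.real_frame {p : Program} {s s' : State} {t : ℕ} (h : Exec p s t s') {a : ℕ}
    (ha : a ∉ p.realWrites) : s'.real a = s.real a := by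
  induction h with
  | skip => rfl
  | setNat => rfl
  | setReal a' i e s =>
    exact s.real_setReal_of_ne _ _ (by simpa [Program.realWrites] using ha)
  | seq _ _ ih₁ ih₂ =>
    simp only [Program.realWrites, List.mem_append, not_or] at ha
    rw [ih₂ ha.2, ih₁ ha.1]
  | ite_true _ _ ih =>
    simp only [Program.realWrites, List.mem_append, not_or] at ha
    exact ih ha.1
  | ite_false _ _ ih =>
    simp only [Program.realWrites, List.mem_append, not_or] at ha
    exact ih ha.2
  | while_true _ _ _ ih₁ ih₂ =>
    rw [ih₂ ha, ih₁ ha]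
  | while_false => rfl

/-- `Reach N p Q s`: started in `s`, the program `p` halts in a state with property `Q`, within the
time that results if every loop is iterated at most `N` times whenever it is reached. -/
def Reach (N : ℕ) (p : Program) (Q : State → Prop) (s : State) : Prop :=
  ∃ t s', Exec p s t s' ∧ t ≤ p.size * (N + 1) ^ p.depth ∧ Q s'

namespace Reach

variable {N : ℕ} {p q : Program} {Q R : State → Prop} {s : State}

theorem mono (h : Reach N p Q s) (hQ : ∀ s', Q s' → R s') : Reach N p R s := by
  obtain ⟨t, s', h₁, h₂, h₃⟩ := h
  exact ⟨t, s', h₁, h₂, hQ _ h₃⟩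

/-- `s'` agrees with `s` outside the arrays written by `p`. -/
structure Frame (p : Program) (s s' : State) : Prop where
  nat : ∀ a, a ∉ p.natWrites → s'.nat a = s.nat a
  real : ∀ a, a ∉ p.realWrites → s'.real a = s.real a

theorem frame (h : Reach N p Q s) : Reach N p (fun s' => Q s' ∧ Frame p s s') s := by
  obtain ⟨t, s', h₁, h₂, h₃⟩ := h
  exact ⟨t, s', h₁, h₂, h₃, fun _ ha => h₁.nat_frame ha, fun _ ha => h₁.real_frame ha⟩

theorem seq (h : Reach N p (Reach N q Q) s) : Reach N (.seq p q) Q s := by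
  obtain ⟨t₁, s₁, h₁, ht₁, t₂, s₂, h₂, ht₂, hQ⟩ := h
  refine ⟨t₁ + t₂, s₂, .seq h₁ h₂, ?_, hQ⟩
  have e₁ : (N + 1) ^ p.depth ≤ (N + 1) ^ max p.depth q.depth :=
    Nat.pow_le_pow_right (by omega) (le_max_left _ _)
  have e₂ : (N + 1) ^ q.depth ≤ (N + 1) ^ max p.depth q.depth :=
    Nat.pow_le_pow_right (by omega) (le_max_right _ _)
  simp only [Program.size, Program.depth, add_mul]
  exact add_le_add (ht₁.trans (Nat.mul_le_mul_left _ e₁)) (ht₂.trans (Nat.mul_le_mul_left _ e₂))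

theorem ite {b : Test} (hp : b.Holds s → Reach N p Q s) (hq : ¬ b.Holds s → Reach N q Q s) :
    Reach N (.ite b p q) Q s := by
  have hN : 1 ≤ (N + 1) ^ max p.depth q.depth := Nat.one_le_pow _ _ (by omega)
  have hb : b.time + 1 ≤ (b.time + 1) * (N + 1) ^ max p.depth q.depth :=
    Nat.le_mul_of_pos_right _ hN
  by_cases h : b.Holds s
  · obtain ⟨t, s', h₁, h₂, h₃⟩ := hp h
    refine ⟨_, s', .ite_true h h₁, ?_, h₃⟩
    have e₁ : (N + 1) ^ p.depth ≤ (N + 1) ^ max p.depth q.depth :=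
      Nat.pow_le_pow_right (by omega) (le_max_left _ _)
    simp only [Program.size, Program.depth, add_mul _ q.size, add_mul _ p.size]
    have := h₂.trans (Nat.mul_le_mul_left _ e₁)
    omega
  · obtain ⟨t, s', h₁, h₂, h₃⟩ := hq h
    refine ⟨_, s', .ite_false h h₁, ?_, h₃⟩
    have e₁ : (N + 1) ^ q.depth ≤ (N + 1) ^ max p.depth q.depth :=
      Nat.pow_le_pow_right (by omega) (le_max_right _ _)
    simp only [Program.size, Program.depth, add_mul _ q.size, add_mul _ p.size]
    have := h₂.trans (Nat.mul_le_mul_left _ e₁)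
    omega

theorem of_run (hp : p.LoopFree) (h : Q (p.run s)) : Reach N p Q s := by
  induction p generalizing s Q with
  | skip => exact ⟨1, s, .skip s, by simp [Program.size, Program.depth], h⟩
  | setNat a i e =>
    exact ⟨_, _, .setNat a i e s, by simp [Program.size, Program.depth], h⟩
  | setReal a i e =>
    exact ⟨_, _, .setReal a i e s, by simp [Program.size, Program.depth], h⟩
  | seq p q ihp ihq => exact Reach.seq (ihp hp.1 (ihq hp.2 h))
  | ite b p q ihp ihq =>
    simp only [Program.run] at h
    refine Reach.ite (fun hb => ihp hp.1 ?_) (fun hb => ihq hp.2 ?_)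
    · rwa [if_pos hb] at h
    · rwa [if_neg hb] at h
  | _ => exact hp.elim

/-- The measure `μ` bounds the number of iterations. The induction is on an upper bound of `μ`,
because a round may lower it by more than one. The additional final test is absorbed in passing from
`N` to `N + 1` in the time bound. -/
theorem loop {b : Test} (I : State → Prop) (μ : State → ℕ) (hμ : μ s ≤ N) (hI : I s)
    (step : ∀ s', I s' → b.Holds s' → Frame p s s' →
      Reach N p (fun s'' => I s'' ∧ μ s'' < μ s') s')
    (done : ∀ s', I s' → ¬ b.Holds s' → Frame p s s' → Q s') : Reach N (.while b p) Q s := by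
  have key : ∀ m, ∀ s', I s' → μ s' ≤ m → Frame p s s' →
      ∃ t s'', Exec (.while b p) s' t s'' ∧
        t ≤ b.time + 1 + m * (b.time + 1 + p.size * (N + 1) ^ p.depth) ∧ Q s'' := by
    intro m
    induction m with
    | zero =>
      intro s' hI' hm hf
      by_cases hb : b.Holds s'
      · obtain ⟨t, s'', h₁, -, h₃, h₄⟩ := step s' hI' hb hf
        omega
      · exact ⟨_, _, .while_false hb, by simp, done s' hI' hb hf⟩
    | succ m ih =>
      intro s' hI' hm hf
      by_cases hb : b.Holds s'
      · obtain ⟨t, s₁, h₁, h₂, ⟨h₃, h₄⟩, h₅⟩ := (step s' hI' hb hf).frame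
        have hf' : Frame p s s₁ :=
          ⟨fun a ha => (h₅.nat a ha).trans (hf.nat a ha),
            fun a ha => (h₅.real a ha).trans (hf.real a ha)⟩
        obtain ⟨t₂, s₂, h₆, h₇, h₈⟩ := ih s₁ h₃ (by omega) hf'
        refine ⟨_, _, .while_true hb h₁ h₆, ?_, h₈⟩
        rw [Nat.succ_mul]
        omega
      · exact ⟨_, _, .while_false hb, by simp, done s' hI' hb hf⟩
  obtain ⟨t, s', h₁, h₂, h₃⟩ := key N s hI hμ ⟨fun _ _ => rfl, fun _ _ => rfl⟩
  refine ⟨t, s', h₁, h₂.trans ?_, h₃⟩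
  simp only [Program.size, Program.depth]
  have hN : 1 ≤ (N + 1) ^ p.depth := Nat.one_le_pow _ _ (by omega)
  have hb : b.time + 1 ≤ (b.time + 1) * (N + 1) ^ p.depth := Nat.le_mul_of_pos_right _ hN
  calc b.time + 1 + N * (b.time + 1 + p.size * (N + 1) ^ p.depth)
      ≤ (b.time + 1) * (N + 1) ^ p.depth
        + N * ((b.time + 1) * (N + 1) ^ p.depth + p.size * (N + 1) ^ p.depth) := by gcongr
    _ ≤ (b.time + 1 + p.size) * (N + 1) ^ (p.depth + 1) := by
      rw [pow_succ]
      nlinarith [Nat.zero_le (p.size * (N + 1) ^ p.depth)]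

end Reach

/-- The scalar variable that is stored in cell `0` of the array `x` of natural numbers. -/
abbrev nvar (x : ℕ) : NExp := .get x (.const 0)

/-- The scalar variable that is stored in cell `0` of the array `x` of real numbers. -/
abbrev rvar (x : ℕ) : RExp := .get x (.const 0)

/-- `for x = lo, …, n - 1 do body`, where `n` is stored in cell `0` of the `nat` array `0`. -/
def forLoop (x : ℕ) (lo : NExp) (body : Program) : Program :=
  .seq (.setNat x (.const 0) lo)
    (.while (.natLe (.add (nvar x) (.const 1)) (nvar 0))
      (.seq body (.setNat x (.const 0) (.add (nvar x) (.const 1)))))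

theorem natWrites_forLoop (x : ℕ) (lo : NExp) (body : Program) :
    (forLoop x lo body).natWrites = x :: (body.natWrites ++ [x]) := rfl

theorem realWrites_forLoop (x : ℕ) (lo : NExp) (body : Program) :
    (forLoop x lo body).realWrites = body.realWrites := by
  simp [forLoop, Program.realWrites]

/-- The counter reaches the invariant only through its index; `hI` makes the invariant blind to the
counter cell, which is overwritten after each execution of the body. -/
theorem Reach.forLoop {N n x : ℕ} {lo : NExp} {body : Program} {Q : State → Prop} {s : State}
    (I : ℕ → State → Prop) (hx : x ∉ body.natWrites) (h0 : 0 ∉ body.natWrites) (hx0 : 0 ≠ x)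
    (hn : s.nat 0 0 = n) (hN : n ≤ N) (hlo : lo.eval s ≤ n)
    (hI : ∀ i s z, I i s → I i (s.setNat x 0 z)) (start : I (lo.eval s) s)
    (step : ∀ i s', lo.eval s ≤ i → i < n → s'.nat x 0 = i → s'.nat 0 0 = n →
      Reach.Frame (RealRAM.forLoop x lo body) s s' → I i s' → Reach N body (I (i + 1)) s')
    (done : ∀ s', Reach.Frame (RealRAM.forLoop x lo body) s s' → I n s' → Q s') :
    Reach N (RealRAM.forLoop x lo body) Q s := by
  have key : Reach N (RealRAM.forLoop x lo body) (I n) s := by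
    refine Reach.seq (Reach.of_run trivial ?_)
    simp only [Program.run, NExp.eval]
    refine Reach.loop (fun s' => I (s'.nat x 0) s' ∧ s'.nat x 0 ≤ n ∧ lo.eval s ≤ s'.nat x 0)
      (fun s' => n - s'.nat x 0) (by omega) ?_ ?_ ?_
    · simpa [hlo] using hI _ _ _ start
    · rintro s' ⟨h₁, h₂, h₃⟩ hb hf
      have hn' : s'.nat 0 0 = n := by
        rw [hf.nat 0 (by simp [Program.natWrites, h0, hx0]), State.nat_setNat_of_ne _ _ _ hx0, hn]
      simp only [Test.Holds, NExp.eval, hn'] at hb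
      refine Reach.seq ((step _ s' h₃ (by omega) rfl hn' ?_ h₁).frame.mono ?_)
      · constructor
        · intro a ha
          rw [natWrites_forLoop] at ha
          simp only [List.mem_cons, List.mem_append, not_or] at ha
          rw [hf.nat a (by simp [Program.natWrites, ha.1, ha.2.1]),
            State.nat_setNat_of_ne _ _ _ ha.1]
        · intro a ha
          rw [realWrites_forLoop] at ha
          rw [hf.real a (by simpa [Program.realWrites] using ha), State.real_setNat]
      · rintro s₁ ⟨h₄, h₅⟩
        refine Reach.of_run trivial ?_
        have hx₁ : s₁.nat x 0 = s'.nat x 0 := by rw [h₅.nat x hx]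
        simp only [Program.run, NExp.eval, State.nat_setNat_same, Function.update_self, hx₁]
        exact ⟨⟨hI _ _ _ h₄, by omega, by omega⟩, by omega⟩
    · rintro s' ⟨h₁, h₂, h₃⟩ hb hf
      have hn' : s'.nat 0 0 = n := by
        rw [hf.nat 0 (by simp [Program.natWrites, h0, hx0]), State.nat_setNat_of_ne _ _ _ hx0, hn]
      simp only [Test.Holds, NExp.eval, hn'] at hb
      have : s'.nat x 0 = n := by omega
      rwa [this] at h₁
  exact key.frame.mono fun s' h => done s' h.2 h.1

end RealRAM

/-! ## Prim's algorithm -/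

/-- State of Prim's algorithm with weights `K` on `n` vertices when `i` vertices belong to the tree:
`ord` lists the vertices, those of the tree first and in the order of their insertion, `par` yields
the positions of parents, and `key` the weights of the edges to parents. For the positions
`q ≥ i` the vertex at position `i - 1` has been taken into account if `q < e`. -/
structure PrimInv (n : ℕ) (K : ℕ → ℕ → ℝ) (i e : ℕ) (ord par : ℕ → ℕ) (key : ℕ → ℝ) : Prop where
  ord_lt : ∀ p < n, ord p < n
  ord_inj : ∀ p < n, ∀ q < n, ord p = ord q → p = q
  par_lt : ∀ m < i, 1 ≤ m → par m < m
  par_out : ∀ p < n, i ≤ p → par p < i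
  key_eq : ∀ p < n, 1 ≤ p → key p = K (ord p) (ord (par p))
  key_le : ∀ m < i, 1 ≤ m → ∀ t < m, ∀ j < n, m ≤ j → key m ≤ K (ord j) (ord t)
  key_out : ∀ t < i, ∀ q < n, i ≤ q → t + 1 < i ∨ q < e → key q ≤ K (ord q) (ord t)

/-- Turns the array contents after an exchange through a temporary cell into composition with a
transposition, the form used by `PrimInv.swap`. -/
theorem Function.update_update_eq_swap {α : Type*} (f : ℕ → α) (i j : ℕ) :
    Function.update (Function.update f i (f j)) j (f i) = fun p => f (Equiv.swap i j p) := by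
  funext p
  by_cases h₁ : p = j
  · subst h₁; simp
  · by_cases h₂ : p = i
    · subst h₂; simp [h₁]
    · simp [h₁, h₂, Equiv.swap_apply_of_ne_of_ne h₂ h₁]

/-- Prim's insertion of the cheapest outside vertex. Parents are stored as positions below `i`,
which the transposition fixes, so no pointer has to be corrected. The cut property of the new tree
edge combines `hmin` with `key_out`. Afterwards the scan index restarts at `i + 1`, as no key takes
the new vertex into account yet. -/
theorem PrimInv.swap {n i j : ℕ} {K : ℕ → ℕ → ℝ} {ord par : ℕ → ℕ} {key : ℕ → ℝ}
    (h : PrimInv n K i n ord par key) (hi : 1 ≤ i) (hij : i ≤ j) (hj : j < n)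
    (hmin : ∀ p < n, i ≤ p → key j ≤ key p) :
    PrimInv n K (i + 1) (i + 1) (fun p => ord (Equiv.swap i j p))
      (fun p => par (Equiv.swap i j p)) (fun p => key (Equiv.swap i j p)) := by
  have hσ : ∀ p, p < i → Equiv.swap i j p = p := fun p hp =>
    Equiv.swap_apply_of_ne_of_ne (by omega) (by omega)
  have hσ' : ∀ p < n, i ≤ p → Equiv.swap i j p < n ∧ i ≤ Equiv.swap i j p := by
    intro p hp hip
    rw [Equiv.swap_apply_def]
    split_ifs <;> omega
  have hσn : ∀ p < n, Equiv.swap i j p < n := fun p hp => by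
    by_cases hip : i ≤ p
    · exact (hσ' p hp hip).1
    · rw [hσ p (by omega)]; exact hp
  constructor
  · exact fun p hp => h.ord_lt _ (hσn p hp)
  · exact fun p hp q hq he => (Equiv.swap i j).injective
      (h.ord_inj _ (hσn p hp) _ (hσn q hq) he)
  · intro m hm h1
    by_cases hmi : m < i
    · simpa [hσ m hmi] using h.par_lt m hmi h1
    · obtain rfl : m = i := by omega
      simpa using h.par_out j hj hij
  · intro p hp hip
    have := hσ' p hp (by omega)
    exact (h.par_out _ this.1 this.2).trans (by omega)
  · intro p hp h1
    by_cases hpi : p < i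
    · have hpp := h.par_lt p hpi h1
      simp only [hσ p hpi, hσ (par p) (by omega)]
      exact h.key_eq p hp h1
    · have h2 := hσ' p hp (by omega)
      have h3 := h.par_out _ h2.1 h2.2
      simp only [hσ _ h3]
      exact h.key_eq _ h2.1 (by omega)
  · intro m hm h1 t ht q hq hmq
    by_cases hmi : m < i
    · simp only [hσ m hmi, hσ t (by omega)]
      by_cases hqi : q < i
      · rw [hσ q hqi]; exact h.key_le m hmi h1 t ht q hq hmq
      · have := hσ' q hq (by omega)
        exact h.key_le m hmi h1 t ht _ this.1 (by omega)
    · obtain rfl : m = i := by omega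
      simp only [Equiv.swap_apply_left, hσ t ht]
      have := hσ' q hq hmq
      exact (hmin _ this.1 this.2).trans (h.key_out t ht _ this.1 this.2 (Or.inr this.1))
  · intro t ht q hq hiq hor
    have h2 := hσ' q hq (by omega)
    have hti : t < i := by omega
    simp only [hσ t hti]
    exact h.key_out t hti _ h2.1 h2.2 (Or.inr h2.1)

theorem PrimInv.skip {n i p : ℕ} {K : ℕ → ℕ → ℝ} {ord par : ℕ → ℕ} {key : ℕ → ℝ}
    (h : PrimInv n K (i + 1) p ord par key) (hle : key p ≤ K (ord p) (ord i)) :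
    PrimInv n K (i + 1) (p + 1) ord par key := by
  refine { h with key_out := ?_ }
  intro t ht q hq hiq hor
  by_cases hqp : q = p
  · subst hqp
    by_cases hti : t = i
    · subst hti; exact hle
    · exact h.key_out t ht q hq hiq (Or.inl (by omega))
  · exact h.key_out t ht q hq hiq (by omega)

/-- Relaxation with the newly inserted vertex at position `i`: the key only decreases, so the bounds
relative to the older tree vertices persist. -/
theorem PrimInv.update {n i p : ℕ} {K : ℕ → ℕ → ℝ} {ord par : ℕ → ℕ} {key : ℕ → ℝ}
    (h : PrimInv n K (i + 1) p ord par key) (hip : i + 1 ≤ p) (hpn : p < n)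
    (hle : K (ord p) (ord i) ≤ key p) :
    PrimInv n K (i + 1) (p + 1) ord (Function.update par p i)
      (Function.update key p (K (ord p) (ord i))) := by
  constructor
  · exact h.ord_lt
  · exact h.ord_inj
  · intro m hm h1
    rw [Function.update_of_ne (by omega)]
    exact h.par_lt m hm h1
  · intro q hq hiq
    by_cases hqp : q = p
    · subst hqp; simp
    · rw [Function.update_of_ne hqp]; exact h.par_out q hq hiq
  · intro q hq h1
    by_cases hqp : q = p
    · subst hqp; simp
    · rw [Function.update_of_ne hqp, Function.update_of_ne hqp]; exact h.key_eq q hq h1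
  · intro m hm h1 t ht j hj hmj
    rw [Function.update_of_ne (by omega)]
    exact h.key_le m hm h1 t ht j hj hmj
  · intro t ht q hq hiq hor
    by_cases hqp : q = p
    · subst hqp
      rw [Function.update_self]
      by_cases hti : t = i
      · subst hti; exact le_rfl
      · exact hle.trans (h.key_out t ht q hq hiq (Or.inl (by omega)))
    · rw [Function.update_of_ne hqp]
      exact h.key_out t ht q hq hiq (by omega)

/-! ### Prim's algorithm as a program -/

namespace RealRAM

/-- `K v w` is the sum of the entries with index `(v, w)` of the matrices in `real` arrays `2` and
`3`. -/
def pairWeight (n : ℕ) (s : State) (v w : ℕ) : ℝ := s.real 3 (v * n + w) + s.real 2 (v * n + w)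

/-- Reads the weight of the pair `(v, w)`; the `nat` array `4` contains the offsets of the rows. -/
def weightExp (v w : NExp) : RExp :=
  .add (.get 3 (.add (.get 4 v) w)) (.get 2 (.add (.get 4 v) w))

/-- The row offsets `v * n` are built by repeated addition, since natural numbers cannot be
multiplied on this machine. -/
def primInitBody : Program :=
  .seq (.setNat 5 (nvar 12) (nvar 12)) <|
  .seq (.setNat 6 (nvar 12) (.const 0)) <|
  .seq (.setNat 4 (.add (nvar 12) (.const 1)) (.add (.get 4 (nvar 12)) (nvar 0)))
    (.setReal 4 (nvar 12) (weightExp (nvar 12) (.const 0)))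

def primArgminBody : Program :=
  .ite (.realLe (.get 4 (nvar 13)) (.get 4 (nvar 12))) .skip (.setNat 13 (.const 0) (nvar 12))

def primSwap : Program :=
  .seq (.setNat 14 (.const 0) (.get 5 (nvar 11))) <|
  .seq (.setNat 5 (nvar 11) (.get 5 (nvar 13))) <|
  .seq (.setNat 5 (nvar 13) (nvar 14)) <|
  .seq (.setNat 14 (.const 0) (.get 6 (nvar 11))) <|
  .seq (.setNat 6 (nvar 11) (.get 6 (nvar 13))) <|
  .seq (.setNat 6 (nvar 13) (nvar 14)) <|
  .seq (.setReal 13 (.const 0) (.get 4 (nvar 11))) <|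
  .seq (.setReal 4 (nvar 11) (.get 4 (nvar 13)))
    (.setReal 4 (nvar 13) (rvar 13))

def primUpdateBody : Program :=
  .seq (.setReal 13 (.const 0) (weightExp (.get 5 (nvar 12)) (.get 5 (nvar 11)))) <|
  .ite (.realLe (.get 4 (nvar 12)) (rvar 13)) .skip <|
  .seq (.setReal 4 (nvar 12) (rvar 13)) (.setNat 6 (nvar 12) (nvar 11))

def primBody : Program :=
  .seq (.setNat 13 (.const 0) (nvar 11)) <|
  .seq (forLoop 12 (nvar 11) primArgminBody) <|
  .seq primSwap (forLoop 12 (.add (nvar 11) (.const 1)) primUpdateBody)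

/-- Prim's algorithm. The vertices are listed in `nat` array `5`, the positions of their parents in
`nat` array `6`, the weights of the tree edges in `real` array `4`. -/
def prim : Program :=
  .seq (.setNat 4 (.const 0) (.const 0)) <|
  .seq (forLoop 12 (.const 0) primInitBody) (forLoop 11 (.const 1) primBody)

theorem reach_primInit {N n : ℕ} {s : State} (hn : s.nat 0 0 = n) (h1 : 1 ≤ n) (hN : n ≤ N)
    (h4 : s.nat 4 0 = 0) :
    Reach N (forLoop 12 (.const 0) primInitBody) (fun s' => (∀ v < n, s'.nat 4 v = v * n) ∧
      PrimInv n (pairWeight n s) 1 n (s'.nat 5) (s'.nat 6) (s'.real 4)) s := by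
  refine Reach.forLoop (n := n) (fun i s' => (∀ v ≤ i, s'.nat 4 v = v * n) ∧ ∀ p < i,
    s'.nat 5 p = p ∧ s'.nat 6 p = 0 ∧ s'.real 4 p = pairWeight n s p 0) (by decide) (by decide)
    (by decide) hn hN (by simp [NExp.eval]) ?_ ?_ ?_ ?_
  · intro i s' z h
    simpa [State.nat_setNat_of_ne] using h
  · simp [NExp.eval, h4]
  · intro i s' _ hi h12 hn' hf ⟨h4', h⟩
    have e2 : s'.real 2 = s.real 2 := hf.real 2 (by decide)
    have e3 : s'.real 3 = s.real 3 := hf.real 3 (by decide)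
    refine Reach.of_run (by simp [primInitBody, Program.LoopFree]) ?_
    simp [primInitBody, weightExp, Program.run, NExp.eval, RExp.eval, State.nat_setNat_of_ne, h12,
      hn', e2, e3]
    constructor
    · intro v hv
      rcases Nat.lt_or_ge i v with hv' | hv'
      · obtain rfl : v = i + 1 := by omega
        simp [h4' i le_rfl, Nat.succ_mul]
      · rw [Function.update_of_ne (by omega)]
        exact h4' v hv'
    · intro p hp
      by_cases hpi : p = i
      · subst hpi
        simp [h4' p le_rfl, pairWeight]
      · simpa [hpi] using h p (by omega)
  · intro s' hf ⟨h4', h⟩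
    refine ⟨fun v hv => h4' v hv.le, ?_⟩
    constructor
    · intro p hp; rw [(h p hp).1]; exact hp
    · intro p hp q hq; rw [(h p hp).1, (h q hq).1]; exact id
    · intro m hm hm'; omega
    · intro p hp _; rw [(h p hp).2.1]; exact Nat.one_pos
    · intro p hp _
      rw [(h p hp).2.2, (h p hp).1, (h p hp).2.1, (h 0 h1).1]
    · intro m hm hm'; omega
    · intro t ht q hq _ _
      obtain rfl : t = 0 := by omega
      rw [(h q hq).2.2, (h q hq).1, (h 0 h1).1]

/-- The first scan finds the minimum key needed by `PrimInv.swap`. The second scan has the parameter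
`e` of `PrimInv` as its loop index and applies `PrimInv.skip` or `PrimInv.update` to each remaining
position. -/
theorem reach_primBody {N n i : ℕ} {K : ℕ → ℕ → ℝ} {s : State} (hn : s.nat 0 0 = n) (hN : n ≤ N)
    (hi : 1 ≤ i) (hin : i < n) (h11 : s.nat 11 0 = i) (hK : pairWeight n s = K)
    (h4 : ∀ v < n, s.nat 4 v = v * n) (h : PrimInv n K i n (s.nat 5) (s.nat 6) (s.real 4)) :
    Reach N primBody (fun s' => PrimInv n K (i + 1) n (s'.nat 5) (s'.nat 6) (s'.real 4)) s := by
  refine Reach.seq (Reach.of_run trivial ?_)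
  simp only [Program.run, NExp.eval, h11]
  refine Reach.seq (Reach.mono (Reach.frame (Reach.forLoop (n := n)
    (Q := fun s' => i ≤ s'.nat 13 0 ∧ s'.nat 13 0 < n ∧
      ∀ p < n, i ≤ p → s'.real 4 (s'.nat 13 0) ≤ s'.real 4 p)
    (fun q s' => i ≤ s'.nat 13 0 ∧ s'.nat 13 0 < n ∧
      ∀ p < q, i ≤ p → s'.real 4 (s'.nat 13 0) ≤ s'.real 4 p) (by decide) (by decide) (by decide)
    (by simpa [State.nat_setNat_of_ne] using hn) hN ?_ ?_ ?_ ?_ (fun s' _ h => h))) ?_)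
  · simp [NExp.eval, State.nat_setNat_of_ne, h11]; omega
  · intro q s' z h
    simpa [State.nat_setNat_of_ne] using h
  · simp [NExp.eval, State.nat_setNat_of_ne, h11]
    refine ⟨by omega, by intros; omega⟩
  · intro q s' hq hqn h12 hn' hf ⟨g1, g2, g3⟩
    simp [NExp.eval, State.nat_setNat_of_ne, h11] at hq
    refine Reach.of_run (by simp [primArgminBody, Program.LoopFree]) ?_
    simp only [primArgminBody, Program.run, NExp.eval, RExp.eval, Test.Holds, h12]
    split_ifs with hle
    · refine ⟨g1, g2, fun p hp hip => ?_⟩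
      by_cases hpq : p = q
      · subst hpq; exact hle
      · exact g3 p (by omega) hip
    · simp only [State.nat_setNat_same, Function.update_self, State.real_setNat]
      refine ⟨hq, hqn, fun p hp hip => ?_⟩
      by_cases hpq : p = q
      · subst hpq; exact le_rfl
      · exact (not_le.1 hle).le.trans (g3 p (by omega) hip)
  · rintro s₁ ⟨⟨g1, g2, g3⟩, hf⟩
    have e5 : s₁.nat 5 = s.nat 5 := by
      rw [hf.nat 5 (by decide), State.nat_setNat_of_ne _ _ _ (by decide)]
    have e6 : s₁.nat 6 = s.nat 6 := by
      rw [hf.nat 6 (by decide), State.nat_setNat_of_ne _ _ _ (by decide)]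
    have e4 : s₁.nat 4 = s.nat 4 := by
      rw [hf.nat 4 (by decide), State.nat_setNat_of_ne _ _ _ (by decide)]
    have e0 : s₁.nat 0 = s.nat 0 := by
      rw [hf.nat 0 (by decide), State.nat_setNat_of_ne _ _ _ (by decide)]
    have e11 : s₁.nat 11 = s.nat 11 := by
      rw [hf.nat 11 (by decide), State.nat_setNat_of_ne _ _ _ (by decide)]
    have r4 : s₁.real 4 = s.real 4 := by rw [hf.real 4 (by decide), State.real_setNat]
    have r2 : s₁.real 2 = s.real 2 := by rw [hf.real 2 (by decide), State.real_setNat]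
    have r3 : s₁.real 3 = s.real 3 := by rw [hf.real 3 (by decide), State.real_setNat]
    rw [r4] at g3
    have hsw := h.swap hi g1 g2 g3
    refine Reach.seq (Reach.mono (Reach.frame (Reach.of_run (by simp [primSwap, Program.LoopFree])
      (Q := fun s' => PrimInv n K (i + 1) (i + 1) (s'.nat 5) (s'.nat 6) (s'.real 4)) ?_)) ?_)
    · simp only [primSwap, Program.run, NExp.eval, RExp.eval, State.nat_setNat_same,
        State.real_setReal_same, State.nat_setReal, State.real_setNat, Function.update_self,
        State.nat_setNat_of_ne _ _ _ (show (5 : ℕ) ≠ 14 by decide),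
        State.nat_setNat_of_ne _ _ _ (show (5 : ℕ) ≠ 6 by decide),
        State.nat_setNat_of_ne _ _ _ (show (6 : ℕ) ≠ 14 by decide),
        State.nat_setNat_of_ne _ _ _ (show (6 : ℕ) ≠ 5 by decide),
        State.nat_setNat_of_ne _ _ _ (show (11 : ℕ) ≠ 5 by decide),
        State.nat_setNat_of_ne _ _ _ (show (11 : ℕ) ≠ 6 by decide),
        State.nat_setNat_of_ne _ _ _ (show (11 : ℕ) ≠ 14 by decide),
        State.nat_setNat_of_ne _ _ _ (show (13 : ℕ) ≠ 5 by decide),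
        State.nat_setNat_of_ne _ _ _ (show (13 : ℕ) ≠ 6 by decide),
        State.nat_setNat_of_ne _ _ _ (show (13 : ℕ) ≠ 14 by decide),
        State.nat_setNat_of_ne _ _ _ (show (14 : ℕ) ≠ 5 by decide),
        State.nat_setNat_of_ne _ _ _ (show (14 : ℕ) ≠ 6 by decide),
        State.real_setReal_of_ne _ _ _ (show (4 : ℕ) ≠ 13 by decide),
        State.real_setReal_of_ne _ _ _ (show (13 : ℕ) ≠ 4 by decide),
        e5, e6, r4, e11, h11, Function.update_update_eq_swap]
      exact hsw
    · rintro s₂ ⟨hp, hf₂⟩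
      have e4' : s₂.nat 4 = s.nat 4 := by rw [hf₂.nat 4 (by decide), e4]
      have e0' : s₂.nat 0 = s.nat 0 := by rw [hf₂.nat 0 (by decide), e0]
      have e11' : s₂.nat 11 = s.nat 11 := by rw [hf₂.nat 11 (by decide), e11]
      have r2' : s₂.real 2 = s.real 2 := by rw [hf₂.real 2 (by decide), r2]
      have r3' : s₂.real 3 = s.real 3 := by rw [hf₂.real 3 (by decide), r3]
      refine Reach.forLoop (n := n) (fun q s' => s'.nat 5 = s₂.nat 5 ∧
        PrimInv n K (i + 1) q (s'.nat 5) (s'.nat 6) (s'.real 4)) (by decide)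
        (by decide) (by decide) (by rw [e0', hn]) hN (by simp [NExp.eval, e11', h11]; omega)
        ?_ ?_ ?_ (fun s' _ h => h.2)
      · intro q s' z h
        simpa [State.nat_setNat_of_ne] using h
      · simpa [NExp.eval, e11', h11] using hp
      · intro q s' hq hqn h12 hn' hf₃ ⟨g5, g⟩
        simp only [NExp.eval, e11', h11] at hq
        have e4'' : s'.nat 4 = s.nat 4 := by rw [hf₃.nat 4 (by decide), e4']
        have e11'' : s'.nat 11 = s.nat 11 := by rw [hf₃.nat 11 (by decide), e11']
        have r2'' : s'.real 2 = s.real 2 := by rw [hf₃.real 2 (by decide), r2']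
        have r3'' : s'.real 3 = s.real 3 := by rw [hf₃.real 3 (by decide), r3']
        have hoff : s'.nat 4 (s'.nat 5 q) = s'.nat 5 q * n := by
          rw [e4'']; exact h4 _ (g.ord_lt q hqn)
        have hKq : s'.real 3 (s'.nat 5 q * n + s'.nat 5 i) + s'.real 2 (s'.nat 5 q * n + s'.nat 5 i)
            = K (s'.nat 5 q) (s'.nat 5 i) := by
          rw [← hK, r2'', r3'', pairWeight]
        refine Reach.of_run (by simp [primUpdateBody, Program.LoopFree]) ?_
        simp only [primUpdateBody, weightExp, Program.run, NExp.eval, RExp.eval, Test.Holds,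
          State.nat_setReal, State.real_setReal_same, Function.update_self, h12, e11'', h11, hoff,
          hKq, State.real_setReal_of_ne _ _ _ (show (4 : ℕ) ≠ 13 by decide)]
        split_ifs with hle
        · simp only [State.nat_setReal, State.real_setReal_of_ne _ _ _ (show (4 : ℕ) ≠ 13 by decide)]
          exact ⟨g5, g.skip hle⟩
        · simp only [State.nat_setReal, State.real_setReal_same, State.real_setNat,
            State.nat_setNat_same, State.nat_setNat_of_ne _ _ _ (show (5 : ℕ) ≠ 6 by decide),
            State.real_setReal_of_ne _ _ _ (show (4 : ℕ) ≠ 13 by decide)]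
          exact ⟨g5, g.update hq hqn (not_le.1 hle).le⟩

theorem reach_prim {N n : ℕ} {s : State} (hn : s.nat 0 0 = n) (h1 : 1 ≤ n) (hN : n ≤ N) :
    Reach N prim (fun s' => (∀ v < n, s'.nat 4 v = v * n) ∧
      PrimInv n (pairWeight n s) n n (s'.nat 5) (s'.nat 6) (s'.real 4)) s := by
  refine Reach.seq (Reach.of_run trivial ?_)
  simp only [Program.run, NExp.eval]
  have hn' : (s.setNat 4 0 0).nat 0 0 = n := by
    rw [State.nat_setNat_of_ne _ _ _ (by decide), hn]
  refine Reach.seq (Reach.mono (Reach.frame (reach_primInit hn' h1 hN (by simp))) ?_)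
  rintro s₁ ⟨⟨h4, h⟩, hf⟩
  have hn₁ : s₁.nat 0 0 = n := by rw [hf.nat 0 (by decide), hn']
  have r2 : s₁.real 2 = s.real 2 := by rw [hf.real 2 (by decide), State.real_setNat]
  have r3 : s₁.real 3 = s.real 3 := by rw [hf.real 3 (by decide), State.real_setNat]
  refine Reach.forLoop (n := n) (fun i s' => (∀ v < n, s'.nat 4 v = v * n) ∧
    PrimInv n (pairWeight n s) i n (s'.nat 5) (s'.nat 6) (s'.real 4)) (by decide) (by decide)
    (by decide) hn₁ hN h1 ?_ ⟨h4, h⟩ ?_ (fun s' _ h => h)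
  · intro i s' z h
    simpa [State.nat_setNat_of_ne] using h
  · intro i s' hi hin h11 hn' hf₂ ⟨h4', h'⟩
    have hK : pairWeight n s' = pairWeight n s := by
      funext v w
      rw [pairWeight, pairWeight, hf₂.real 3 (by decide), hf₂.real 2 (by decide), r2, r3]
    refine Reach.mono (Reach.frame (reach_primBody hn' hN hi hin h11 hK h4' h')) ?_
    rintro s₂ ⟨g, hf₃⟩
    rw [hf₃.nat 4 (by decide)]
    exact ⟨h4', g⟩

end RealRAM

/-! ## The linear program on a path of intervals

All objects are indexed by the positions `0, …, n - 1` of the vertices in the order of Prim's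
algorithm; `d i j` and `c i j` (for `i < j`) are the load and the cost of an edge. -/

open Finset in
/-- The pairs `i < j` of elements of `A`. -/
def pairsIn (A : Finset ℕ) : Finset (ℕ × ℕ) := {p ∈ A ×ˢ A | p.1 < p.2}

theorem mem_pairsIn {A : Finset ℕ} {p : ℕ × ℕ} :
    p ∈ pairsIn A ↔ p.1 ∈ A ∧ p.2 ∈ A ∧ p.1 < p.2 := by
  simp [pairsIn, and_assoc]

theorem pairsIn_mono {A B : Finset ℕ} (h : A ⊆ B) : pairsIn A ⊆ pairsIn B := by
  intro p hp
  rw [mem_pairsIn] at hp ⊢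
  exact ⟨h hp.1, h hp.2.1, hp.2.2⟩

/-- Feasible points of the linear program in terms of pairs of positions. -/
structure PairFeasible (n : ℕ) (d : ℕ → ℕ → ℝ) (b : ℕ → ℝ) (y : ℕ → ℕ → ℝ) : Prop where
  nonneg : ∀ j < n, ∀ i < j, 0 ≤ y i j
  forest : ∀ A ⊆ Finset.range n, A.Nonempty → ∑ p ∈ pairsIn A, y p.1 p.2 ≤ (A.card : ℝ) - 1
  load : ∀ A ⊆ Finset.range n,
    ∑ p ∈ pairsIn A, (1 + d p.1 p.2) * y p.1 p.2 ≤ ∑ v ∈ A, (1 - b v)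

/-- A spanning tree with parent function `par` as it is produced by Prim's algorithm. -/
structure PrimTree (n : ℕ) (d c : ℕ → ℕ → ℝ) (b : ℕ → ℝ) (par : ℕ → ℕ) : Prop where
  d_nonneg : ∀ j < n, ∀ i < j, 0 ≤ d i j
  c_nonneg : ∀ j < n, ∀ i < j, 0 ≤ c i j
  mono : ∀ j < n, ∀ i < j, ∀ j' < n, ∀ i' < j', d i j + c i j ≤ d i' j' + c i' j' →
    d i j ≤ d i' j' ∧ c i j ≤ c i' j'
  b_nonneg : ∀ v < n, 0 ≤ b v
  b_lt_one : ∀ v < n, b v < 1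
  par_lt : ∀ m < n, 1 ≤ m → par m < m
  cut : ∀ m < n, 1 ≤ m → ∀ i < m, ∀ j < n, m ≤ j →
    d (par m) m + c (par m) m ≤ d i j + c i j

/-- Nonnegative edge weights that decrease when loads and costs increase. -/
structure AntiWeight (n : ℕ) (d c : ℕ → ℕ → ℝ) (g : ℕ → ℕ → ℝ) : Prop where
  nonneg : ∀ j < n, ∀ i < j, 0 ≤ g i j
  anti : ∀ j < n, ∀ i < j, ∀ j' < n, ∀ i' < j', d i j ≤ d i' j' → c i j ≤ c i' j' → g i' j' ≤ g i j

/-- The class of admissible weights is closed under the subtraction step of the dual argument,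
because the constraint coefficients `w` increase with the load. This is why optimality is proved for
the whole class and not for one objective. -/
theorem AntiWeight.sub {n : ℕ} {d c g w : ℕ → ℕ → ℝ} (hg : AntiWeight n d c g)
    (hw : ∀ j < n, ∀ i < j, ∀ j' < n, ∀ i' < j', d i j ≤ d i' j' → w i j ≤ w i' j') {l : ℝ}
    (hl : 0 ≤ l) : AntiWeight n d c fun i j => max (g i j - l * w i j) 0 where
  nonneg _ _ _ _ := le_max_right _ _
  anti j hj i hi j' hj' i' hi' hd hc := by
    have h₁ := hg.anti j hj i hi j' hj' i' hi' hd hc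
    have h₂ := mul_le_mul_of_nonneg_left (hw j hj i hi j' hj' i' hi' hd) hl
    exact max_le_max (by linarith) le_rfl

/-- Upper bounds for two vertex sets can be combined, if all edges between the sets are at least as
large as the tree edge `(par m, m)`, the support of `x` on the two sets consists of edges that are
at most as large, and a feasible inequality with coefficients `w` is tight on the union. -/
theorem sum_pairs_union_le {n m : ℕ} {d c g w y : ℕ → ℕ → ℝ} {par : ℕ → ℕ} {x : ℕ → ℝ} {t : ℝ}
    {A B : Finset ℕ} (hA : A ⊆ Finset.range n) (hB : B ⊆ Finset.range n)
    (hm : m < n) (hpm : par m < m)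
    (hg : AntiWeight n d c g) (hw : ∀ j < n, ∀ i < j, 0 < w i j)
    (hwm : ∀ j < n, ∀ i < j, ∀ j' < n, ∀ i' < j', d i j ≤ d i' j' → w i j ≤ w i' j')
    (hy : ∀ j < n, ∀ i < j, 0 ≤ y i j)
    (hcross : ∀ p ∈ pairsIn (A ∪ B), p ∉ pairsIn A → p ∉ pairsIn B →
      d (par m) m ≤ d p.1 p.2 ∧ c (par m) m ≤ c p.1 p.2)
    (hsupp : ∀ p ∈ A ∪ B, x p ≠ 0 → par p < p ∧ d (par p) p ≤ d (par m) m ∧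
      c (par p) p ≤ c (par m) m)
    (hbA : ∀ g, AntiWeight n d c g →
      ∑ p ∈ pairsIn A, g p.1 p.2 * y p.1 p.2 ≤ ∑ p ∈ A, g (par p) p * x p)
    (hbB : ∀ g, AntiWeight n d c g →
      ∑ p ∈ pairsIn B, g p.1 p.2 * y p.1 p.2 ≤ ∑ p ∈ B, g (par p) p * x p)
    (htight : ∑ p ∈ pairsIn (A ∪ B), w p.1 p.2 * y p.1 p.2 ≤
      ∑ p ∈ A, w (par p) p * x p + ∑ p ∈ B, w (par p) p * x p + w (par m) m * t) :
    ∑ p ∈ pairsIn (A ∪ B), g p.1 p.2 * y p.1 p.2 ≤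
      ∑ p ∈ A, g (par p) p * x p + ∑ p ∈ B, g (par p) p * x p + g (par m) m * t := by
  have hw0 := hw m hm _ hpm
  -- The multiplier `l` makes `g - l * w` vanish on the tree edge of `m`. The part `l * w` is
  -- controlled by the tight inequality; the truncated remainder is admissible and is 0 on pairs
  -- crossing between `A` and `B`, where `g` is at most and `l * w` at least its value on the tree
  -- edge.
  obtain ⟨l, hl⟩ : ∃ l, l = g (par m) m / w (par m) m := ⟨_, rfl⟩
  have hl0 : 0 ≤ l := hl ▸ div_nonneg (hg.nonneg m hm _ hpm) hw0.le
  have hlw : l * w (par m) m = g (par m) m := by rw [hl]; field_simp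
  have hg' := hg.sub hwm hl0
  have hUn : A ∪ B ⊆ Finset.range n := Finset.union_subset hA hB
  have hlt : ∀ p ∈ pairsIn (A ∪ B), p.2 < n ∧ p.1 < p.2 := fun p hp => by
    rw [mem_pairsIn] at hp
    exact ⟨Finset.mem_range.1 (hUn hp.2.1), hp.2.2⟩
  have hpt : ∀ p ∈ pairsIn (A ∪ B), g p.1 p.2 * y p.1 p.2 ≤ l * (w p.1 p.2 * y p.1 p.2)
      + (if p ∈ pairsIn A then max (g p.1 p.2 - l * w p.1 p.2) 0 * y p.1 p.2 else 0)
      + (if p ∈ pairsIn B then max (g p.1 p.2 - l * w p.1 p.2) 0 * y p.1 p.2 else 0) := by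
    intro p hp
    obtain ⟨h2, h1⟩ := hlt p hp
    have hyp := hy p.2 h2 p.1 h1
    have hmx : g p.1 p.2 * y p.1 p.2 ≤ l * (w p.1 p.2 * y p.1 p.2)
        + max (g p.1 p.2 - l * w p.1 p.2) 0 * y p.1 p.2 := by
      have := mul_le_mul_of_nonneg_right (le_max_left (g p.1 p.2 - l * w p.1 p.2) 0) hyp
      linarith
    have hnn : 0 ≤ max (g p.1 p.2 - l * w p.1 p.2) 0 * y p.1 p.2 :=
      mul_nonneg (le_max_right _ _) hyp
    by_cases hpA : p ∈ pairsIn A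
    · rw [if_pos hpA]
      split_ifs <;> linarith
    · by_cases hpB : p ∈ pairsIn B
      · rw [if_neg hpA, if_pos hpB]; linarith
      · rw [if_neg hpA, if_neg hpB, add_zero, add_zero, ← mul_assoc]
        obtain ⟨hd, hc⟩ := hcross p hp hpA hpB
        have h₁ := hg.anti m hm _ hpm p.2 h2 p.1 h1 hd hc
        have h₂ := mul_le_mul_of_nonneg_left (hwm m hm _ hpm p.2 h2 p.1 h1 hd) hl0
        exact mul_le_mul_of_nonneg_right (by linarith) hyp
  have hsum := Finset.sum_le_sum hpt
  rw [Finset.sum_add_distrib, Finset.sum_add_distrib, ← Finset.mul_sum, Finset.sum_ite_mem,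
    Finset.sum_ite_mem, Finset.inter_eq_right.2 (pairsIn_mono Finset.subset_union_left),
    Finset.inter_eq_right.2 (pairsIn_mono Finset.subset_union_right)] at hsum
  -- On the support of `x` the edges are no heavier than the tree edge of `m`, so truncation changes
  -- nothing there and the two parts of `g` add up exactly.
  have hconv : ∀ D ⊆ A ∪ B, ∑ p ∈ D, max (g (par p) p - l * w (par p) p) 0 * x p =
      ∑ p ∈ D, g (par p) p * x p - l * ∑ p ∈ D, w (par p) p * x p := by
    intro D hD
    rw [Finset.mul_sum, ← Finset.sum_sub_distrib]
    refine Finset.sum_congr rfl fun p hp => ?_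
    by_cases hxp : x p = 0
    · simp [hxp]
    · obtain ⟨h1, h2, h3⟩ := hsupp p (hD hp) hxp
      have hpn : p < n := Finset.mem_range.1 (hUn (hD hp))
      have h₁ := hg.anti p hpn _ h1 m hm _ hpm h2 h3
      have h₂ := mul_le_mul_of_nonneg_left (hwm p hpn _ h1 m hm _ hpm h2) hl0
      rw [max_eq_left (by linarith)]
      ring
  have h₁ := hbA _ hg'
  have h₂ := hbB _ hg'
  rw [hconv A Finset.subset_union_left] at h₁
  rw [hconv B Finset.subset_union_right] at h₂
  have h₃ := mul_le_mul_of_nonneg_left htight hl0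
  have h₄ : l * (w (par m) m * t) = g (par m) m * t := by rw [← mul_assoc, hlw]
  rw [mul_add, mul_add, h₄] at h₃
  linarith

/-- The positions with label `a`. -/
def interval (n : ℕ) (lab : ℕ → ℕ) (a : ℕ) : Finset ℕ := {p ∈ Finset.range n | lab p = a}

theorem mem_interval {n : ℕ} {lab : ℕ → ℕ} {a p : ℕ} :
    p ∈ interval n lab a ↔ p < n ∧ lab p = a := by simp [interval]

theorem interval_subset {n : ℕ} {lab : ℕ → ℕ} {a : ℕ} : interval n lab a ⊆ Finset.range n :=
  Finset.filter_subset _ _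

/-- Invariant of the greedy algorithm for the linear program: tree edges are processed by increasing
weight, `lab` assigns to every position the first position of its interval, `ld a` is the load of
the interval starting at `a` (which is `1` if a load constraint is tight), and `x` is the solution
of the linear program. -/
structure GreedyInv (n : ℕ) (d c : ℕ → ℕ → ℝ) (b : ℕ → ℝ) (γ : ℝ) (par done lab : ℕ → ℕ)
    (ld x : ℕ → ℝ) : Prop where
  lab_zero : lab 0 = 0
  lab_eq : ∀ p < n, 1 ≤ p → lab p = if 1 ≤ done p ∧ c (par p) p ≤ γ then lab (p - 1) else p
  done_le : ∀ p < n, 1 ≤ p → ∀ m < n, 1 ≤ m → 1 ≤ done p → done m = 0 →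
    d (par p) p + c (par p) p ≤ d (par m) m + c (par m) m
  x_zero : ∀ p < n, lab p = p → x p = 0
  x_nonneg : ∀ p < n, 0 ≤ x p
  ld_nonneg : ∀ a < n, 0 ≤ ld a
  ld_le : ∀ a < n, ld a ≤ 1
  load_eq : ∀ a < n, lab a = a → ∑ p ∈ interval n lab a, (1 + d (par p) p) * x p =
    ∑ p ∈ interval n lab a, (1 - b p) - (1 - ld a)
  bound : ∀ a < n, lab a = a → ∀ g, AntiWeight n d c g → ∀ y, PairFeasible n d b y →
    ∑ p ∈ pairsIn (interval n lab a), g p.1 p.2 * y p.1 p.2 ≤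
      ∑ p ∈ interval n lab a, g (par p) p * x p
  ones : ∀ a < n, lab a = a → ld a < 1 → ∀ p < n, lab p = a → p ≠ a → x p = 1

/-- `m` is the first among the unprocessed tree edges of minimum weight. -/
structure IsNextEdge (n : ℕ) (d c : ℕ → ℕ → ℝ) (par done : ℕ → ℕ) (m : ℕ) : Prop where
  lt : m < n
  pos : 1 ≤ m
  undone : done m = 0
  le : ∀ p < n, 1 ≤ p → done p = 0 → d (par m) m + c (par m) m ≤ d (par p) p + c (par p) p
  first : ∀ p < m, 1 ≤ p → done p = 0 → d (par m) m + c (par m) m < d (par p) p + c (par p) p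

/-- Value of the linear programming solution on an edge of load `w - l₁ - l₂` joining intervals of
loads `l₁` and `l₂`. -/
noncomputable def joinValue (l₁ l₂ u : ℝ) : ℝ :=
  if l₁ < 1 ∧ l₂ < 1 ∧ l₁ + l₂ + u ≤ 1 then 1 else (1 - l₁) / (1 + u) + (1 - l₂) / (1 + u)

namespace GreedyInv

variable {n : ℕ} {d c : ℕ → ℕ → ℝ} {b : ℕ → ℝ} {γ : ℝ} {par done lab : ℕ → ℕ} {ld x : ℕ → ℝ}

theorem lab_le (h : GreedyInv n d c b γ par done lab ld x) : ∀ p < n, lab p ≤ p := by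
  intro p
  induction p with
  | zero => intro _; rw [h.lab_zero]
  | succ p ih =>
    intro hp
    rw [h.lab_eq _ hp (by omega)]
    split_ifs
    · exact (ih (by omega)).trans (by omega)
    · exact le_rfl

theorem lab_contig (h : GreedyInv n d c b γ par done lab ld x) :
    ∀ p < n, ∀ q, lab p ≤ q → q ≤ p → lab q = lab p := by
  intro p
  induction p with
  | zero => intro _ q _ hq; rw [Nat.le_zero.1 hq]
  | succ p ih =>
    intro hp q hlq hq
    rcases Nat.lt_or_ge p q with hpq | hpq
    · rw [show q = p + 1 by omega]
    · have h₁ := h.lab_eq _ hp (by omega)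
      split_ifs at h₁
      · rw [Nat.add_sub_cancel] at h₁
        rw [h₁] at hlq ⊢
        exact ih (by omega) q hlq hpq
      · omega

theorem lab_lab (h : GreedyInv n d c b γ par done lab ld x) {p : ℕ} (hp : p < n) :
    lab (lab p) = lab p := h.lab_contig p hp _ le_rfl (h.lab_le p hp)

/-- A joined position carries the label of its predecessor, which is smaller than the position
itself. -/
theorem not_joined (h : GreedyInv n d c b γ par done lab ld x) {a : ℕ} (ha : a < n) (h1 : 1 ≤ a)
    (hl : lab a = a) : ¬ (1 ≤ done a ∧ c (par a) a ≤ γ) := by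
  intro hc
  have h₁ := h.lab_eq a ha h1
  rw [if_pos hc] at h₁
  have := h.lab_le (a - 1) (by omega)
  omega

theorem joined (h : GreedyInv n d c b γ par done lab ld x) {a : ℕ} (ha : a < n)
    (hl : lab a ≠ a) : 1 ≤ a ∧ 1 ≤ done a ∧ c (par a) a ≤ γ := by
  have h1 : 1 ≤ a := by
    by_contra h0
    obtain rfl : a = 0 := by omega
    exact hl h.lab_zero
  refine ⟨h1, ?_⟩
  by_contra hc
  have h₁ := h.lab_eq a ha h1
  rw [if_neg hc] at h₁
  exact hl h₁

theorem lab_next (h : GreedyInv n d c b γ par done lab ld x) {m : ℕ}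
    (hm : IsNextEdge n d c par done m) : lab m = m := by
  by_contra hl
  have := (h.joined hm.lt hl).2.1
  have := hm.undone
  omega

/-- The tree edge of `m` ends in the interval directly before `m`. Otherwise it would cross the cut
in front of that interval's first position `a`, so by Prim's cut property the tree edge of `a` is no
heavier. If that edge is unprocessed, `m` is not the first minimum; if it is processed, its cost is
at most `γ` and `a` would have been joined to its predecessor. -/
theorem lab_par (h : GreedyInv n d c b γ par done lab ld x) (T : PrimTree n d c b par) {m : ℕ}
    (hm : IsNextEdge n d c par done m) (hγ : c (par m) m ≤ γ) : lab (par m) = lab (m - 1) := by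
  have hmn := hm.lt
  have hm1 := hm.pos
  have hpm := T.par_lt m hmn hm1
  have hle := h.lab_le (m - 1) (by omega)
  by_cases hlt : par m < lab (m - 1)
  · exfalso
    have han : lab (m - 1) < n := by omega
    have hcut := T.cut (lab (m - 1)) han (by omega) (par m) hlt m hmn (by omega)
    have hnj := h.not_joined han (by omega) (h.lab_lab (by omega))
    rcases Nat.eq_zero_or_pos (done (lab (m - 1))) with h0 | h0
    · exact absurd (hm.first _ (by omega) (by omega) h0) (not_lt.2 hcut)
    · refine hnj ⟨h0, ?_⟩
      exact ((T.mono _ han _ (T.par_lt _ han (by omega)) m hmn _ hpm hcut).2).trans hγ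
  · exact h.lab_contig (m - 1) (by omega) _ (by omega) (by omega)

theorem interval_lt (h : GreedyInv n d c b γ par done lab ld x) {m : ℕ}
    (hm : IsNextEdge n d c par done m) {p : ℕ} (hp : p ∈ interval n lab (lab (m - 1))) : p < m := by
  rw [mem_interval] at hp
  have hmn := hm.lt
  have hm1 := hm.pos
  have hle := h.lab_le (m - 1) (by omega)
  by_contra hpm
  have h₁ := h.lab_contig p hp.1 m (by omega) (by omega)
  rw [h.lab_next hm] at h₁
  omega

theorem le_of_mem_interval (h : GreedyInv n d c b γ par done lab ld x) {a p : ℕ}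
    (hp : p ∈ interval n lab a) : a ≤ p := by
  rw [mem_interval] at hp
  have := h.lab_le p hp.1
  omega

theorem initial (T : PrimTree n d c b par) :
    GreedyInv n d c b γ par (fun _ => 0) (fun p => p) b (fun _ => 0) where
  lab_zero := rfl
  lab_eq p _ _ := by simp
  done_le p _ _ m _ _ h := by simp at h
  x_zero _ _ _ := rfl
  x_nonneg _ _ := le_rfl
  ld_nonneg := T.b_nonneg
  ld_le a ha := (T.b_lt_one a ha).le
  load_eq a ha _ := by
    have : interval n (fun p => p) a = {a} := by
      ext p; rw [mem_interval, Finset.mem_singleton]; constructor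
      · exact fun h => h.2
      · rintro rfl; exact ⟨ha, rfl⟩
    rw [this]; simp
  bound a ha _ g _ y _ := by
    have : pairsIn (interval n (fun p => p) a) = ∅ := by
      ext p
      simp only [mem_pairsIn, mem_interval, Finset.notMem_empty, iff_false]
      omega
    rw [this]; simp
  ones a _ _ _ p _ h h' := absurd h h'

theorem skip (h : GreedyInv n d c b γ par done lab ld x) {m : ℕ}
    (hm : IsNextEdge n d c par done m) (hγ : ¬ c (par m) m ≤ γ) :
    GreedyInv n d c b γ par (Function.update done m 1) lab ld x := by
  refine { h with lab_eq := ?_, done_le := ?_ }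
  · intro p hp h1
    by_cases hpm : p = m
    · subst hpm
      rw [if_neg (fun h => hγ h.2)]
      exact h.lab_next hm
    · rw [Function.update_of_ne hpm]
      exact h.lab_eq p hp h1
  · intro p hp hp1 q hq hq1 hdp hdq
    have hqm : q ≠ m := by rintro rfl; simp at hdq
    rw [Function.update_of_ne hqm] at hdq
    by_cases hpm : p = m
    · subst hpm; exact hm.le q hq hq1 hdq
    · rw [Function.update_of_ne hpm] at hdp
      exact h.done_le p hp hp1 q hq hq1 hdp hdq

theorem joinValue_nonneg {l₁ l₂ u : ℝ} (h₁ : l₁ ≤ 1) (h₂ : l₂ ≤ 1) (hu : 0 ≤ u) :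
    0 ≤ joinValue l₁ l₂ u := by
  unfold joinValue
  split_ifs
  · exact zero_le_one
  · have : 0 ≤ 1 - l₁ := by linarith
    have : 0 ≤ 1 - l₂ := by linarith
    positivity

theorem interval_join (h : GreedyInv n d c b γ par done lab ld x) {m : ℕ}
    (hm : IsNextEdge n d c par done m) :
    interval n (fun p => if lab p = m then lab (m - 1) else lab p) (lab (m - 1)) =
      interval n lab (lab (m - 1)) ∪ interval n lab m := by
  have := h.lab_le (m - 1) (by have := hm.lt; omega)
  have := hm.pos
  ext p
  simp only [Finset.mem_union, mem_interval]
  split_ifs with hl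
  · simp only [hl]; tauto
  · simp [hl]

theorem interval_join_of_ne {m a : ℕ} (ha : a ≠ lab (m - 1)) (ham : a ≠ m) :
    interval n (fun p => if lab p = m then lab (m - 1) else lab p) a = interval n lab a := by
  ext p
  simp only [mem_interval]
  split_ifs with hl
  · rw [hl]; constructor
    · rintro ⟨_, rfl⟩; exact absurd rfl ha
    · rintro ⟨_, rfl⟩; exact absurd rfl ham
  · rfl

/-- The induction step of the optimality proof: pairs between the two intervals are at least as
heavy as the tree edge of `m`, all edges with positive value were processed earlier and are at most
as heavy, and some constraint is tight on the union. These are the requirements of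
`sum_pairs_union_le`. -/
theorem join (h : GreedyInv n d c b γ par done lab ld x) (T : PrimTree n d c b par) {m : ℕ}
    (hm : IsNextEdge n d c par done m) (hγ : c (par m) m ≤ γ) :
    GreedyInv n d c b γ par (Function.update done m 1)
      (fun p => if lab p = m then lab (m - 1) else lab p)
      (Function.update ld (lab (m - 1)) (min 1 (ld (lab (m - 1)) + ld m + d (par m) m)))
      (Function.update x m (joinValue (ld (lab (m - 1))) (ld m) (d (par m) m))) := by
  have hmn := hm.lt
  have hm1 := hm.pos
  have hlm := h.lab_next hm
  have hpm := T.par_lt m hmn hm1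
  obtain ⟨a, ha⟩ : ∃ a, a = lab (m - 1) := ⟨_, rfl⟩
  have ham : a ≤ m - 1 := ha ▸ h.lab_le (m - 1) (by omega)
  have han : a < n := by omega
  have hla : lab a = a := by rw [ha]; exact h.lab_lab (by omega)
  have hu := T.d_nonneg m hmn _ hpm
  have hla0 := h.ld_nonneg a han
  have hlm0 := h.ld_nonneg m hmn
  have hla1 := h.ld_le a han
  have hlm1 := h.ld_le m hmn
  have hxm : x m = 0 := h.x_zero m hmn hlm
  have hint := h.interval_join hm
  have hltA : ∀ p ∈ interval n lab a, p < m := fun p hp => h.interval_lt hm (ha ▸ hp)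
  have hdisj : Disjoint (interval n lab a) (interval n lab m) := by
    rw [Finset.disjoint_left]
    intro p hp hp'
    rw [mem_interval] at hp hp'
    omega
  have hmA : m ∉ interval n lab a := fun hmem => (hltA m hmem).ne rfl
  have hmB : m ∈ interval n lab m := mem_interval.2 ⟨hmn, hlm⟩
  rw [← ha] at hint ⊢
  obtain ⟨t, ht⟩ : ∃ t, t = joinValue (ld a) (ld m) (d (par m) m) := ⟨_, rfl⟩
  rw [← ht]
  have hsumupd : ∀ f : ℕ → ℝ, ∑ p ∈ interval n lab a ∪ interval n lab m,
      f p * Function.update x m t p =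
      ∑ p ∈ interval n lab a, f p * x p + ∑ p ∈ interval n lab m, f p * x p + f m * t := by
    intro f
    rw [Finset.sum_union hdisj, add_assoc]
    congr 1
    · refine Finset.sum_congr rfl fun p hp => ?_
      rw [Function.update_of_ne (by rintro rfl; exact hmA hp)]
    · rw [← Finset.add_sum_erase _ _ hmB, ← Finset.add_sum_erase _ (fun p => f p * x p) hmB,
        Function.update_self, hxm, mul_zero, zero_add, add_comm]
      congr 1
      refine Finset.sum_congr rfl fun p hp => ?_
      rw [Function.update_of_ne (Finset.ne_of_mem_erase hp)]
  -- The quantity `1 - ld` is the slack of the load constraint. The new edge uses up `(1 + u) * t`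
  -- of the two slacks; in the second case of `joinValue` nothing is left.
  have hloadt : (1 + d (par m) m) * t =
      (1 - ld a) + (1 - ld m) - (1 - min 1 (ld a + ld m + d (par m) m)) := by
    rw [ht, joinValue]
    split_ifs with hc
    · rw [min_eq_right hc.2.2]; ring
    · have : 1 ≤ ld a + ld m + d (par m) m := by
        by_contra hlt
        push Not at hlt
        exact hc ⟨by linarith, by linarith, hlt.le⟩
      rw [min_eq_left this]
      field_simp
      ring
  have hdone : ∀ p < n, x p ≠ 0 → par p < p ∧ d (par p) p ≤ d (par m) m ∧
      c (par p) p ≤ c (par m) m := by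
    intro p hp hxp
    have hlp : lab p ≠ p := fun hl => hxp (h.x_zero p hp hl)
    obtain ⟨h1, h2, -⟩ := h.joined hp hlp
    have hpp := T.par_lt p hp h1
    exact ⟨hpp, T.mono p hp _ hpp m hmn _ hpm (h.done_le p hp h1 m hmn hm1 h2 hm.undone)⟩
  have hoff : ∀ a' < n, (if lab a' = m then a else lab a') = a' → a' ≠ a →
      lab a' = a' ∧ a' ≠ m := by
    intro a' ha' hl hne
    split_ifs at hl with hl'
    · exact absurd hl.symm hne
    · refine ⟨hl, ?_⟩
      rintro rfl; exact hl' hl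
  have hne : ∀ a', a' ≠ a → a' ≠ m →
      interval n (fun p => if lab p = m then a else lab p) a' = interval n lab a' := by
    intro a' h₁ h₂
    rw [ha]; exact interval_join_of_ne (ha ▸ h₁) h₂
  have hsumne : ∀ a', a' ≠ m → ∀ f : ℕ → ℝ, ∑ p ∈ interval n lab a', f p * Function.update x m t p =
      ∑ p ∈ interval n lab a', f p * x p := by
    intro a' h₁ f
    refine Finset.sum_congr rfl fun p hp => ?_
    rw [Function.update_of_ne]
    rintro rfl
    exact h₁ ((mem_interval.1 hp).2.symm.trans hlm)
  refine ⟨?_, ?_, ?_, ?_, ?_, ?_, ?_, ?_, ?_, ?_⟩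
  · rw [h.lab_zero, if_neg (by omega)]
  · intro p hp hp1
    by_cases hpm' : p = m
    · subst hpm'
      rw [if_pos hlm, Function.update_self, if_pos ⟨le_rfl, hγ⟩, ← ha, if_neg (by omega)]
    · rw [Function.update_of_ne hpm']
      have h₁ := h.lab_eq p hp hp1
      split_ifs at h₁ ⊢ <;> omega
  · intro p hp hp1 q hq hq1 hdp hdq
    have hqm : q ≠ m := by rintro rfl; simp at hdq
    rw [Function.update_of_ne hqm] at hdq
    by_cases hpm' : p = m
    · subst hpm'; exact hm.le q hq hq1 hdq
    · rw [Function.update_of_ne hpm'] at hdp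
      exact h.done_le p hp hp1 q hq hq1 hdp hdq
  · intro p hp hl
    have hpm' : p ≠ m := by
      rintro rfl; rw [if_pos hlm] at hl; omega
    rw [Function.update_of_ne hpm']
    by_cases hpa : p = a
    · subst hpa; exact h.x_zero p hp hla
    · exact h.x_zero p hp (hoff p hp hl hpa).1
  · intro p hp
    by_cases hpm' : p = m
    · subst hpm'
      rw [Function.update_self, ht]
      exact joinValue_nonneg hla1 hlm1 hu
    · rw [Function.update_of_ne hpm']; exact h.x_nonneg p hp
  · intro p hp
    by_cases hpa : p = a
    · subst hpa
      rw [Function.update_self]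
      exact le_min zero_le_one (by linarith)
    · rw [Function.update_of_ne hpa]; exact h.ld_nonneg p hp
  · intro p hp
    by_cases hpa : p = a
    · subst hpa
      rw [Function.update_self]
      exact min_le_left _ _
    · rw [Function.update_of_ne hpa]; exact h.ld_le p hp
  · intro a' ha' hl
    by_cases haa : a' = a
    · subst haa
      rw [hint, hsumupd, Function.update_self, Finset.sum_union hdisj, h.load_eq a' ha' hla,
        h.load_eq m hmn hlm, hloadt]
      ring
    · obtain ⟨h₁, h₂⟩ := hoff a' ha' hl haa
      rw [hne a' haa h₂, hsumne a' h₂, Function.update_of_ne haa]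
      exact h.load_eq a' ha' h₁
  · intro a' ha' hl g hg y hy
    by_cases haa : a' = a
    · subst haa
      rw [hint, hsumupd (fun p => g (par p) p)]
      have hcross : ∀ p ∈ pairsIn (interval n lab a' ∪ interval n lab m),
          p ∉ pairsIn (interval n lab a') → p ∉ pairsIn (interval n lab m) →
          d (par m) m ≤ d p.1 p.2 ∧ c (par m) m ≤ c p.1 p.2 := by
        intro p hp hpA hpB
        simp only [mem_pairsIn, Finset.mem_union] at hp hpA hpB
        obtain ⟨h₁, h₂, h₃⟩ := hp
        have h₄ : p.1 < m ∧ m ≤ p.2 := by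
          rcases h₁ with h₁ | h₁ <;> rcases h₂ with h₂ | h₂
          · exact absurd ⟨h₁, h₂, h₃⟩ hpA
          · exact ⟨hltA _ h₁, h.le_of_mem_interval h₂⟩
          · have := hltA _ h₂
            have := h.le_of_mem_interval h₁
            omega
          · exact absurd ⟨h₁, h₂, h₃⟩ hpB
        have h₅ : p.2 < n := by
          rcases h₂ with h₂ | h₂ <;> exact (mem_interval.1 h₂).1
        exact T.mono m hmn _ hpm _ h₅ _ h₃ (T.cut m hmn hm1 _ h₄.1 _ h₅ h₄.2)
      have hsupp : ∀ p ∈ interval n lab a' ∪ interval n lab m, x p ≠ 0 →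
          par p < p ∧ d (par p) p ≤ d (par m) m ∧ c (par p) p ≤ c (par m) m := by
        intro p hp hxp
        refine hdone p ?_ hxp
        rcases Finset.mem_union.1 hp with hp | hp <;> exact (mem_interval.1 hp).1
      have hsub : interval n lab a' ∪ interval n lab m ⊆ Finset.range n :=
        Finset.union_subset interval_subset interval_subset
      -- If everything fits, all tree edges inside the union have value 1 and its forest constraint
      -- is tight, so `w = 1`. Otherwise its load constraint is tight and `w = 1 + d`.
      by_cases hc : ld a' < 1 ∧ ld m < 1 ∧ ld a' + ld m + d (par m) m ≤ 1
      · refine sum_pairs_union_le (w := fun _ _ => 1) interval_subset interval_subset hmn hpm hg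
          (fun _ _ _ _ => one_pos) (fun _ _ _ _ _ _ _ _ _ => le_rfl) hy.nonneg hcross hsupp
          (fun g hg => h.bound a' ha' hla g hg y hy) (fun g hg => h.bound m hmn hlm g hg y hy) ?_
        have hone : ∀ e < n, lab e = e → ld e < 1 → ∑ p ∈ interval n lab e, 1 * x p =
            ((interval n lab e).card : ℝ) - 1 := by
          intro e he hle hlt
          have hmem : e ∈ interval n lab e := mem_interval.2 ⟨he, hle⟩
          rw [← Finset.add_sum_erase _ _ hmem, h.x_zero e he hle, mul_zero, zero_add,
            Finset.sum_congr rfl (g := fun _ => (1 : ℝ)), Finset.sum_const,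
            Finset.card_erase_of_mem hmem, nsmul_eq_mul, mul_one, Nat.cast_sub, Nat.cast_one]
          · exact Finset.card_pos.2 ⟨e, hmem⟩
          · intro p hp
            have hp' := mem_interval.1 (Finset.mem_of_mem_erase hp)
            rw [h.ones e he hle hlt p hp'.1 hp'.2 (Finset.ne_of_mem_erase hp), mul_one]
        rw [hone a' ha' hla hc.1, hone m hmn hlm hc.2.1, ht, joinValue, if_pos hc]
        have h₁ := hy.forest _ hsub ⟨m, Finset.mem_union_right _ hmB⟩
        rw [Finset.card_union_of_disjoint hdisj, Nat.cast_add] at h₁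
        simp only [one_mul]
        linarith
      · refine sum_pairs_union_le (w := fun i j => 1 + d i j) interval_subset interval_subset hmn
          hpm hg (fun j hj i hi => by have := T.d_nonneg j hj i hi; linarith)
          (fun _ _ _ _ _ _ _ _ h => by linarith) hy.nonneg hcross hsupp
          (fun g hg => h.bound a' ha' hla g hg y hy) (fun g hg => h.bound m hmn hlm g hg y hy) ?_
        have h₁ := hy.load _ hsub
        rw [Finset.sum_union hdisj] at h₁
        have h₂ := h.load_eq a' ha' hla
        have h₃ := h.load_eq m hmn hlm
        have h₄ : (1 : ℝ) ≤ ld a' + ld m + d (par m) m := by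
          by_contra hlt
          push Not at hlt
          exact hc ⟨by linarith, by linarith, hlt.le⟩
        rw [min_eq_left h₄] at hloadt
        linarith
    · obtain ⟨h₁, h₂⟩ := hoff a' ha' hl haa
      rw [hne a' haa h₂, hsumne a' h₂ (fun p => g (par p) p)]
      exact h.bound a' ha' h₁ g hg y hy
  · intro a' ha' hl hlt p hp hlp hpa
    by_cases haa : a' = a
    · subst haa
      rw [Function.update_self] at hlt
      have hw : ld a' + ld m + d (par m) m < 1 := by
        rcases min_lt_iff.1 hlt with h₁ | h₁
        · exact absurd h₁ (lt_irrefl _)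
        · exact h₁
      by_cases hpm' : p = m
      · subst hpm'
        rw [Function.update_self, ht, joinValue, if_pos ⟨by linarith, by linarith, hw.le⟩]
      · rw [Function.update_of_ne hpm']
        split_ifs at hlp with hl'
        · exact h.ones m hmn hlm (by linarith) p hp hl' hpm'
        · exact h.ones a' ha' hla (by linarith) p hp hlp hpa
    · obtain ⟨h₁, h₂⟩ := hoff a' ha' hl haa
      rw [Function.update_of_ne haa] at hlt
      split_ifs at hlp with hl'
      · exact absurd hlp.symm haa
      · rw [Function.update_of_ne]
        · exact h.ones a' ha' h₁ hlt p hp hlp hpa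
        · rintro rfl; exact hl' hlm

/-- When all tree edges have been processed, `x` is an optimum solution of the linear program. -/
theorem optimal (h : GreedyInv n d c b γ par done lab ld x) (T : PrimTree n d c b par)
    (hdone : ∀ p < n, 1 ≤ p → 1 ≤ done p) {y : ℕ → ℕ → ℝ} (hy : PairFeasible n d b y) :
    ∑ p ∈ pairsIn (Finset.range n), (γ - c p.1 p.2) * y p.1 p.2 ≤
      ∑ p ∈ Finset.range n, (γ - c (par p) p) * x p := by
  -- Truncation at 0 discards the unprofitable pairs, giving an admissible weight to which `bound`
  -- applies on each final interval.
  have hg : AntiWeight n d c fun i j => max (γ - c i j) 0 :=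
    ⟨fun _ _ _ _ => le_max_right _ _, fun _ _ _ _ _ _ _ _ _ h =>
      max_le_max (by linarith) le_rfl⟩
  have hlt : ∀ p ∈ pairsIn (Finset.range n), p.1 < p.2 ∧ p.2 < n := by
    intro p hp
    rw [mem_pairsIn] at hp
    exact ⟨hp.2.2, Finset.mem_range.1 hp.2.1⟩
  calc ∑ p ∈ pairsIn (Finset.range n), (γ - c p.1 p.2) * y p.1 p.2
      ≤ ∑ p ∈ pairsIn (Finset.range n), ∑ a ∈ Finset.range n,
        if lab a = a ∧ p ∈ pairsIn (interval n lab a) then max (γ - c p.1 p.2) 0 * y p.1 p.2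
          else 0 := by
        refine Finset.sum_le_sum fun p hp => ?_
        obtain ⟨h₁, h₂⟩ := hlt p hp
        have hyp := hy.nonneg _ h₂ _ h₁
        have hnn : 0 ≤ max (γ - c p.1 p.2) 0 * y p.1 p.2 := mul_nonneg (le_max_right _ _) hyp
        by_cases hl : lab p.1 = lab p.2
        · have hln : lab p.2 < n := (h.lab_le _ h₂).trans_lt h₂
          refine le_trans ?_ (Finset.single_le_sum (fun a _ => ?_) (Finset.mem_range.2 hln))
          · rw [if_pos]
            · exact mul_le_mul_of_nonneg_right (le_max_left _ _) hyp
            · refine ⟨h.lab_lab h₂, mem_pairsIn.2 ⟨?_, ?_, h₁⟩⟩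
              · exact mem_interval.2 ⟨h₁.trans h₂, hl⟩
              · exact mem_interval.2 ⟨h₂, rfl⟩
          · split_ifs
            · exact hnn
            · exact le_rfl
        -- A pair in different final intervals crosses the cut before `lab p.2`. The tree edge there
        -- was rejected, so it costs more than `γ`, and by the cut property the pair costs at least
        -- as much.
        · have hcγ : γ ≤ c p.1 p.2 := by
            have hl2 := h.lab_le _ h₂
            have hl1 : p.1 < lab p.2 := by
              by_contra hge
              exact hl (h.lab_contig _ h₂ _ (by omega) h₁.le)
            have hln : lab p.2 < n := by omega
            have h₃ := h.not_joined hln (by omega) (h.lab_lab h₂)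
            have h₄ := hdone _ hln (by omega)
            have h₅ := T.cut _ hln (by omega) _ hl1 _ h₂ hl2
            have h₆ := T.mono _ hln _ (T.par_lt _ hln (by omega)) _ h₂ _ h₁ h₅
            have h₇ : γ < c (par (lab p.2)) (lab p.2) := not_le.1 fun h => h₃ ⟨h₄, h⟩
            linarith [h₆.2]
          refine le_trans (mul_nonpos_of_nonpos_of_nonneg (by linarith) hyp)
            (Finset.sum_nonneg fun a _ => ?_)
          split_ifs
          · exact hnn
          · exact le_rfl
    _ = ∑ a ∈ Finset.range n, if lab a = a then
          ∑ p ∈ pairsIn (interval n lab a), max (γ - c p.1 p.2) 0 * y p.1 p.2 else 0 := by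
        rw [Finset.sum_comm]
        refine Finset.sum_congr rfl fun a _ => ?_
        split_ifs with hl
        · simp only [hl, true_and]
          rw [Finset.sum_ite_mem, Finset.inter_eq_right.2 (pairsIn_mono interval_subset)]
        · simp [hl]
    _ ≤ ∑ a ∈ Finset.range n, ∑ p ∈ interval n lab a, (γ - c (par p) p) * x p := by
        refine Finset.sum_le_sum fun a ha => ?_
        -- Only joined positions have nonzero value, and their tree edges cost at most `γ`, so the
        -- truncation is inactive.
        have hsimp : ∀ p ∈ interval n lab a, max (γ - c (par p) p) 0 * x p =
            (γ - c (par p) p) * x p := by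
          intro p hp
          have hpn := (mem_interval.1 hp).1
          by_cases hl : lab p = p
          · rw [h.x_zero p hpn hl, mul_zero, mul_zero]
          · rw [max_eq_left (by linarith [(h.joined hpn hl).2.2])]
        split_ifs with hl
        · rw [← Finset.sum_congr rfl hsimp]
          exact h.bound a (Finset.mem_range.1 ha) hl _ hg y hy
        · rw [← Finset.sum_congr rfl hsimp]
          exact Finset.sum_nonneg fun p hp =>
            mul_nonneg (le_max_right _ _) (h.x_nonneg p (mem_interval.1 hp).1)
    _ = ∑ p ∈ Finset.range n, (γ - c (par p) p) * x p :=
        Finset.sum_fiberwise_of_maps_to (fun p hp => Finset.mem_range.2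
          ((h.lab_le p (Finset.mem_range.1 hp)).trans_lt (Finset.mem_range.1 hp))) _

end GreedyInv

/-! ## Budgets of the trees of the rounded solution -/

theorem Finset.sum_update_eq {α : Type*} [DecidableEq α] {s : Finset α} {i : α} (hi : i ∈ s)
    (f : α → ℝ) (v : ℝ) : ∑ x ∈ s, Function.update f i v x = ∑ x ∈ s, f x - f i + v := by
  rw [Finset.sum_update_of_mem hi, ← Finset.sum_sdiff (Finset.singleton_subset_iff.2 hi),
    Finset.sum_singleton]
  ring

/-- Total load of the vertices with root `r` and of the edges that connect them to their parents. -/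
noncomputable def rootLoad (n : ℕ) (d : ℕ → ℕ → ℝ) (b : ℕ → ℝ) (par kept rt : ℕ → ℕ) (r : ℕ) : ℝ :=
  ∑ v ∈ Finset.range n with rt v = r, (b v + if 1 ≤ kept v then d (par v) v else 0)

/-- Invariant for rounding: `kept` marks the edges to parents that belong to the rounded forest,
`rt` assigns to every vertex the root of its tree, and `S r` is the number of trees into which the
tree with root `r` may be split. -/
structure BudgetInv (n : ℕ) (d c : ℕ → ℕ → ℝ) (b : ℕ → ℝ) (par lab kept : ℕ → ℕ) (ld x S : ℕ → ℝ)
    (rt : ℕ → ℕ) : Prop where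
  kept_joined : ∀ p < n, 1 ≤ kept p → lab p ≠ p ∧ lab (par p) = lab p
  rt_eq : ∀ p < n, rt p = if 1 ≤ kept p then rt (par p) else p
  rt_le : ∀ p < n, rt p ≤ p
  lab_rt : ∀ p < n, lab (rt p) = lab p
  kept_rt : ∀ p < n, kept (rt p) = 0
  one_le : ∀ r < n, kept r = 0 → 1 ≤ S r
  load_le : ∀ r < n, kept r = 0 → 2 * rootLoad n d b par kept rt r ≤ S r
  vertex_le : ∀ v < n, 2 * rootLoad n d b par kept rt (rt v) + 2 * b v - 1 ≤ S (rt v)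
  ld_lt : ∀ a < n, lab a = a → ld a < 1 → ld a = rootLoad n d b par kept rt a ∧ S a = 3 ∧
    ∀ p < n, lab p = a → rt p = a
  sum_le : ∑ r ∈ Finset.range n with kept r = 0, S r ≤ 3 * ((n : ℝ) - ∑ p ∈ Finset.range n, x p)
  cost_le : ∑ p ∈ Finset.range n with 1 ≤ kept p, 2 * c (par p) p ≤
    3 * ∑ p ∈ Finset.range n, c (par p) p * x p

/-- The budget that results from attaching a tree of small load `l₁`. -/
theorem attach_budget {l₁ l₂ u S₂ L₂ x₁ x₂ : ℝ} (hl₁ : 0 ≤ l₁) (hl₂ : 0 ≤ l₂)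
    (hl₂' : l₂ ≤ 1) (hu : 0 ≤ u) (hsmall : 2 * (1 + u) < 3 * (1 - l₁)) (hw : 1 ≤ l₁ + l₂ + u)
    (hx₁ : x₁ * (1 + u) = 1 - l₁) (hx₂ : x₂ * (1 + u) = 1 - l₂)
    (hd : l₂ < 1 → S₂ = 3 ∧ l₂ = L₂) (h1 : 1 ≤ S₂) (hL : 2 * L₂ ≤ S₂) :
    1 ≤ S₂ + 3 - 3 * (x₁ + x₂) ∧ 2 * (L₂ + l₁ + u) ≤ S₂ + 3 - 3 * (x₁ + x₂) ∧
    (∀ β, β ≤ L₂ → β ≤ 1 → 2 * L₂ + 2 * β - 1 ≤ S₂ →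
      2 * (L₂ + l₁ + u) + 2 * β - 1 ≤ S₂ + 3 - 3 * (x₁ + x₂)) ∧
    ∀ β, β ≤ l₁ → 2 * (L₂ + l₁ + u) + 2 * β - 1 ≤ S₂ + 3 - 3 * (x₁ + x₂) := by
  have hu1 : 0 < 1 + u := by linarith
  have hx₁' : 2 / 3 < x₁ := by
    by_contra hle
    push Not at hle
    have := mul_le_mul_of_nonneg_right hle hu1.le
    linarith
  have hx₁1 : x₁ ≤ 1 := by
    by_contra hle
    push Not at hle
    have := mul_lt_mul_of_pos_right hle hu1
    linarith
  have hsum : x₁ + x₂ ≤ 1 := by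
    by_contra hle
    push Not at hle
    have := mul_lt_mul_of_pos_right hle hu1
    linarith
  have hu2 : u < 1 / 2 := by linarith
  -- From `x₁ * (1 + u) = 1 - l₁` one gets `l₁ + u = (1 - x₁) * (1 + u)`, and `1 + u ≤ 3 / 2`. Thus
  -- what the attached tree retains of its budget 3 covers twice its own load together with the load
  -- of the edge.
  have hq : 2 * (l₁ + u) ≤ 3 - 3 * x₁ := by
    nlinarith [mul_nonneg (sub_nonneg.2 hx₁1) (sub_nonneg.2 hu2.le)]
  rcases hl₂'.lt_or_eq with hlt | rfl
  · obtain ⟨rfl, rfl⟩ := hd hlt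
    have hx₂0 : x₂ ≤ 1 := by linarith
    have h3 : l₂ ≤ 1 - x₂ := by
      nlinarith [mul_nonneg (sub_nonneg.2 hx₂0) hu, mul_nonneg hl₂ hu]
    refine ⟨by linarith, by linarith, fun β hβ hβ1 _ => by linarith, fun β hβ => by linarith⟩
  · have hx₂0 : x₂ = 0 := by
      have : x₂ * (1 + u) = 0 := by linarith
      rcases mul_eq_zero.1 this with h | h
      · exact h
      · linarith
    subst hx₂0
    refine ⟨by linarith, by linarith, fun β hβ hβ1 _ => by linarith, fun β hβ => by linarith⟩

namespace BudgetInv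

variable {n : ℕ} {d c : ℕ → ℕ → ℝ} {b : ℕ → ℝ} {γ : ℝ} {par done lab kept rt : ℕ → ℕ}
  {ld x S : ℕ → ℝ}

theorem initial (T : PrimTree n d c b par) :
    BudgetInv n d c b par (fun p => p) (fun _ => 0) b (fun _ => 0) (fun _ => 3) (fun p => p) := by
  have hL : ∀ r < n, rootLoad n d b par (fun _ => 0) (fun p => p) r = b r := by
    intro r hr
    have : (Finset.range n).filter (fun v => v = r) = {r} := by
      ext v; simp only [Finset.mem_filter, Finset.mem_range, Finset.mem_singleton]; constructor
      · exact fun h => h.2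
      · rintro rfl; exact ⟨hr, rfl⟩
    rw [rootLoad, this]; simp
  refine ⟨by simp, by simp, fun _ _ => le_rfl, fun _ _ => rfl, fun _ _ => rfl, ?_, ?_, ?_, ?_, ?_,
    by simp⟩
  · intros; norm_num
  · intro r hr _; rw [hL r hr]; linarith [T.b_lt_one r hr]
  · intro r hr; rw [hL r hr]; linarith [T.b_lt_one r hr]
  · intro a ha _ _
    exact ⟨(hL a ha).symm, rfl, fun p _ h => h⟩
  · simp [mul_comm]

theorem b_le_rootLoad (h : BudgetInv n d c b par lab kept ld x S rt)
    (G : GreedyInv n d c b γ par done lab ld x) (T : PrimTree n d c b par) {v : ℕ} (hv : v < n) :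
    b v ≤ rootLoad n d b par kept rt (rt v) := by
  have hnn : ∀ w < n, 0 ≤ if 1 ≤ kept w then d (par w) w else 0 := by
    intro w hw
    split_ifs with hk
    · exact T.d_nonneg w hw _ (T.par_lt w hw (G.joined hw (h.kept_joined w hw hk).1).1)
    · exact le_rfl
  refine le_trans (le_add_of_nonneg_right (hnn v hv)) ?_
  refine Finset.single_le_sum (f := fun v => b v + if 1 ≤ kept v then d (par v) v else 0) ?_
    (Finset.mem_filter.2 ⟨Finset.mem_range.2 hv, rfl⟩)
  intro w hw
  have hwn := Finset.mem_range.1 (Finset.mem_filter.1 hw).1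
  exact add_nonneg (T.b_nonneg w hwn) (hnn w hwn)

theorem kept_of_lab (h : BudgetInv n d c b par lab kept ld x S rt) {a : ℕ} (ha : a < n)
    (hl : lab a = a) : kept a = 0 := by
  by_contra hk
  exact (h.kept_joined a ha (by omega)).1 hl

/-- The edge `m` is added to the rounded forest. -/
theorem join_keep (h : BudgetInv n d c b par lab kept ld x S rt)
    (G : GreedyInv n d c b γ par done lab ld x) (T : PrimTree n d c b par) {m : ℕ}
    (hm : IsNextEdge n d c par done m) (hγ : c (par m) m ≤ γ)
    (hK : ld (lab (m - 1)) + ld m + d (par m) m ≤ 1 ∨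
      2 * (1 + d (par m) m) < 3 * (1 - ld (lab (m - 1))) ∨
      2 * (1 + d (par m) m) < 3 * (1 - ld m)) :
    ∃ S' rt', BudgetInv n d c b par (fun p => if lab p = m then lab (m - 1) else lab p)
      (Function.update kept m 1)
      (Function.update ld (lab (m - 1)) (min 1 (ld (lab (m - 1)) + ld m + d (par m) m)))
      (Function.update x m (joinValue (ld (lab (m - 1))) (ld m) (d (par m) m))) S' rt' := by
  have hmn := hm.lt
  have hm1 := hm.pos
  have hlm := G.lab_next hm
  have hpm := T.par_lt m hmn hm1
  have hlp := G.lab_par T hm hγ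
  obtain ⟨a, ha⟩ : ∃ a, a = lab (m - 1) := ⟨_, rfl⟩
  have ham : a ≤ m - 1 := ha ▸ G.lab_le (m - 1) (by omega)
  have han : a < n := by omega
  have hla : lab a = a := by rw [ha]; exact G.lab_lab (by omega)
  rw [← ha] at hK hlp ⊢
  obtain ⟨u, hu⟩ : ∃ u, u = d (par m) m := ⟨_, rfl⟩
  have hu0 : 0 ≤ u := hu ▸ T.d_nonneg m hmn _ hpm
  rw [← hu] at hK ⊢
  have hkm : kept m = 0 := h.kept_of_lab hmn hlm
  have hrtm : rt m = m := by rw [h.rt_eq m hmn, if_neg (by omega)]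
  obtain ⟨r, hr⟩ : ∃ r, r = rt (par m) := ⟨_, rfl⟩
  have hrm : r < m := hr ▸ (h.rt_le _ (by omega)).trans_lt hpm
  have hrn : r < n := by omega
  have hlr : lab r = a := by rw [hr, h.lab_rt _ (by omega), hlp]
  have hkr : kept r = 0 := by rw [hr]; exact h.kept_rt _ (by omega)
  have hrtr : rt r = r := by rw [h.rt_eq r hrn, if_neg (by omega)]
  -- Before the join, `m` is the root of its own rounded tree. Merging adds both loads and `u`, the
  -- latter because the edge of `m` now counts as kept.
  have hLr : rootLoad n d b par (Function.update kept m 1) (fun v => if rt v = m then r else rt v) r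
      = rootLoad n d b par kept rt r + rootLoad n d b par kept rt m + u := by
    simp only [rootLoad, Finset.sum_filter]
    rw [← Finset.sum_add_distrib]
    have : u = ∑ v ∈ Finset.range n, if v = m then u else 0 := by
      rw [Finset.sum_ite_eq', if_pos (Finset.mem_range.2 hmn)]
    conv_rhs => rw [this]
    rw [← Finset.sum_add_distrib]
    refine Finset.sum_congr rfl fun v _ => ?_
    by_cases hv : v = m
    · subst hv
      simp [hrtm, hkm, hrm.ne', hu]
    · rw [Function.update_of_ne hv]
      by_cases hv' : rt v = m
      · simp [hv, hv', hrm.ne']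
      · simp [hv, hv']
  have hLq : ∀ q, q ≠ r → q ≠ m → rootLoad n d b par (Function.update kept m 1)
      (fun v => if rt v = m then r else rt v) q = rootLoad n d b par kept rt q := by
    intro q hqr hqm
    simp only [rootLoad, Finset.sum_filter]
    refine Finset.sum_congr rfl fun v _ => ?_
    by_cases hv : v = m
    · subst hv
      rw [if_pos hrtm, if_neg (Ne.symm hqr), hrtm, if_neg (Ne.symm hqm)]
    · rw [Function.update_of_ne hv]
      by_cases hv' : rt v = m
      · rw [if_pos hv', if_neg (Ne.symm hqr), hv', if_neg (Ne.symm hqm)]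
      · rw [if_neg hv']
  have hla0 := G.ld_nonneg a han
  have hlm0 := G.ld_nonneg m hmn
  have hla1 := G.ld_le a han
  have hlm1 := G.ld_le m hmn
  obtain ⟨t, ht⟩ : ∃ t, t = joinValue (ld a) (ld m) u := ⟨_, rfl⟩
  rw [← ht]
  -- As long as an interval has slack, it is a single rounded tree with untouched budget 3. An
  -- interval of load 1 may consist of several rounded trees, and only the one containing `par m` is
  -- affected.
  have hA : ld a < 1 → r = a ∧ ld a = rootLoad n d b par kept rt r ∧ S r = 3 := by
    intro hlt
    obtain ⟨h₁, h₂, h₃⟩ := h.ld_lt a han hla hlt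
    have hra : r = a := hrtr.symm.trans (h₃ r hrn hlr)
    exact ⟨hra, hra ▸ h₁, hra ▸ h₂⟩
  have hM := h.ld_lt m hmn hlm
  have h1r := h.one_le r hrn hkr
  have h1m := h.one_le m hmn hkm
  have h2r := h.load_le r hrn hkr
  have h2m := h.load_le m hmn hkm
  have hvr := h.vertex_le
  have hbr := fun v (hv : v < n) => h.b_le_rootLoad G T hv
  have hones : ld a < 1 ∧ ld m < 1 ∧ ld a + ld m + u ≤ 1 → t = 1 := by
    intro hc; rw [ht, joinValue, if_pos hc]
  have hxa : (1 - ld a) / (1 + u) * (1 + u) = 1 - ld a := div_mul_cancel₀ _ (by linarith)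
  have hxm : (1 - ld m) / (1 + u) * (1 + u) = 1 - ld m := div_mul_cancel₀ _ (by linarith)
  -- If the join fits, `t = 1` and the budget `3 + 3 - 3` equals 3 again. Otherwise one side has a
  -- share above `2/3` and plays the role of the attached tree in `attach_budget`.
  have hgood : 2 ≤ 3 * t ∧ 1 ≤ S r + S m - 3 * t ∧
      2 * (rootLoad n d b par kept rt r + rootLoad n d b par kept rt m + u) ≤ S r + S m - 3 * t ∧
      (∀ v < n, rt v = r → 2 * (rootLoad n d b par kept rt r + rootLoad n d b par kept rt m + u)
        + 2 * b v - 1 ≤ S r + S m - 3 * t) ∧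
      ∀ v < n, rt v = m → 2 * (rootLoad n d b par kept rt r + rootLoad n d b par kept rt m + u)
        + 2 * b v - 1 ≤ S r + S m - 3 * t := by
    by_cases hc : ld a < 1 ∧ ld m < 1 ∧ ld a + ld m + u ≤ 1
    · rw [hones hc]
      obtain ⟨h₁, h₂, h₃⟩ := hA hc.1
      obtain ⟨h₄, h₅, h₆⟩ := hM hc.2.1
      rw [h₃, h₅, ← h₂, ← h₄]
      refine ⟨by norm_num, by norm_num, by linarith, fun v hv hrv => ?_, fun v hv hrv => ?_⟩
      · have := hbr v hv; rw [hrv] at this; linarith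
      · have := hbr v hv; rw [hrv] at this; linarith
    · have hteq : t = (1 - ld a) / (1 + u) + (1 - ld m) / (1 + u) := by
        rw [ht, joinValue, if_neg hc]
      have hw : 1 ≤ ld a + ld m + u := by
        by_contra hlt
        push Not at hlt
        exact hc ⟨by linarith, by linarith, hlt.le⟩
      -- The loads may fit although one of them equals 1, a case that `joinValue` treats as tight.
      -- Then the other load and `u` are 0, and the share of that other side is 1.
      have hK' : 2 * (1 + u) < 3 * (1 - ld a) ∨ 2 * (1 + u) < 3 * (1 - ld m) := by
        rcases hK with hK | hK
        · rcases hla1.lt_or_eq with h₁ | h₁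
          · rcases hlm1.lt_or_eq with h₂ | h₂
            · exact absurd ⟨h₁, h₂, hK⟩ hc
            · left; linarith
          · right; linarith
        · exact hK
      have hpos : ∀ l, 2 * (1 + u) < 3 * (1 - l) → 2 / 3 ≤ (1 - l) / (1 + u) := by
        intro l hl
        rw [div_le_div_iff₀ (by norm_num) (by linarith)]
        linarith
      have hnn : ∀ l, l ≤ 1 → 0 ≤ (1 - l) / (1 + u) := fun l hl =>
        div_nonneg (by linarith) (by linarith)
      rcases hK' with hs | hs
      · have hlt : ld a < 1 := by linarith
        obtain ⟨-, h₂, h₃⟩ := hA hlt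
        obtain ⟨g₁, g₂, g₃, g₄⟩ := attach_budget hla0 hlm0 hlm1 hu0 hs (by linarith) hxa hxm
          (fun hlt => ⟨(hM hlt).2.1, (hM hlt).1⟩) h1m h2m
        have := hpos _ hs
        have := hnn _ hlm1
        rw [hteq, h₃, ← h₂]
        refine ⟨by linarith, by linarith, by linarith, fun v hv hrv => ?_, fun v hv hrv => ?_⟩
        · have h₄ := hbr v hv
          rw [hrv, ← h₂] at h₄
          have := g₄ _ h₄
          linarith
        · have h₄ := hbr v hv
          have h₅ := hvr v hv
          rw [hrv] at h₄ h₅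
          have := g₃ _ h₄ (T.b_lt_one v hv).le h₅
          linarith
      · have hlt : ld m < 1 := by linarith
        obtain ⟨h₂, h₃, -⟩ := hM hlt
        obtain ⟨g₁, g₂, g₃, g₄⟩ := attach_budget hlm0 hla0 hla1 hu0 hs (by linarith) hxm hxa
          (fun hlt => ⟨(hA hlt).2.2, (hA hlt).2.1⟩) h1r h2r
        have := hpos _ hs
        have := hnn _ hla1
        rw [hteq, h₃, ← h₂]
        refine ⟨by linarith, by linarith, by linarith, fun v hv hrv => ?_, fun v hv hrv => ?_⟩
        · have h₄ := hbr v hv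
          have h₅ := hvr v hv
          rw [hrv] at h₄ h₅
          have := g₃ _ h₄ (T.b_lt_one v hv).le h₅
          linarith
        · have h₄ := hbr v hv
          rw [hrv, ← h₂] at h₄
          have := g₄ _ h₄
          linarith
  obtain ⟨g₀, g₁, g₂, g₃, g₄⟩ := hgood
  have hfilter : (Finset.range n).filter (fun q => Function.update kept m 1 q = 0) =
      ((Finset.range n).filter (fun q => kept q = 0)).erase m := by
    ext q
    simp only [Finset.mem_filter, Finset.mem_erase]
    by_cases hq : q = m
    · subst hq; simp
    · simp [hq]
  have hfilter' : (Finset.range n).filter (fun q => 1 ≤ Function.update kept m 1 q) =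
      insert m ((Finset.range n).filter (fun q => 1 ≤ kept q)) := by
    ext q
    simp only [Finset.mem_filter, Finset.mem_insert]
    by_cases hq : q = m
    · subst hq; simpa using hmn
    · simp [hq]
  refine ⟨Function.update S r (S r + S m - 3 * t), fun v => if rt v = m then r else rt v,
    ?_, ?_, ?_, ?_, ?_, ?_, ?_, ?_, ?_, ?_, ?_⟩
  · intro p hp hk
    by_cases hpm' : p = m
    · subst hpm'
      rw [if_pos hlm, hlp, if_neg (by omega)]
      exact ⟨by omega, rfl⟩
    · rw [Function.update_of_ne hpm'] at hk
      obtain ⟨h₁, h₂⟩ := h.kept_joined p hp hk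
      rw [h₂]
      refine ⟨?_, rfl⟩
      split_ifs with h₃
      · intro hap
        have := G.lab_le p hp
        omega
      · exact h₁
  · intro p hp
    by_cases hpm' : p = m
    · subst hpm'
      rw [if_pos hrtm, Function.update_self, if_pos le_rfl, ← hr, if_neg (by omega)]
    · rw [Function.update_of_ne hpm']
      have h₁ := h.rt_eq p hp
      by_cases hk : 1 ≤ kept p
      · rw [if_pos hk] at h₁ ⊢
        rw [h₁]
      · rw [if_neg hk] at h₁ ⊢
        rw [h₁, if_neg hpm']
  · intro p hp
    have := h.rt_le p hp
    show (if rt p = m then r else rt p) ≤ p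
    split_ifs <;> omega
  · intro p hp
    show (if lab (if rt p = m then r else rt p) = m then a else _) = _
    have h₁ := h.lab_rt p hp
    by_cases h₂ : rt p = m
    · rw [if_pos h₂, hlr, if_neg (by omega)]
      rw [h₂, hlm] at h₁
      rw [if_pos h₁.symm]
    · rw [if_neg h₂, h₁]
  · intro p hp
    show Function.update kept m 1 (if rt p = m then r else rt p) = 0
    by_cases h₂ : rt p = m
    · rw [if_pos h₂, Function.update_of_ne (by omega), hkr]
    · rw [if_neg h₂, Function.update_of_ne h₂]
      exact h.kept_rt p hp
  · intro q hq hk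
    have hqm : q ≠ m := by rintro rfl; simp at hk
    rw [Function.update_of_ne hqm] at hk
    by_cases hqr : q = r
    · subst hqr; rw [Function.update_self]; exact g₁
    · rw [Function.update_of_ne hqr]; exact h.one_le q hq hk
  · intro q hq hk
    have hqm : q ≠ m := by rintro rfl; simp at hk
    rw [Function.update_of_ne hqm] at hk
    by_cases hqr : q = r
    · subst hqr; rw [Function.update_self, hLr]; exact g₂
    · rw [Function.update_of_ne hqr, hLq q hqr hqm]; exact h.load_le q hq hk
  · intro v hv
    show 2 * rootLoad n d b par (Function.update kept m 1) (fun v => if rt v = m then r else rt v)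
      (if rt v = m then r else rt v) + 2 * b v - 1 ≤
      Function.update S r (S r + S m - 3 * t) (if rt v = m then r else rt v)
    by_cases h₂ : rt v = m
    · rw [if_pos h₂, Function.update_self, hLr]; exact g₄ v hv h₂
    · rw [if_neg h₂]
      by_cases hqr : rt v = r
      · rw [hqr, Function.update_self, hLr]; exact g₃ v hv hqr
      · rw [Function.update_of_ne hqr, hLq _ hqr h₂]; exact hvr v hv
  · intro e he hl hlt
    by_cases hea : e = a
    · subst hea
      rw [Function.update_self] at hlt ⊢
      have hw : ld e + ld m + u < 1 := by
        rcases min_lt_iff.1 hlt with h₁ | h₁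
        · exact absurd h₁ (lt_irrefl _)
        · exact h₁
      have hc : ld e < 1 ∧ ld m < 1 ∧ ld e + ld m + u ≤ 1 := ⟨by linarith, by linarith, hw.le⟩
      obtain ⟨h₁, h₂, h₃⟩ := hA hc.1
      obtain ⟨h₄, h₅, h₆⟩ := hM hc.2.1
      subst h₁
      rw [Function.update_self, hLr, min_eq_right hw.le, ← h₂, ← h₄, h₃, h₅, hones hc]
      refine ⟨rfl, by norm_num, fun p hp hlp' => ?_⟩
      show (if rt p = m then r else rt p) = r
      by_cases hl' : lab p = m
      · rw [if_pos (h₆ p hp hl')]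
      · rw [if_neg hl'] at hlp'
        rw [(h.ld_lt r han hla hc.1).2.2 p hp hlp', if_neg hrm.ne]
    · have hem : e ≠ m := by
        rintro rfl; rw [if_pos hlm] at hl; exact hea hl.symm
      have hle : lab e = e := by
        split_ifs at hl with hl'
        · exact absurd hl.symm hea
        · exact hl
      have her : e ≠ r := by rintro rfl; exact hea (hle.symm.trans hlr)
      rw [Function.update_of_ne hea] at hlt ⊢
      rw [Function.update_of_ne her, hLq e her hem]
      obtain ⟨h₁, h₂, h₃⟩ := h.ld_lt e he hle hlt
      refine ⟨h₁, h₂, fun p hp hlp' => ?_⟩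
      split_ifs at hlp' with hl'
      · exact absurd hlp'.symm hea
      · show (if rt p = m then r else rt p) = e
        rw [h₃ p hp hlp', if_neg hem]
  · have hmem : m ∈ (Finset.range n).filter (fun q => kept q = 0) :=
      Finset.mem_filter.2 ⟨Finset.mem_range.2 hmn, hkm⟩
    have hrmem : r ∈ ((Finset.range n).filter (fun q => kept q = 0)).erase m :=
      Finset.mem_erase.2 ⟨hrm.ne, Finset.mem_filter.2 ⟨Finset.mem_range.2 hrn, hkr⟩⟩
    rw [hfilter, Finset.sum_update_eq hrmem, Finset.sum_update_eq (Finset.mem_range.2 hmn),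
      G.x_zero m hmn hlm, Finset.sum_erase_eq_sub hmem]
    linarith [h.sum_le]
  · have hnm : m ∉ (Finset.range n).filter (fun q => 1 ≤ kept q) := by
      intro hmem
      have := (Finset.mem_filter.1 hmem).2
      omega
    have hcm := T.c_nonneg m hmn _ hpm
    have hupd : ∀ p, c (par p) p * Function.update x m t p =
        Function.update (fun p => c (par p) p * x p) m (c (par m) m * t) p := by
      intro p
      by_cases hp : p = m
      · subst hp; simp
      · simp [hp]
    rw [hfilter', Finset.sum_insert hnm, Finset.sum_congr rfl (fun p _ => hupd p),
      Finset.sum_update_eq (Finset.mem_range.2 hmn), G.x_zero m hmn hlm]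
    have := mul_le_mul_of_nonneg_left g₀ hcm
    linarith [h.cost_le]

/-- The edge `m` is not added to the rounded forest. -/
theorem join_drop (h : BudgetInv n d c b par lab kept ld x S rt)
    (G : GreedyInv n d c b γ par done lab ld x) (T : PrimTree n d c b par) {m : ℕ}
    (hm : IsNextEdge n d c par done m)
    (hw : 1 < ld (lab (m - 1)) + ld m + d (par m) m)
    (hKa : 3 * (1 - ld (lab (m - 1))) ≤ 2 * (1 + d (par m) m))
    (hKm : 3 * (1 - ld m) ≤ 2 * (1 + d (par m) m)) :
    ∃ S', BudgetInv n d c b par (fun p => if lab p = m then lab (m - 1) else lab p) kept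
      (Function.update ld (lab (m - 1)) (min 1 (ld (lab (m - 1)) + ld m + d (par m) m)))
      (Function.update x m (joinValue (ld (lab (m - 1))) (ld m) (d (par m) m))) S' rt := by
  have hmn := hm.lt
  have hm1 := hm.pos
  have hlm := G.lab_next hm
  have hpm := T.par_lt m hmn hm1
  obtain ⟨a, ha⟩ : ∃ a, a = lab (m - 1) := ⟨_, rfl⟩
  have ham : a ≤ m - 1 := ha ▸ G.lab_le (m - 1) (by omega)
  have han : a < n := by omega
  have hla : lab a = a := by rw [ha]; exact G.lab_lab (by omega)
  rw [← ha] at hw hKa ⊢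
  obtain ⟨u, hu⟩ : ∃ u, u = d (par m) m := ⟨_, rfl⟩
  have hu0 : 0 ≤ u := hu ▸ T.d_nonneg m hmn _ hpm
  rw [← hu] at hw hKa hKm ⊢
  have hkm : kept m = 0 := h.kept_of_lab hmn hlm
  have hka : kept a = 0 := h.kept_of_lab han hla
  have hla1 := G.ld_le a han
  have hlm1 := G.ld_le m hmn
  have hbr := fun v (hv : v < n) => h.b_le_rootLoad G T hv
  have hteq : joinValue (ld a) (ld m) u = (1 - ld a) / (1 + u) + (1 - ld m) / (1 + u) := by
    rw [joinValue, if_neg (fun hc => absurd hc.2.2 (not_le.2 hw))]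
  have hx0 : ∀ l ≤ (1 : ℝ), 0 ≤ (1 - l) / (1 + u) := fun l hl =>
    div_nonneg (by linarith) (by linarith)
  rw [hteq, min_eq_left hw.le]
  -- Each side pays for its own share. With slack, the budget drops from 3 by at most 2, and it
  -- still covers `3 * ld e`, which dominates `2 * ld e` and `4 * ld e - 1`. Without slack the share
  -- is 0.
  have hgood : ∀ e < n, lab e = e → 3 * (1 - ld e) ≤ 2 * (1 + u) →
      1 ≤ S e - 3 * ((1 - ld e) / (1 + u)) ∧
      2 * rootLoad n d b par kept rt e ≤ S e - 3 * ((1 - ld e) / (1 + u)) ∧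
      ∀ v < n, rt v = e → 2 * rootLoad n d b par kept rt e + 2 * b v - 1 ≤
        S e - 3 * ((1 - ld e) / (1 + u)) := by
    intro e he hle hKe
    have hke := h.kept_of_lab he hle
    rcases (G.ld_le e he).lt_or_eq with hlt | heq
    · obtain ⟨h₁, h₂, h₃⟩ := h.ld_lt e he hle hlt
      have hx : (1 - ld e) / (1 + u) ≤ 2 / 3 := by
        rw [div_le_div_iff₀ (by linarith) (by norm_num)]; linarith
      have hx' : (1 - ld e) / (1 + u) ≤ 1 - ld e :=
        div_le_self (by linarith) (by linarith)
      have hl0 := G.ld_nonneg e he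
      rw [h₂, ← h₁]
      refine ⟨by linarith, by linarith, fun v hv hrv => ?_⟩
      have h₄ := hbr v hv
      rw [hrv, ← h₁] at h₄
      linarith
    · rw [heq]
      simp only [sub_self, zero_div, mul_zero, sub_zero]
      refine ⟨h.one_le e he hke, h.load_le e he hke, fun v hv hrv => ?_⟩
      have := h.vertex_le v hv
      rwa [hrv] at this
  have ham' : a ≠ m := by omega
  refine ⟨Function.update (Function.update S a (S a - 3 * ((1 - ld a) / (1 + u)))) m
    (S m - 3 * ((1 - ld m) / (1 + u))), ?_, h.rt_eq, h.rt_le, ?_, h.kept_rt, ?_, ?_, ?_, ?_, ?_, ?_⟩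
  · intro p hp hk
    obtain ⟨h₁, h₂⟩ := h.kept_joined p hp hk
    rw [h₂]
    refine ⟨?_, rfl⟩
    split_ifs with h₃
    · intro hap
      have := G.lab_le p hp
      omega
    · exact h₁
  · intro p hp
    rw [h.lab_rt p hp]
  · intro q hq hk
    by_cases hqm : q = m
    · subst hqm; rw [Function.update_self]; exact (hgood q hq hlm hKm).1
    · rw [Function.update_of_ne hqm]
      by_cases hqa : q = a
      · subst hqa; rw [Function.update_self]; exact (hgood q hq hla hKa).1
      · rw [Function.update_of_ne hqa]; exact h.one_le q hq hk
  · intro q hq hk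
    by_cases hqm : q = m
    · subst hqm; rw [Function.update_self]; exact (hgood q hq hlm hKm).2.1
    · rw [Function.update_of_ne hqm]
      by_cases hqa : q = a
      · subst hqa; rw [Function.update_self]; exact (hgood q hq hla hKa).2.1
      · rw [Function.update_of_ne hqa]; exact h.load_le q hq hk
  · intro v hv
    by_cases hqm : rt v = m
    · rw [hqm, Function.update_self]; exact (hgood m hmn hlm hKm).2.2 v hv hqm
    · rw [Function.update_of_ne hqm]
      by_cases hqa : rt v = a
      · rw [hqa, Function.update_self]; exact (hgood a han hla hKa).2.2 v hv hqa
      · rw [Function.update_of_ne hqa]; exact h.vertex_le v hv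
  · intro e he hl hlt
    have hea : e ≠ a := by
      rintro rfl
      rw [Function.update_self] at hlt
      exact absurd hlt (lt_irrefl _)
    have hem : e ≠ m := by
      rintro rfl; rw [if_pos hlm] at hl; exact hea hl.symm
    have hle : lab e = e := by
      split_ifs at hl with hl'
      · exact absurd hl.symm hea
      · exact hl
    rw [Function.update_of_ne hea] at hlt ⊢
    rw [Function.update_of_ne hem, Function.update_of_ne hea]
    obtain ⟨h₁, h₂, h₃⟩ := h.ld_lt e he hle hlt
    refine ⟨h₁, h₂, fun p hp hlp' => h₃ p hp ?_⟩
    split_ifs at hlp' with hl'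
    · exact absurd hlp'.symm hea
    · exact hlp'
  · have hmem : m ∈ (Finset.range n).filter (fun q => kept q = 0) :=
      Finset.mem_filter.2 ⟨Finset.mem_range.2 hmn, hkm⟩
    have hamem : a ∈ (Finset.range n).filter (fun q => kept q = 0) :=
      Finset.mem_filter.2 ⟨Finset.mem_range.2 han, hka⟩
    rw [Finset.sum_update_eq hmem, Finset.sum_update_eq hamem, Function.update_of_ne ham'.symm,
      Finset.sum_update_eq (Finset.mem_range.2 hmn), G.x_zero m hmn hlm]
    linarith [h.sum_le]
  · have hupd : ∀ p, c (par p) p * Function.update x m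
        ((1 - ld a) / (1 + u) + (1 - ld m) / (1 + u)) p =
        Function.update (fun p => c (par p) p * x p) m
          (c (par m) m * ((1 - ld a) / (1 + u) + (1 - ld m) / (1 + u))) p := by
      intro p
      by_cases hp : p = m
      · subst hp; simp
      · simp [hp]
    have hcm := T.c_nonneg m hmn _ hpm
    have := mul_nonneg hcm (add_nonneg (hx0 _ hla1) (hx0 _ hlm1))
    rw [Finset.sum_congr rfl (fun p _ => hupd p), Finset.sum_update_eq (Finset.mem_range.2 hmn),
      G.x_zero m hmn hlm]
    linarith [h.cost_le]

end BudgetInv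

/-! ## The greedy algorithm and the rounding as a program -/

theorem interval_congr {n : ℕ} {lab lab' : ℕ → ℕ} (hl : ∀ p < n, lab' p = lab p) (a : ℕ) :
    interval n lab' a = interval n lab a := by
  ext p
  simp only [mem_interval]
  constructor
  · rintro ⟨h₁, h₂⟩; exact ⟨h₁, (hl p h₁).symm.trans h₂⟩
  · rintro ⟨h₁, h₂⟩; exact ⟨h₁, (hl p h₁).trans h₂⟩

/-- Bridges exact function updates and memory contents, which are known only in the cells below `n`.
-/
theorem GreedyInv.congr {n : ℕ} {d c : ℕ → ℕ → ℝ} {b : ℕ → ℝ} {γ : ℝ}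
    {par done lab done' lab' : ℕ → ℕ} {ld ld' x : ℕ → ℝ}
    (h : GreedyInv n d c b γ par done lab ld x) (hn : 0 < n) (hd : ∀ p < n, done' p = done p)
    (hl : ∀ p < n, lab' p = lab p) (hld : ∀ p < n, ld' p = ld p) :
    GreedyInv n d c b γ par done' lab' ld' x where
  lab_zero := by rw [hl 0 hn, h.lab_zero]
  lab_eq p hp h1 := by rw [hl p hp, hl (p - 1) (by omega), hd p hp, h.lab_eq p hp h1]
  done_le p hp h1 m hm hm1 := by rw [hd p hp, hd m hm]; exact h.done_le p hp h1 m hm hm1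
  x_zero p hp := by rw [hl p hp]; exact h.x_zero p hp
  x_nonneg := h.x_nonneg
  ld_nonneg a ha := by rw [hld a ha]; exact h.ld_nonneg a ha
  ld_le a ha := by rw [hld a ha]; exact h.ld_le a ha
  load_eq a ha := by rw [hl a ha, hld a ha, interval_congr hl]; exact h.load_eq a ha
  bound a ha := by rw [hl a ha, interval_congr hl]; exact h.bound a ha
  ones a ha := by
    rw [hl a ha, hld a ha]
    intro h₁ h₂ p hp
    rw [hl p hp]; exact h.ones a ha h₁ h₂ p hp

theorem BudgetInv.congr {n : ℕ} {d c : ℕ → ℕ → ℝ} {b : ℕ → ℝ} {γ : ℝ}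
    {par done lab lab' kept kept' rt : ℕ → ℕ} {ld ld' x S : ℕ → ℝ}
    (h : BudgetInv n d c b par lab kept ld x S rt) (G : GreedyInv n d c b γ par done lab ld x)
    (T : PrimTree n d c b par)
    (hl : ∀ p < n, lab' p = lab p) (hk : ∀ p < n, kept' p = kept p)
    (hld : ∀ p < n, ld' p = ld p) : BudgetInv n d c b par lab' kept' ld' x S rt := by
  have hL : ∀ r, rootLoad n d b par kept' rt r = rootLoad n d b par kept rt r := by
    intro r
    refine Finset.sum_congr rfl fun v hv => ?_
    rw [hk v (Finset.mem_range.1 (Finset.mem_filter.1 hv).1)]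
  have hf₁ : (Finset.range n).filter (fun q => kept' q = 0) =
      (Finset.range n).filter (fun q => kept q = 0) :=
    Finset.filter_congr fun p hp => by rw [hk p (Finset.mem_range.1 hp)]
  have hf₂ : (Finset.range n).filter (fun q => 1 ≤ kept' q) =
      (Finset.range n).filter (fun q => 1 ≤ kept q) :=
    Finset.filter_congr fun p hp => by rw [hk p (Finset.mem_range.1 hp)]
  have hrt : ∀ p < n, rt p < n := fun p hp => (h.rt_le p hp).trans_lt hp
  constructor
  · intro p hp hkp
    rw [hk p hp] at hkp
    obtain ⟨h₁, h₂⟩ := h.kept_joined p hp hkp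
    have := T.par_lt p hp (G.joined hp h₁).1
    rw [hl p hp, hl (par p) (by omega)]
    exact ⟨h₁, h₂⟩
  · intro p hp; rw [hk p hp]; exact h.rt_eq p hp
  · exact h.rt_le
  · intro p hp; rw [hl p hp, hl _ (hrt p hp)]; exact h.lab_rt p hp
  · intro p hp; rw [hk _ (hrt p hp)]; exact h.kept_rt p hp
  · intro r hr; rw [hk r hr]; exact h.one_le r hr
  · intro r hr; rw [hk r hr, hL]; exact h.load_le r hr
  · intro v hv; rw [hL]; exact h.vertex_le v hv
  · intro a ha
    rw [hl a ha, hld a ha, hL]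
    intro h₁ h₂
    obtain ⟨h₃, h₄, h₅⟩ := h.ld_lt a ha h₁ h₂
    exact ⟨h₃, h₄, fun p hp => by rw [hl p hp]; exact h₅ p hp⟩
  · rw [hf₁]; exact h.sum_le
  · rw [hf₂]; exact h.cost_le

namespace RealRAM

def greedyInitBody : Program :=
  .seq (.setNat 7 (nvar 12) (nvar 12)) <|
  .seq (.setNat 8 (nvar 12) (.const 0)) <|
  .seq (.setNat 9 (nvar 12) (.const 0)) <|
  .seq (.setReal 7 (nvar 12) (.get 1 (.get 5 (nvar 12)))) <|
  .seq (.setReal 8 (nvar 12) (.get 1 (.get 5 (nvar 12)))) <|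
  .seq (.setReal 5 (nvar 12) (.get 3
    (.add (.get 4 (.get 5 (nvar 12))) (.get 5 (.get 6 (nvar 12))))))
    (.setReal 6 (nvar 12) (.get 2
      (.add (.get 4 (.get 5 (nvar 12))) (.get 5 (.get 6 (nvar 12))))))

/-- The candidate is replaced only by a strictly lighter edge, which gives the first minimum
required by `IsNextEdge`. The value 0 means that no candidate has been found; position 0 has no tree
edge. -/
def greedyFindBody : Program :=
  .ite (.and (.natLe (.get 8 (nvar 12)) (.const 0))
    (.not (.and (.natLe (.const 1) (nvar 13)) (.realLe (.get 4 (nvar 13)) (.get 4 (nvar 12))))))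
    (.setNat 13 (.const 0) (nvar 12)) .skip

/-- Twice the load factor of the edge in variable `13`. -/
def thresholdExp : RExp := .mul (.const 2) (.add (.const 1) (.get 5 (nvar 13)))

def slackExp (i : NExp) : RExp := .mul (.const 3) (.sub (.const 1) (.get 8 i))

/-- The rounding test compares `3 * (1 - l)` with `2 * (1 + u)`, the form without division of
comparing a share with `2/3`. Loads are stored capped at 1. -/
def greedyJoin : Program :=
  .seq (.setNat 14 (.const 0) (.get 7 (.sub (nvar 13) (.const 1)))) <|
  .seq (.setReal 13 (.const 0)
    (.add (.add (.get 8 (nvar 14)) (.get 8 (nvar 13))) (.get 5 (nvar 13)))) <|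
  .seq (.ite (.and (.not (.realLe (rvar 13) (.const 1)))
    (.and (.realLe (slackExp (nvar 14)) thresholdExp)
      (.realLe (slackExp (nvar 13)) thresholdExp)))
    .skip (.setNat 9 (nvar 13) (.const 1))) <|
  .ite (.realLe (rvar 13) (.const 1)) (.setReal 8 (nvar 14) (rvar 13))
    (.setReal 8 (nvar 14) (.const 1))

def relabelBody : Program :=
  .ite (.and (.natLe (.get 7 (nvar 12)) (nvar 13)) (.natLe (nvar 13) (.get 7 (nvar 12))))
    (.setNat 7 (nvar 12) (nvar 14)) .skip

def greedyProcess : Program :=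
  .seq (.setNat 8 (nvar 13) (.const 1)) <|
  .ite (.realLe (.get 6 (nvar 13)) (rvar 0))
    (.seq greedyJoin (forLoop 12 (.const 0) relabelBody)) .skip

def greedyBody : Program :=
  .seq (.setNat 13 (.const 0) (.const 0)) <|
  .seq (forLoop 12 (.const 1) greedyFindBody) <|
  .ite (.natLe (.const 1) (nvar 13)) greedyProcess .skip

/-- The greedy algorithm. The edges of the rounded forest are marked in `nat` array `9`. -/
def greedy : Program :=
  .seq (forLoop 12 (.const 0) greedyInitBody) (forLoop 11 (.const 0) greedyBody)

/-- The memory contains the tree computed by Prim's algorithm. -/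
structure HoldsTree (n : ℕ) (d c : ℕ → ℕ → ℝ) (b : ℕ → ℝ) (γ : ℝ) (par : ℕ → ℕ) (s : State) :
    Prop where
  size : s.nat 0 0 = n
  opening : s.real 0 0 = γ
  par_eq : s.nat 6 = par
  key : ∀ p < n, 1 ≤ p → s.real 4 p = d (par p) p + c (par p) p
  load : ∀ p < n, 1 ≤ p → s.real 5 p = d (par p) p
  cost : ∀ p < n, 1 ≤ p → s.real 6 p = c (par p) p
  vertexLoad : ∀ p < n, s.real 7 p = b p

theorem HoldsTree.of_eq {n : ℕ} {d c : ℕ → ℕ → ℝ} {b : ℕ → ℝ} {γ : ℝ} {par : ℕ → ℕ} {s s' : State}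
    (h : HoldsTree n d c b γ par s) (h0 : s'.nat 0 = s.nat 0) (hr0 : s'.real 0 = s.real 0)
    (h6 : s'.nat 6 = s.nat 6) (hr4 : s'.real 4 = s.real 4) (hr5 : s'.real 5 = s.real 5)
    (hr6 : s'.real 6 = s.real 6) (hr7 : s'.real 7 = s.real 7) :
    HoldsTree n d c b γ par s' where
  size := by rw [h0, h.size]
  opening := by rw [hr0, h.opening]
  par_eq := by rw [h6, h.par_eq]
  key := by rw [hr4]; exact h.key
  load := by rw [hr5]; exact h.load
  cost := by rw [hr6]; exact h.cost
  vertexLoad := by rw [hr7]; exact h.vertexLoad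

variable {N n : ℕ} {d c : ℕ → ℕ → ℝ} {b : ℕ → ℝ} {γ : ℝ} {par : ℕ → ℕ} {s : State}

theorem reach_greedyFind (hN : n ≤ N) (h1 : 1 ≤ n) (hs : HoldsTree n d c b γ par s)
    (h13 : s.nat 13 0 = 0) :
    Reach N (forLoop 12 (.const 1) greedyFindBody) (fun s' =>
      (s'.nat 13 0 = 0 ∧ ∀ q < n, 1 ≤ q → s.nat 8 q ≠ 0) ∨
      IsNextEdge n d c par (s.nat 8) (s'.nat 13 0)) s := by
  refine Reach.forLoop (n := n) (fun i s' =>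
    (s'.nat 13 0 = 0 ∧ ∀ q < i, 1 ≤ q → s.nat 8 q ≠ 0) ∨
      (s'.nat 13 0 < i ∧ 1 ≤ s'.nat 13 0 ∧ s.nat 8 (s'.nat 13 0) = 0 ∧
        (∀ q < i, 1 ≤ q → s.nat 8 q = 0 → s.real 4 (s'.nat 13 0) ≤ s.real 4 q) ∧
        ∀ q < s'.nat 13 0, 1 ≤ q → s.nat 8 q = 0 → s.real 4 (s'.nat 13 0) < s.real 4 q))
    (by decide) (by decide) (by decide) hs.size hN h1 ?_ ?_ ?_ ?_
  · intro i s' z h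
    simpa [State.nat_setNat_of_ne] using h
  · left; exact ⟨h13, fun q hq hq1 => by simp [NExp.eval] at hq; omega⟩
  · intro i s' hi hin h12 hn' hf hI
    have e8 : s'.nat 8 = s.nat 8 := hf.nat 8 (by decide)
    have r4 : s'.real 4 = s.real 4 := hf.real 4 (by decide)
    have hi1 : 1 ≤ i := hi
    refine Reach.of_run (by simp [greedyFindBody, Program.LoopFree]) ?_
    simp only [greedyFindBody, Program.run, Test.Holds, NExp.eval, RExp.eval, h12, e8, r4]
    split_ifs with hc
    · obtain ⟨hc₁, hc₂⟩ := hc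
      right
      simp only [State.nat_setNat_same, Function.update_self]
      refine ⟨by omega, hi1, by omega, ?_, ?_⟩
      · intro q hq hq1 hq0
        by_cases hqi : q = i
        · rw [hqi]
        · rcases hI with ⟨-, hI⟩ | ⟨g₁, g₂, g₃, g₄, g₅⟩
          · exact absurd hq0 (hI q (by omega) hq1)
          · exact (not_le.1 fun hle => hc₂ ⟨g₂, hle⟩).le.trans (g₄ q (by omega) hq1 hq0)
      · intro q hq hq1 hq0
        rcases hI with ⟨-, hI⟩ | ⟨g₁, g₂, g₃, g₄, g₅⟩
        · exact absurd hq0 (hI q (by omega) hq1)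
        · exact (not_le.1 fun hle => hc₂ ⟨g₂, hle⟩).trans_le (g₄ q (by omega) hq1 hq0)
    · rcases hI with ⟨hI₁, hI₂⟩ | ⟨g₁, g₂, g₃, g₄, g₅⟩
      · left
        refine ⟨hI₁, fun q hq hq1 => ?_⟩
        by_cases hqi : q = i
        · subst hqi
          intro h0
          exact hc ⟨h0.le, fun h => by omega⟩
        · exact hI₂ q (by omega) hq1
      · right
        refine ⟨by omega, g₂, g₃, fun q hq hq1 hq0 => ?_, g₅⟩
        by_cases hqi : q = i
        · subst hqi
          by_contra hlt
          exact hc ⟨hq0.le, fun h => hlt h.2⟩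
        · exact g₄ q (by omega) hq1 hq0
  · intro s' _ hI
    rcases hI with hI | ⟨g₁, g₂, g₃, g₄, g₅⟩
    · exact Or.inl hI
    · right
      refine ⟨g₁, g₂, g₃, fun p hp hp1 hp0 => ?_, fun p hp hp1 hp0 => ?_⟩
      · rw [← hs.key _ g₁ g₂, ← hs.key p hp hp1]; exact g₄ p hp hp1 hp0
      · rw [← hs.key _ g₁ g₂, ← hs.key p (by omega) hp1]; exact g₅ p hp hp1 hp0

/-- The invariants of the greedy algorithm hold for the contents of the memory. -/
def GreedyState (n : ℕ) (d c : ℕ → ℕ → ℝ) (b : ℕ → ℝ) (γ : ℝ) (par done kept lab : ℕ → ℕ)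
    (ld : ℕ → ℝ) : Prop :=
  ∃ x S rt, GreedyInv n d c b γ par done lab ld x ∧ BudgetInv n d c b par lab kept ld x S rt

theorem reach_relabel (hN : n ≤ N) (hn : s.nat 0 0 = n) {m a : ℕ} (hm : s.nat 13 0 = m)
    (ha : s.nat 14 0 = a) :
    Reach N (forLoop 12 (.const 0) relabelBody) (fun s' =>
      ∀ p < n, s'.nat 7 p = if s.nat 7 p = m then a else s.nat 7 p) s := by
  refine Reach.forLoop (n := n) (fun i s' =>
    (∀ p < i, s'.nat 7 p = if s.nat 7 p = m then a else s.nat 7 p) ∧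
    ∀ p, i ≤ p → s'.nat 7 p = s.nat 7 p)
    (by decide) (by decide) (by decide) hn hN (Nat.zero_le _) ?_ ?_ ?_ (fun s' _ h => h.1)
  · intro i s' z h
    simpa [State.nat_setNat_of_ne] using h
  · exact ⟨fun p hp => absurd hp (Nat.not_lt_zero p), fun _ _ => rfl⟩
  · intro i s' _ hin h12 hn' hf ⟨hI₁, hI₂⟩
    have e13 : s'.nat 13 = s.nat 13 := hf.nat 13 (by decide)
    have e14 : s'.nat 14 = s.nat 14 := hf.nat 14 (by decide)
    refine Reach.of_run (by simp [relabelBody, Program.LoopFree]) ?_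
    simp only [relabelBody, Program.run, Test.Holds, NExp.eval, h12, e13, e14, hm, ha]
    split_ifs with hc
    · rw [hI₂ i le_rfl] at hc
      simp only [State.nat_setNat_same]
      constructor
      · intro p hp
        by_cases hpi : p = i
        · subst hpi
          rw [Function.update_self, if_pos (by omega)]
        · rw [Function.update_of_ne hpi]; exact hI₁ p (by omega)
      · intro p hp
        rw [Function.update_of_ne (by omega)]; exact hI₂ p (by omega)
    · rw [hI₂ i le_rfl] at hc
      refine ⟨fun p hp => ?_, fun p hp => hI₂ p (by omega)⟩
      by_cases hpi : p = i
      · subst hpi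
        rw [hI₂ p le_rfl, if_neg (by omega)]
      · exact hI₁ p (by omega)

/-- The tests reproduce exactly the hypotheses of `BudgetInv.join_keep` and `BudgetInv.join_drop`;
an edge of cost above `γ` is merely marked as processed. New `x`, `S` and `rt` are supplied by these
lemmas without being computed. -/
theorem reach_greedyProcess (hN : n ≤ N) (T : PrimTree n d c b par)
    (hs : HoldsTree n d c b γ par s)
    (hm : IsNextEdge n d c par (s.nat 8) (s.nat 13 0))
    (hG : GreedyState n d c b γ par (s.nat 8) (s.nat 9) (s.nat 7) (s.real 8)) :
    Reach N greedyProcess (fun s' => s'.nat 8 = Function.update (s.nat 8) (s.nat 13 0) 1 ∧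
      GreedyState n d c b γ par (s'.nat 8) (s'.nat 9) (s'.nat 7) (s'.real 8)) s := by
  obtain ⟨m, hm13⟩ : ∃ m, s.nat 13 0 = m := ⟨_, rfl⟩
  rw [hm13] at hm ⊢
  have hmn := hm.lt
  have hm1 := hm.pos
  obtain ⟨x, S, rt, G, B⟩ := hG
  refine Reach.seq (Reach.of_run trivial ?_)
  simp only [Program.run, NExp.eval, hm13]
  refine Reach.ite ?_ ?_
  · intro hγ
    simp only [Test.Holds, NExp.eval, RExp.eval, State.real_setNat, hs.opening,
      State.nat_setNat_of_ne _ _ _ (show (13 : ℕ) ≠ 8 by decide), hm13, hs.cost m hmn hm1] at hγ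
    obtain ⟨a, ha⟩ : ∃ a, a = s.nat 7 (m - 1) := ⟨_, rfl⟩
    have ham : a < m := by
      have := G.lab_le (m - 1) (by omega)
      omega
    refine Reach.seq (Reach.mono (Reach.frame (Reach.of_run
      (by simp [greedyJoin, Program.LoopFree])
      (Q := fun s' => s'.nat 14 0 = a ∧ (∃ kept', s'.nat 9 = kept' ∧
        ∃ x' S' rt', GreedyInv n d c b γ par (Function.update (s.nat 8) m 1)
          (fun p => if s.nat 7 p = m then a else s.nat 7 p) (s'.real 8) x' ∧
          BudgetInv n d c b par (fun p => if s.nat 7 p = m then a else s.nat 7 p) kept'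
            (s'.real 8) x' S' rt')) ?_)) ?_)
    · have G' := G.join T hm hγ
      rw [← ha] at G'
      simp only [greedyJoin, slackExp, thresholdExp, Program.run, Test.Holds, NExp.eval, RExp.eval,
        State.nat_setNat_same, State.nat_setReal, State.real_setNat, State.real_setReal_same,
        Function.update_self, State.nat_setNat_of_ne _ _ _ (show (13 : ℕ) ≠ 8 by decide),
        State.nat_setNat_of_ne _ _ _ (show (13 : ℕ) ≠ 14 by decide),
        State.nat_setNat_of_ne _ _ _ (show (7 : ℕ) ≠ 8 by decide),
        State.real_setReal_of_ne _ _ _ (show (8 : ℕ) ≠ 13 by decide),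
        State.real_setReal_of_ne _ _ _ (show (5 : ℕ) ≠ 13 by decide),
        hm13, ← ha, hs.load m hmn hm1, Rat.cast_one, Rat.cast_ofNat]
      split_ifs with hc hw hw
      · exact absurd hw hc.1
      · obtain ⟨S', B'⟩ := B.join_drop G T hm (by rw [← ha]; exact not_le.1 hc.1)
          (by rw [← ha]; exact hc.2.1) hc.2.2
        rw [← ha] at B'
        replace hw : ¬ s.real 8 a + s.real 8 m + d (par m) m ≤ 1 := hw
        rw [min_eq_left (not_le.1 hw).le] at B' G'
        simp only [State.nat_setNat_same, State.nat_setReal, State.real_setReal_same,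
          State.real_setReal_of_ne _ _ _ (show (8 : ℕ) ≠ 13 by decide), State.real_setNat,
          Function.update_self, State.nat_setNat_of_ne _ _ _ (show (9 : ℕ) ≠ 14 by decide),
          State.nat_setNat_of_ne _ _ _ (show (9 : ℕ) ≠ 8 by decide)]
        exact ⟨trivial, _, rfl, _, S', rt, G', B'⟩
      · obtain ⟨S', rt', B'⟩ := B.join_keep G T hm hγ (Or.inl (by rw [← ha]; exact hw))
        rw [← ha] at B'
        replace hw : s.real 8 a + s.real 8 m + d (par m) m ≤ 1 := hw
        rw [min_eq_right hw] at B' G'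
        simp [State.nat_setNat_of_ne, State.real_setReal_of_ne]
        exact ⟨_, G', S', rt', B'⟩
      · obtain ⟨S', rt', B'⟩ := B.join_keep G T hm hγ (Or.inr (by
          rw [← ha]
          by_contra hcon
          push Not at hcon
          exact hc ⟨hw, hcon.1, hcon.2⟩))
        rw [← ha] at B'
        replace hw : ¬ s.real 8 a + s.real 8 m + d (par m) m ≤ 1 := hw
        rw [min_eq_left (not_le.1 hw).le] at B' G'
        simp [State.nat_setNat_of_ne, State.real_setReal_of_ne]
        exact ⟨_, G', S', rt', B'⟩
    · rintro s₁ ⟨⟨h14, kept', h9, x', S', rt', G', B'⟩, hf⟩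
      have e13 : s₁.nat 13 0 = m := by
        rw [hf.nat 13 (by decide), State.nat_setNat_of_ne _ _ _ (by decide), hm13]
      have e0 : s₁.nat 0 0 = n := by
        rw [hf.nat 0 (by decide), State.nat_setNat_of_ne _ _ _ (by decide), hs.size]
      have e7 : s₁.nat 7 = s.nat 7 := by
        rw [hf.nat 7 (by decide), State.nat_setNat_of_ne _ _ _ (by decide)]
      have e8 : s₁.nat 8 = Function.update (s.nat 8) m 1 := by
        rw [hf.nat 8 (by decide), State.nat_setNat_same]
      refine Reach.mono (Reach.frame (reach_relabel hN e0 e13 h14)) ?_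
      rintro s₂ ⟨h7, hf₂⟩
      rw [e7] at h7
      have e8' : s₂.nat 8 = Function.update (s.nat 8) m 1 := by rw [hf₂.nat 8 (by decide), e8]
      have e9 : s₂.nat 9 = kept' := by rw [hf₂.nat 9 (by decide), h9]
      have r8 : s₂.real 8 = s₁.real 8 := hf₂.real 8 (by decide)
      rw [e8', e9, r8]
      exact ⟨rfl, x', S', rt', G'.congr (by omega) (fun _ _ => rfl) h7 (fun _ _ => rfl),
        B'.congr G' T h7 (fun _ _ => rfl) (fun _ _ => rfl)⟩
  · intro hγ
    simp only [Test.Holds, NExp.eval, RExp.eval, State.real_setNat, hs.opening,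
      State.nat_setNat_of_ne _ _ _ (show (13 : ℕ) ≠ 8 by decide), hm13, hs.cost m hmn hm1] at hγ
    refine Reach.of_run trivial ?_
    simp only [Program.run, State.nat_setNat_same, State.real_setNat,
      State.nat_setNat_of_ne _ _ _ (show (9 : ℕ) ≠ 8 by decide),
      State.nat_setNat_of_ne _ _ _ (show (7 : ℕ) ≠ 8 by decide)]
    exact ⟨trivial, x, S, rt, G.skip hm hγ, B⟩

theorem reach_greedyBody (hN : n ≤ N) (h1 : 1 ≤ n) (T : PrimTree n d c b par)
    (hs : HoldsTree n d c b γ par s)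
    (hG : GreedyState n d c b γ par (s.nat 8) (s.nat 9) (s.nat 7) (s.real 8)) :
    Reach N greedyBody (fun s' =>
      (((∀ q < n, 1 ≤ q → s.nat 8 q ≠ 0) ∧ s'.nat 8 = s.nat 8) ∨
        ∃ m, IsNextEdge n d c par (s.nat 8) m ∧ s'.nat 8 = Function.update (s.nat 8) m 1) ∧
      GreedyState n d c b γ par (s'.nat 8) (s'.nat 9) (s'.nat 7) (s'.real 8)) s := by
  refine Reach.seq (Reach.of_run trivial ?_)
  simp only [Program.run, NExp.eval]
  have hs' : HoldsTree n d c b γ par (s.setNat 13 0 0) := by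
    refine hs.of_eq ?_ ?_ ?_ ?_ ?_ ?_ ?_ <;> simp [State.nat_setNat_of_ne]
  refine Reach.seq (Reach.mono (Reach.frame (reach_greedyFind hN h1 hs' (by simp))) ?_)
  rintro s₁ ⟨h, hf⟩
  have e8 : s₁.nat 8 = s.nat 8 := by
    rw [hf.nat 8 (by decide), State.nat_setNat_of_ne _ _ _ (by decide)]
  have e9 : s₁.nat 9 = s.nat 9 := by
    rw [hf.nat 9 (by decide), State.nat_setNat_of_ne _ _ _ (by decide)]
  have e7 : s₁.nat 7 = s.nat 7 := by
    rw [hf.nat 7 (by decide), State.nat_setNat_of_ne _ _ _ (by decide)]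
  have r8 : s₁.real 8 = s.real 8 := by rw [hf.real 8 (by decide), State.real_setNat]
  rw [State.nat_setNat_of_ne _ _ _ (show (8 : ℕ) ≠ 13 by decide)] at h
  have hs₁ : HoldsTree n d c b γ par s₁ := hs'.of_eq (hf.nat 0 (by decide)) (hf.real 0 (by decide))
    (hf.nat 6 (by decide)) (hf.real 4 (by decide)) (hf.real 5 (by decide)) (hf.real 6 (by decide))
    (hf.real 7 (by decide))
  refine Reach.ite ?_ ?_
  · intro hb
    simp only [Test.Holds, NExp.eval] at hb
    rcases h with ⟨h, -⟩ | h
    · omega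
    · refine Reach.mono (reach_greedyProcess hN T hs₁ (by rwa [e8])
        (by rwa [e8, e9, e7, r8])) ?_
      rintro s₂ ⟨h8, hG'⟩
      exact ⟨Or.inr ⟨_, h, by rw [h8, e8]⟩, hG'⟩
  · intro hb
    simp only [Test.Holds, NExp.eval] at hb
    refine Reach.of_run trivial ?_
    simp only [Program.run]
    rcases h with ⟨-, h⟩ | h
    · exact ⟨Or.inl ⟨h, e8⟩, by rwa [e8, e9, e7, r8]⟩
    · exact absurd h.pos hb

theorem reach_greedyInit (hN : n ≤ N) (hn : s.nat 0 0 = n) :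
    Reach N (forLoop 12 (.const 0) greedyInitBody) (fun s' => ∀ p < n, s'.nat 7 p = p ∧
      s'.nat 8 p = 0 ∧ s'.nat 9 p = 0 ∧ s'.real 7 p = s.real 1 (s.nat 5 p) ∧
      s'.real 8 p = s.real 1 (s.nat 5 p) ∧
      s'.real 5 p = s.real 3 (s.nat 4 (s.nat 5 p) + s.nat 5 (s.nat 6 p)) ∧
      s'.real 6 p = s.real 2 (s.nat 4 (s.nat 5 p) + s.nat 5 (s.nat 6 p))) s := by
  refine Reach.forLoop (n := n) (fun i s' => ∀ p < i, s'.nat 7 p = p ∧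
      s'.nat 8 p = 0 ∧ s'.nat 9 p = 0 ∧ s'.real 7 p = s.real 1 (s.nat 5 p) ∧
      s'.real 8 p = s.real 1 (s.nat 5 p) ∧
      s'.real 5 p = s.real 3 (s.nat 4 (s.nat 5 p) + s.nat 5 (s.nat 6 p)) ∧
      s'.real 6 p = s.real 2 (s.nat 4 (s.nat 5 p) + s.nat 5 (s.nat 6 p)))
    (by decide) (by decide) (by decide) hn hN (Nat.zero_le _) ?_ ?_ ?_ (fun s' _ h => h)
  · intro i s' z h
    simpa [State.nat_setNat_of_ne] using h
  · exact fun p hp => absurd hp (Nat.not_lt_zero p)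
  · intro i s' _ hin h12 hn' hf hI
    have e4 : s'.nat 4 = s.nat 4 := hf.nat 4 (by decide)
    have e5 : s'.nat 5 = s.nat 5 := hf.nat 5 (by decide)
    have e6 : s'.nat 6 = s.nat 6 := hf.nat 6 (by decide)
    have r1 : s'.real 1 = s.real 1 := hf.real 1 (by decide)
    have r2 : s'.real 2 = s.real 2 := hf.real 2 (by decide)
    have r3 : s'.real 3 = s.real 3 := hf.real 3 (by decide)
    refine Reach.of_run (by simp [greedyInitBody, Program.LoopFree]) ?_
    simp only [greedyInitBody, Program.run, NExp.eval, RExp.eval]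
    intro p hp
    by_cases hpi : p = i
    · subst hpi
      simp [State.nat_setNat_of_ne, State.real_setReal_of_ne, h12, e4, e5, e6, r1, r2, r3]
    · have := hI p (by omega)
      simpa [State.nat_setNat_of_ne, State.real_setReal_of_ne, h12, hpi] using this

theorem reach_greedy (hN : n ≤ N) (h1 : 1 ≤ n) (T : PrimTree n d c b par)
    (hn : s.nat 0 0 = n) (hγ : s.real 0 0 = γ) (hpar : s.nat 6 = par)
    (hkey : ∀ p < n, 1 ≤ p → s.real 4 p = d (par p) p + c (par p) p)
    (hload : ∀ p < n, 1 ≤ p → s.real 3 (s.nat 4 (s.nat 5 p) + s.nat 5 (par p)) = d (par p) p)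
    (hcost : ∀ p < n, 1 ≤ p → s.real 2 (s.nat 4 (s.nat 5 p) + s.nat 5 (par p)) = c (par p) p)
    (hb : ∀ p < n, s.real 1 (s.nat 5 p) = b p) :
    Reach N greedy (fun s' => HoldsTree n d c b γ par s' ∧ ∃ done lab ld,
      GreedyState n d c b γ par done (s'.nat 9) lab ld ∧ ∀ p < n, 1 ≤ p → 1 ≤ done p) s := by
  refine Reach.seq (Reach.mono (Reach.frame (reach_greedyInit hN hn)) ?_)
  rintro s₁ ⟨h, hf⟩
  have hs₁ : HoldsTree n d c b γ par s₁ := by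
    constructor
    · rw [hf.nat 0 (by decide), hn]
    · rw [hf.real 0 (by decide), hγ]
    · rw [hf.nat 6 (by decide), hpar]
    · rw [hf.real 4 (by decide)]; exact hkey
    · intro p hp hp1; rw [(h p hp).2.2.2.2.2.1, hpar, hload p hp hp1]
    · intro p hp hp1; rw [(h p hp).2.2.2.2.2.2, hpar, hcost p hp hp1]
    · intro p hp; rw [(h p hp).2.2.2.1, hb p hp]
  refine Reach.mono (Reach.frame (Reach.forLoop (n := n)
    (Q := fun s' => GreedyState n d c b γ par (s'.nat 8) (s'.nat 9) (s'.nat 7) (s'.real 8) ∧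
      ((Finset.range n).filter fun p => 1 ≤ p ∧ s'.nat 8 p = 0).card ≤ n - 1 - n)
    -- At most `n - 1` tree edges exist, while the loop makes `n` rounds; the last one may be idle.
    -- At the end the truncated difference is 0, so nothing is left unprocessed.
    (fun i s' => GreedyState n d c b γ par (s'.nat 8) (s'.nat 9) (s'.nat 7) (s'.real 8) ∧
      ((Finset.range n).filter fun p => 1 ≤ p ∧ s'.nat 8 p = 0).card ≤ n - 1 - i)
    (by decide) (by decide) (by decide) hs₁.size hN (Nat.zero_le _) ?_ ?_ ?_ (fun s' _ h => h))) ?_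
  · intro i s' z h
    simpa [State.nat_setNat_of_ne] using h
  · refine ⟨⟨fun _ => 0, fun _ => 3, fun p => p, ?_, ?_⟩, ?_⟩
    · exact (GreedyInv.initial T).congr h1 (fun p hp => (h p hp).2.1) (fun p hp => (h p hp).1)
        (fun p hp => by rw [(h p hp).2.2.2.2.1, hb p hp])
    · exact (BudgetInv.initial T).congr (γ := γ) (GreedyInv.initial T) T (fun p hp => (h p hp).1)
        (fun p hp => (h p hp).2.2.1) (fun p hp => by rw [(h p hp).2.2.2.2.1, hb p hp])
    · simp only [NExp.eval]
      calc _ ≤ ((Finset.range n).erase 0).card := by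
            refine Finset.card_le_card fun p hp => ?_
            rw [Finset.mem_filter] at hp
            exact Finset.mem_erase.2 ⟨by omega, hp.1⟩
        _ = n - 1 - 0 := by
            rw [Finset.card_erase_of_mem (Finset.mem_range.2 h1), Finset.card_range, Nat.sub_zero]
  · intro i s' _ hin h11 hn' hf₂ ⟨hG, hcard⟩
    have hs' : HoldsTree n d c b γ par s' := hs₁.of_eq (hf₂.nat 0 (by decide))
      (hf₂.real 0 (by decide)) (hf₂.nat 6 (by decide)) (hf₂.real 4 (by decide))
      (hf₂.real 5 (by decide)) (hf₂.real 6 (by decide)) (hf₂.real 7 (by decide))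
    refine Reach.mono (reach_greedyBody hN h1 T hs' hG) ?_
    rintro s₂ ⟨hor, hG'⟩
    refine ⟨hG', ?_⟩
    rcases hor with ⟨hall, h8⟩ | ⟨m, hm, h8⟩
    · rw [h8, Finset.filter_false_of_mem]
      · simp
      · intro p hp hp'
        exact hall p (Finset.mem_range.1 hp) hp'.1 hp'.2
    · have hlt : ((Finset.range n).filter fun p => 1 ≤ p ∧ s₂.nat 8 p = 0).card <
          ((Finset.range n).filter fun p => 1 ≤ p ∧ s'.nat 8 p = 0).card := by
        refine Finset.card_lt_card (Finset.ssubset_iff_of_subset ?_ |>.2 ⟨m, ?_, ?_⟩)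
        · intro p hp
          rw [Finset.mem_filter, h8] at hp
          rw [Finset.mem_filter]
          obtain ⟨h₁, h₂, h₃⟩ := hp
          have hpm : p ≠ m := by rintro rfl; simp at h₃
          rw [Function.update_of_ne hpm] at h₃
          exact ⟨h₁, h₂, h₃⟩
        · exact Finset.mem_filter.2 ⟨Finset.mem_range.2 hm.lt, hm.pos, hm.undone⟩
        · intro hmem
          have := (Finset.mem_filter.1 hmem).2.2
          rw [h8, Function.update_self] at this
          exact one_ne_zero this
      omega
  · rintro s₂ ⟨⟨hG, hcard⟩, hf₂⟩
    refine ⟨hs₁.of_eq (hf₂.nat 0 (by decide)) (hf₂.real 0 (by decide)) (hf₂.nat 6 (by decide))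
      (hf₂.real 4 (by decide)) (hf₂.real 5 (by decide)) (hf₂.real 6 (by decide))
      (hf₂.real 7 (by decide)), _, _, _, hG, fun p hp hp1 => ?_⟩
    by_contra h0
    have hmem : p ∈ (Finset.range n).filter fun p => 1 ≤ p ∧ s₂.nat 8 p = 0 :=
      Finset.mem_filter.2 ⟨Finset.mem_range.2 hp, hp1, by omega⟩
    have := Finset.card_pos.2 ⟨p, hmem⟩
    omega

end RealRAM

/-! ## Splitting the trees of the rounded forest -/

/-- Load of the vertex `v` together with the edge to its parent. -/
noncomputable def ownLoad (d : ℕ → ℕ → ℝ) (b : ℕ → ℝ) (par kept : ℕ → ℕ) (v : ℕ) : ℝ :=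
  b v + if 1 ≤ kept v then d (par v) v else 0

/-- A metric on `{0, …, n - 1}`. -/
structure FiniteMetric (n : ℕ) (d : ℕ → ℕ → ℝ) : Prop where
  nonneg : ∀ i j, 0 ≤ d i j
  symm : ∀ i j, d i j = d j i
  triangle : ∀ i < n, ∀ j < n, ∀ k < n, d i k ≤ d i j + d j k

/-- The rounded forest with edges to the parents of the vertices in `kept` and roots `rt`, and
bounds `S` on the number of trees into which its trees may be split. -/
structure RoundedForest (n : ℕ) (d c : ℕ → ℕ → ℝ) (b : ℕ → ℝ) (par kept rt : ℕ → ℕ)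
    (S : ℕ → ℝ) : Prop where
  load_metric : FiniteMetric n d
  cost_metric : FiniteMetric n c
  b_nonneg : ∀ v < n, 0 ≤ b v
  b_lt_one : ∀ v < n, b v < 1
  par_lt : ∀ p < n, 1 ≤ kept p → par p < p
  rt_eq : ∀ p < n, rt p = if 1 ≤ kept p then rt (par p) else p
  rt_le : ∀ p < n, rt p ≤ p
  kept_rt : ∀ p < n, kept (rt p) = 0
  one_le : ∀ r < n, kept r = 0 → 1 ≤ S r
  load_le : ∀ r < n, kept r = 0 → 2 * rootLoad n d b par kept rt r ≤ S r
  vertex_le : ∀ v < n, 2 * rootLoad n d b par kept rt (rt v) + 2 * b v - 1 ≤ S (rt v)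

/-- Structural invariant for splitting the rounded forest given by `par₀`, `kept₀` and `rt` into the
forest given by `par` and `kept`. The vertices `v ≥ z` have been settled; `h v` is the load of the
subtree below `v`, and `ρ` is a rank function that certifies acyclicity. -/
structure SplitForest (n : ℕ) (d : ℕ → ℕ → ℝ) (b : ℕ → ℝ) (par₀ kept₀ rt : ℕ → ℕ) (z : ℕ)
    (kept par : ℕ → ℕ) (acc sz M h : ℕ → ℝ) (ρ : ℕ → ℤ) : Prop where
  le : z ≤ n
  kept_eq : ∀ v < z, kept v = kept₀ v
  par_eq : ∀ v < z, par v = par₀ v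
  rank : ∀ x < n, 1 ≤ kept x → par x < n ∧ ρ (par x) < ρ x
  h_eq : ∀ w < n, z ≤ w →
    h w = b w + ∑ x ∈ Finset.range n, if 1 ≤ kept x ∧ par x = w then h x + d x w else 0
  h_nonneg : ∀ w < n, z ≤ w → 0 ≤ h w
  h_le : ∀ w < n, z ≤ w → kept w = 0 → h w ≤ 1
  pending : ∀ w < n, z ≤ w → 1 ≤ kept w → par w < z →
    par w = par₀ w ∧ sz w = h w + d w (par w) ∧ rt w = rt (par w)
  acc_eq : ∀ v < z, acc v =
    ∑ x ∈ Finset.range n, if z ≤ x ∧ 1 ≤ kept x ∧ par x = v then sz x else 0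
  M_eq : ∀ r < z, kept₀ r = 0 → M r =
    ∑ v ∈ Finset.range z, if rt v = r then ownLoad d b par₀ kept₀ v + acc v else 0

namespace SplitForest

variable {n z : ℕ} {d c : ℕ → ℕ → ℝ} {b S : ℕ → ℝ} {par₀ kept₀ rt kept par : ℕ → ℕ}
  {acc sz M h : ℕ → ℝ} {ρ : ℕ → ℤ}

theorem sz_nonneg (F : SplitForest n d b par₀ kept₀ rt z kept par acc sz M h ρ)
    (B : RoundedForest n d c b par₀ kept₀ rt S) {w : ℕ} (hw : w < n) (hz : z ≤ w)
    (hk : 1 ≤ kept w) (hp : par w < z) : 0 ≤ sz w := by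
  rw [(F.pending w hw hz hk hp).2.1]
  exact add_nonneg (F.h_nonneg w hw hz) (B.load_metric.nonneg _ _)

theorem acc_nonneg (F : SplitForest n d b par₀ kept₀ rt z kept par acc sz M h ρ)
    (B : RoundedForest n d c b par₀ kept₀ rt S) {v : ℕ} (hv : v < z) : 0 ≤ acc v := by
  rw [F.acc_eq v hv]
  refine Finset.sum_nonneg fun x hx => ?_
  split_ifs with hc
  · exact F.sz_nonneg B (Finset.mem_range.1 hx) hc.1 hc.2.1 (by omega)
  · exact le_rfl

/-- An unsettled vertex still has its original parent, a smaller position, so its parent cannot be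
`z - 1` or later. -/
theorem settled_of_par (F : SplitForest n d b par₀ kept₀ rt z kept par acc sz M h ρ)
    (B : RoundedForest n d c b par₀ kept₀ rt S) {x : ℕ} (hx : x < n) (hk : 1 ≤ kept x)
    (hp : z ≤ par x + 1) : z ≤ x := by
  by_contra hlt
  push Not at hlt
  have := B.par_lt x hx (by rw [← F.kept_eq x hlt]; exact hk)
  rw [← F.par_eq x hlt] at this
  omega

/-- A pending vertex becomes the root of its own tree. -/
theorem detach (F : SplitForest n d b par₀ kept₀ rt z kept par acc sz M h ρ) {p : ℕ} (hp : p < n)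
    (hz : z ≤ p) (hk : 1 ≤ kept p) (hpp : par p < z) (hh : h p ≤ 1) :
    SplitForest n d b par₀ kept₀ rt z (Function.update kept p 0) par
      (Function.update acc (par p) (acc (par p) - sz p)) sz
      (Function.update M (rt p) (M (rt p) - sz p)) h ρ := by
  obtain ⟨-, -, hrt⟩ := F.pending p hp hz hk hpp
  refine ⟨F.le, ?_, F.par_eq, ?_, ?_, F.h_nonneg, ?_, ?_, ?_, ?_⟩
  · intro v hv
    rw [Function.update_of_ne (by omega)]
    exact F.kept_eq v hv
  · intro x hx hkx
    have hxp : x ≠ p := by rintro rfl; simp at hkx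
    rw [Function.update_of_ne hxp] at hkx
    exact F.rank x hx hkx
  · intro w hw hzw
    rw [F.h_eq w hw hzw]
    congr 1
    refine Finset.sum_congr rfl fun x _ => ?_
    by_cases hxp : x = p
    · subst hxp
      -- The parent of a pending vertex is unsettled, so detaching the vertex changes no subtree
      -- load `h w` of a settled vertex.
      rw [if_neg (by omega), if_neg (by simp)]
    · rw [Function.update_of_ne hxp]
  · intro w hw hzw hkw
    by_cases hwp : w = p
    · rwa [hwp]
    · rw [Function.update_of_ne hwp] at hkw
      exact F.h_le w hw hzw hkw
  · intro w hw hzw hkw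
    have hxp : w ≠ p := by rintro rfl; simp at hkw
    rw [Function.update_of_ne hxp] at hkw
    exact F.pending w hw hzw hkw
  · intro v hv
    have key : (∑ x ∈ Finset.range n,
        if z ≤ x ∧ 1 ≤ Function.update kept p 0 x ∧ par x = v then sz x else 0) =
        acc v - if par p = v then sz p else 0 := by
      have h1 : (if par p = v then sz p else 0) =
          ∑ x ∈ Finset.range n, if x = p then (if par p = v then sz p else 0) else 0 := by
        rw [Finset.sum_ite_eq', if_pos (Finset.mem_range.2 hp)]
      rw [F.acc_eq v hv, h1, ← Finset.sum_sub_distrib]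
      refine Finset.sum_congr rfl fun x _ => ?_
      by_cases hxp : x = p
      · subst hxp
        simp [hz, hk]
      · simp [hxp]
    rw [key]
    by_cases hvp : v = par p
    · subst hvp; simp
    · rw [Function.update_of_ne hvp, if_neg (Ne.symm hvp), sub_zero]
  · intro r hr hkr
    have key : (∑ v ∈ Finset.range z, if rt v = r then ownLoad d b par₀ kept₀ v +
        Function.update acc (par p) (acc (par p) - sz p) v else 0) =
        M r - if rt p = r then sz p else 0 := by
      have h1 : (if rt p = r then sz p else 0) =
          ∑ v ∈ Finset.range z, if v = par p then (if rt p = r then sz p else 0) else 0 := by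
        rw [Finset.sum_ite_eq', if_pos (Finset.mem_range.2 hpp)]
      rw [F.M_eq r hr hkr, h1, ← Finset.sum_sub_distrib]
      refine Finset.sum_congr rfl fun x _ => ?_
      by_cases hxp : x = par p
      · subst hxp
        rw [Function.update_self, if_pos rfl, ← hrt]
        split_ifs <;> ring
      · simp [hxp]
    rw [key]
    by_cases hvp : r = rt p
    · subst hvp; simp
    · rw [Function.update_of_ne hvp, if_neg (Ne.symm hvp), sub_zero]

/-- The tree with root `q` is attached to the root `p` of another tree. -/
theorem hang (F : SplitForest n d b par₀ kept₀ rt z kept par acc sz M h ρ)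
    (B : RoundedForest n d c b par₀ kept₀ rt S) {p q : ℕ} (hp : p < n)
    (hzp : z ≤ p) (hkp : kept p = 0) (hq : q < n) (hzq : z ≤ q) (hkq : kept q = 0) (hqp : q ≠ p)
    (hh : h p + h q + d q p ≤ 1) :
    SplitForest n d b par₀ kept₀ rt z (Function.update kept q 1) (Function.update par q p) acc sz M
      (Function.update h p (h p + h q + d q p))
      (Function.update ρ p (min (ρ p) (ρ q) - 1)) := by
  refine ⟨F.le, ?_, ?_, ?_, ?_, ?_, ?_, ?_, ?_, F.M_eq⟩
  · intro v hv
    rw [Function.update_of_ne (by omega)]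
    exact F.kept_eq v hv
  · intro v hv
    rw [Function.update_of_ne (by omega)]
    exact F.par_eq v hv
  · intro x hx hkx
    by_cases hxq : x = q
    · subst hxq
      rw [Function.update_self, Function.update_self, Function.update_of_ne hqp]
      exact ⟨hp, by omega⟩
    · rw [Function.update_of_ne hxq] at hkx ⊢
      -- Since `p` is a root, lowering its rank constrains no edge out of `p` and only relaxes the
      -- edges into it. Ranks may become negative, hence integer values.
      have hxp : x ≠ p := by rintro rfl; omega
      obtain ⟨h₁, h₂⟩ := F.rank x hx hkx
      rw [Function.update_of_ne hxp]
      refine ⟨h₁, ?_⟩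
      by_cases hpp : par x = p
      · rw [hpp, Function.update_self]
        rw [hpp] at h₂
        omega
      · rwa [Function.update_of_ne hpp]
  · intro w hw hzw
    have key : (∑ x ∈ Finset.range n,
        if 1 ≤ Function.update kept q 1 x ∧ Function.update par q p x = w then
          Function.update h p (h p + h q + d q p) x + d x w else 0) =
        (h w - b w) + if p = w then h q + d q w else 0 := by
      have h1 : (if p = w then h q + d q w else 0) =
          ∑ x ∈ Finset.range n, if x = q then (if p = w then h q + d q w else 0) else 0 := by
        rw [Finset.sum_ite_eq', if_pos (Finset.mem_range.2 hq)]
      rw [F.h_eq w hw hzw, h1, add_sub_cancel_left, ← Finset.sum_add_distrib]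
      refine Finset.sum_congr rfl fun x _ => ?_
      by_cases hxq : x = q
      · subst hxq
        simp [hkq, hqp]
      · by_cases hxp : x = p
        · subst hxp
          simp [hxq, hkp]
        · simp [hxq, hxp]
    rw [key]
    by_cases hwp : w = p
    · subst hwp; simp; ring
    · rw [Function.update_of_ne hwp, if_neg (Ne.symm hwp)]; ring
  · intro w hw hzw
    by_cases hwp : w = p
    · subst hwp
      rw [Function.update_self]
      have := F.h_nonneg w hw hzw
      have := F.h_nonneg q hq hzq
      have := B.load_metric.nonneg q w
      linarith
    · rw [Function.update_of_ne hwp]; exact F.h_nonneg w hw hzw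
  · intro w hw hzw hkw
    have hwq : w ≠ q := by rintro rfl; simp at hkw
    rw [Function.update_of_ne hwq] at hkw
    by_cases hwp : w = p
    · subst hwp
      rwa [Function.update_self]
    · rw [Function.update_of_ne hwp]; exact F.h_le w hw hzw hkw
  · intro w hw hzw hkw hpw
    have hwq : w ≠ q := by
      rintro rfl
      rw [Function.update_self] at hpw
      omega
    rw [Function.update_of_ne hwq] at hkw hpw ⊢
    have hwp : w ≠ p := by rintro rfl; omega
    rw [Function.update_of_ne hwp]
    exact F.pending w hw hzw hkw hpw
  · intro v hv
    rw [F.acc_eq v hv]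
    refine Finset.sum_congr rfl fun x _ => ?_
    by_cases hxq : x = q
    · subst hxq
      rw [if_neg (by omega), Function.update_self, Function.update_self, if_neg (by omega)]
    · rw [Function.update_of_ne hxq, Function.update_of_ne hxq]

/-- The largest unsettled vertex is settled. -/
theorem settle {v : ℕ} (F : SplitForest n d b par₀ kept₀ rt (v + 1) kept par acc sz M h ρ)
    (B : RoundedForest n d c b par₀ kept₀ rt S) {acc' : ℕ → ℝ}
    (hacc : ∀ x < v, acc' x = acc x +
      if 1 ≤ kept v ∧ par v = x then ownLoad d b par₀ kept₀ v + acc v else 0)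
    (hh : kept v = 0 → b v + acc v ≤ 1) :
    SplitForest n d b par₀ kept₀ rt v kept par acc'
      (Function.update sz v (ownLoad d b par₀ kept₀ v + acc v)) M
      (Function.update h v (b v + acc v)) ρ := by
  have hvn : v < n := F.le
  have hkv := F.kept_eq v (Nat.lt_succ_self v)
  have hpv := F.par_eq v (Nat.lt_succ_self v)
  have hplt : 1 ≤ kept v → par v < v := fun hk => by
    rw [hpv]; exact B.par_lt v hvn (by rwa [← hkv])
  have hrtv : 1 ≤ kept v → rt v = rt (par v) := fun hk => by
    rw [B.rt_eq v hvn, if_pos (by rwa [← hkv]), hpv]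
  refine ⟨by omega, fun x hx => F.kept_eq x (by omega), fun x hx => F.par_eq x (by omega), F.rank,
    ?_, ?_, ?_, ?_, ?_, ?_⟩
  · intro w hw hzw
    by_cases hwv : w = v
    · subst hwv
      rw [Function.update_self, F.acc_eq w (Nat.lt_succ_self w)]
      congr 1
      refine Finset.sum_congr rfl fun x hx => ?_
      by_cases hc : 1 ≤ kept x ∧ par x = w
      · have hzx := F.settled_of_par B (Finset.mem_range.1 hx) hc.1 (by omega)
        rw [if_pos ⟨hzx, hc⟩, if_pos hc, Function.update_of_ne (by omega),
          (F.pending x (Finset.mem_range.1 hx) hzx hc.1 (by omega)).2.1, hc.2]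
      · rw [if_neg hc, if_neg fun hc' => hc hc'.2]
    · rw [Function.update_of_ne hwv, F.h_eq w hw (by omega)]
      congr 1
      refine Finset.sum_congr rfl fun x hx => ?_
      by_cases hxv : x = v
      · subst hxv
        have : ¬ (1 ≤ kept x ∧ par x = w) := fun hc => by have := hplt hc.1; omega
        rw [if_neg this, if_neg this]
      · rw [Function.update_of_ne hxv]
  · intro w hw hzw
    by_cases hwv : w = v
    · subst hwv
      rw [Function.update_self]
      exact add_nonneg (B.b_nonneg w hw) (F.acc_nonneg B (Nat.lt_succ_self w))
    · rw [Function.update_of_ne hwv]; exact F.h_nonneg w hw (by omega)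
  · intro w hw hzw hkw
    by_cases hwv : w = v
    · subst hwv
      rw [Function.update_self]
      exact hh hkw
    · rw [Function.update_of_ne hwv]; exact F.h_le w hw (by omega) hkw
  · intro w hw hzw hkw hpw
    by_cases hwv : w = v
    · subst hwv
      rw [Function.update_self, Function.update_self, ownLoad, if_pos (by rwa [← hkv]), ← hpv,
        B.load_metric.symm w]
      exact ⟨rfl, by ring, hrtv hkw⟩
    · rw [Function.update_of_ne hwv, Function.update_of_ne hwv]
      exact F.pending w hw (by omega) hkw (by omega)
  · intro x hx
    have h1 : (if 1 ≤ kept v ∧ par v = x then ownLoad d b par₀ kept₀ v + acc v else 0) =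
        ∑ w ∈ Finset.range n, if w = v then
          (if 1 ≤ kept v ∧ par v = x then ownLoad d b par₀ kept₀ v + acc v else 0) else 0 := by
      rw [Finset.sum_ite_eq', if_pos (Finset.mem_range.2 hvn)]
    rw [hacc x hx, F.acc_eq x (by omega), h1, ← Finset.sum_add_distrib]
    refine Finset.sum_congr rfl fun w _ => ?_
    by_cases hwv : w = v
    · subst hwv
      simp
    · rw [if_neg hwv, add_zero, Function.update_of_ne hwv]
      have : v + 1 ≤ w ↔ v ≤ w := by omega
      simp only [this]
  · intro r hr hkr
    rw [F.M_eq r (by omega) hkr, Finset.sum_range_succ]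
    -- The load of `v` does not leave its rounded tree: it moves into `acc` at the parent of `v`,
    -- which has the same root. A vertex without parent contributes nothing because then `rt v = v`,
    -- which differs from `r < v`.
    have h2 : (if rt v = r then ownLoad d b par₀ kept₀ v + acc v else 0) =
        ∑ x ∈ Finset.range v, if rt x = r then
          (if 1 ≤ kept v ∧ par v = x then ownLoad d b par₀ kept₀ v + acc v else 0) else 0 := by
      by_cases hk : 1 ≤ kept v
      · have : ∀ x, (if rt x = r then
            (if 1 ≤ kept v ∧ par v = x then ownLoad d b par₀ kept₀ v + acc v else 0) else 0) =
            if x = par v then (if rt v = r then ownLoad d b par₀ kept₀ v + acc v else 0)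
              else 0 := by
          intro x
          by_cases hx : x = par v
          · subst hx; simp [hk, hrtv hk]
          · simp [hx, Ne.symm hx]
        rw [Finset.sum_congr rfl fun x _ => this x, Finset.sum_ite_eq',
          if_pos (Finset.mem_range.2 (hplt hk))]
      · rw [if_neg]
        · symm
          refine Finset.sum_eq_zero fun x _ => ?_
          simp [hk]
        · rw [B.rt_eq v hvn, if_neg (by rwa [← hkv])]
          omega
    rw [h2, ← Finset.sum_add_distrib]
    refine Finset.sum_congr rfl fun x hx => ?_
    rw [hacc x (Finset.mem_range.1 hx)]
    split_ifs <;> ring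

end SplitForest

/-! ## Counting and pricing the trees of the split forest -/

/-- Number of roots among the vertices with label `r`. -/
def freeCount (n : ℕ) (kept rt : ℕ → ℕ) (r : ℕ) : ℕ :=
  ((Finset.range n).filter fun x => kept x = 0 ∧ rt x = r).card

/-- Cost of the split forest, where edges to original parents count twice. -/
noncomputable def splitCost (n : ℕ) (c : ℕ → ℕ → ℝ) (par₀ kept par : ℕ → ℕ) : ℝ :=
  ∑ x ∈ Finset.range n,
    if 1 ≤ kept x then c x (par x) + (if par x = par₀ x then c x (par x) else 0) else 0

section

variable {n : ℕ} {d c : ℕ → ℕ → ℝ} {par₀ kept par rt : ℕ → ℕ} {p q : ℕ}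

theorem freeCount_detach (hp : p < n) (hk : 1 ≤ kept p) (r : ℕ) :
    freeCount n (Function.update kept p 0) rt r =
      freeCount n kept rt r + if rt p = r then 1 else 0 := by
  have h1 : (if rt p = r then 1 else 0) =
      ∑ x ∈ Finset.range n, if x = p then (if rt p = r then 1 else 0) else 0 := by
    rw [Finset.sum_ite_eq', if_pos (Finset.mem_range.2 hp)]
  rw [freeCount, freeCount, Finset.card_filter, Finset.card_filter, h1, ← Finset.sum_add_distrib]
  refine Finset.sum_congr rfl fun x _ => ?_
  by_cases hx : x = p
  · subst hx
    have : kept x ≠ 0 := by omega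
    simp [this]
  · simp [hx]

theorem freeCount_hang (hq : q < n) (hk : kept q = 0) (r : ℕ) :
    freeCount n (Function.update kept q 1) rt r + (if rt q = r then 1 else 0) =
      freeCount n kept rt r := by
  have h := freeCount_detach (kept := Function.update kept q 1) (rt := rt) hq (by simp) r
  rw [Function.update_idem, Function.update_eq_self_iff.2 hk.symm] at h
  rw [h]

theorem splitCost_detach (hp : p < n) (hk : 1 ≤ kept p) (hpp : par p = par₀ p) :
    splitCost n c par₀ (Function.update kept p 0) par =
      splitCost n c par₀ kept par - 2 * c p (par p) := by
  have h1 : 2 * c p (par p) = ∑ x ∈ Finset.range n, if x = p then 2 * c p (par p) else 0 := by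
    rw [Finset.sum_ite_eq', if_pos (Finset.mem_range.2 hp)]
  rw [splitCost, splitCost, h1, ← Finset.sum_sub_distrib]
  refine Finset.sum_congr rfl fun x _ => ?_
  by_cases hx : x = p
  · subst hx
    simp only [Function.update_self, if_pos hk, if_pos hpp]
    norm_num
    ring
  · simp [hx]

/-- A shortcut edge counts only once, since it does not lead to the original parent and will never
be bypassed again. -/
theorem splitCost_hang (hq : q < n) (hk : kept q = 0) (hpp : p ≠ par₀ q) :
    splitCost n c par₀ (Function.update kept q 1) (Function.update par q p) =
      splitCost n c par₀ kept par + c q p := by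
  have h1 : c q p = ∑ x ∈ Finset.range n, if x = q then c q p else 0 := by
    rw [Finset.sum_ite_eq', if_pos (Finset.mem_range.2 hq)]
  conv_rhs => rw [h1]
  rw [splitCost, splitCost, ← Finset.sum_add_distrib]
  refine Finset.sum_congr rfl fun x _ => ?_
  by_cases hx : x = q
  · subst hx
    simp [hk, hpp]
  · simp [hx]

end

/-- Invariant for splitting the rounded forest into trees of load at most one. -/
structure SplitInv (n : ℕ) (d c : ℕ → ℕ → ℝ) (b : ℕ → ℝ) (par₀ kept₀ rt : ℕ → ℕ) (S : ℕ → ℝ)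
    (K : ℝ) (z : ℕ) (kept par : ℕ → ℕ) (acc sz M h : ℕ → ℝ) (ρ : ℕ → ℤ) : Prop where
  forest : SplitForest n d b par₀ kept₀ rt z kept par acc sz M h ρ
  small : ∀ w < n, z ≤ w → 1 ≤ kept w → par w < z → 1 < M (rt w) → sz w < 1 / 2
  M_le : ∀ r < n, z ≤ r → kept₀ r = 0 → M r ≤ 1
  cost_le : splitCost n c par₀ kept par ≤ K
  count_le : ∀ r < n, kept₀ r = 0 → M r ≤ 1 → (freeCount n kept rt r : ℝ) ≤ S r
  count : ∀ r < n, kept₀ r = 0 → 1 < M r →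
    (freeCount n kept rt r : ℝ) ≤ 1 + 2 * (rootLoad n d b par₀ kept₀ rt r - M r) ∨
    ∃ v, z = v + 1 ∧ r = rt v ∧ acc v = 0 ∧
      (freeCount n kept rt r : ℝ) ≤ 2 * (rootLoad n d b par₀ kept₀ rt r - M r) + 2 * b v

/-- Invariant for collecting pending children of `v`, whose sizes add up to `g`, to a new tree with
root `q`, starting from the forest given by `kept₁` and `par₁`. -/
structure GroupInv (n : ℕ) (d c : ℕ → ℕ → ℝ) (b : ℕ → ℝ) (par₀ kept₀ rt : ℕ → ℕ) (K : ℝ)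
    (v : ℕ) (s₁ : ℝ) (kept₁ par₁ : ℕ → ℕ) (acc₁ sz M₁ : ℕ → ℝ) (kept par : ℕ → ℕ) (g : ℝ) (q : ℕ)
    (h : ℕ → ℝ) (ρ : ℕ → ℤ) : Prop where
  forest : SplitForest n d b par₀ kept₀ rt (v + 1) kept par (Function.update acc₁ v (acc₁ v - g)) sz
    (Function.update M₁ (rt v) (M₁ (rt v) - g)) h ρ
  lt : q < n
  le : v + 1 ≤ q
  root : kept q = 0
  rt_eq : rt q = rt v
  par_eq : par₀ q = v
  load_le : h q + d q v ≤ 2 * g - s₁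
  cost_le : splitCost n c par₀ kept par + c q v ≤ K
  count : ∀ r, freeCount n kept rt r = freeCount n kept₁ rt r + if rt v = r then 1 else 0
  old : ∀ w < n, v + 1 ≤ w → 1 ≤ kept w → par w < v + 1 → 1 ≤ kept₁ w ∧ par₁ w = par w
  nonneg : 0 ≤ g

/-! ### Steps of the splitting procedure and the count of trees -/

section

variable {n z v p q : ℕ} {d c : ℕ → ℕ → ℝ} {b S : ℕ → ℝ} {par₀ kept₀ rt kept par kept₁ par₁ : ℕ → ℕ}
  {acc sz M h : ℕ → ℝ} {ρ : ℕ → ℤ} {K g s₁ : ℝ}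

theorem ownLoad_ge (B : RoundedForest n d c b par₀ kept₀ rt S) (v : ℕ) :
    b v ≤ ownLoad d b par₀ kept₀ v := by
  rw [ownLoad]
  split_ifs
  · linarith [B.load_metric.nonneg (par₀ v) v]
  · linarith

/-- A single detached child is the first group. Removing its edge to `v` frees twice that edge's
cost, one copy of which is reserved for a possible shortcut from this child to the next member. -/
theorem GroupInv.start (I : SplitInv n d c b par₀ kept₀ rt S K (v + 1) kept par acc sz M h ρ)
    (B : RoundedForest n d c b par₀ kept₀ rt S) (hp : p < n) (hk : 1 ≤ kept p) (hpv : par p = v)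
    (hs : sz p < 1 / 2) :
    GroupInv n d c b par₀ kept₀ rt K v (sz p) kept par acc sz M (Function.update kept p 0) par
      (sz p) p h ρ := by
  have hz := I.forest.settled_of_par B hp hk (by omega)
  obtain ⟨h₁, h₂, h₃⟩ := I.forest.pending p hp hz hk (by omega)
  have hh : h p ≤ 1 := by
    have := B.load_metric.nonneg p (par p)
    linarith
  have F := I.forest.detach hp hz hk (by omega) hh
  rw [hpv] at h₁ h₂ h₃
  rw [hpv, h₃] at F
  refine ⟨F, hp, hz, by simp, h₃, h₁.symm, by linarith, ?_, ?_, ?_, ?_⟩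
  · rw [splitCost_detach hp hk (by rw [hpv, h₁]), hpv]
    have := I.cost_le
    have := B.cost_metric.nonneg p v
    linarith
  · intro r
    rw [freeCount_detach hp hk, h₃]
  · intro w hw hzw hkw hpw
    have hwp : w ≠ p := by rintro rfl; simp at hkw
    rw [Function.update_of_ne hwp] at hkw
    exact ⟨hkw, rfl⟩
  · exact I.forest.sz_nonneg B hp hz hk (by omega)

/-- The next child becomes the new root of the group, and the old root is connected to it directly
instead of through `v`. Sizes at most that of the first child keep the load of the group below 1. -/
theorem GroupInv.step
    (G : GroupInv n d c b par₀ kept₀ rt K v s₁ kept₁ par₁ acc sz M kept par g q h ρ)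
    (B : RoundedForest n d c b par₀ kept₀ rt S) (hs₁ : s₁ < 1 / 2) (hg : g < 1 / 2) (hp : p < n)
    (hk : 1 ≤ kept p) (hpv : par p = v) (hs : sz p ≤ s₁) :
    GroupInv n d c b par₀ kept₀ rt K v s₁ kept₁ par₁ acc sz M
      (Function.update (Function.update kept p 0) q 1) (Function.update par q p) (g + sz p) p
      (Function.update h p (h p + h q + d q p))
      (Function.update ρ p (min (ρ p) (ρ q) - 1)) := by
  have hz := G.forest.settled_of_par B hp hk (by omega)
  obtain ⟨h₁, h₂, h₃⟩ := G.forest.pending p hp hz hk (by omega)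
  have hqp : q ≠ p := by rintro rfl; have := G.root; omega
  have hvn : v < n := G.forest.le
  have hh : h p ≤ 1 := by
    have := B.load_metric.nonneg p (par p)
    linarith
  have hszp := G.forest.sz_nonneg B hp hz hk (by omega)
  have F := G.forest.detach hp hz hk (by omega) hh
  rw [hpv] at h₁ h₂ h₃
  rw [hpv, h₃, Function.update_self, Function.update_self, Function.update_idem,
    Function.update_idem, sub_sub, sub_sub] at F
  have htri := B.load_metric.triangle q G.lt v hvn p hp
  rw [B.load_metric.symm v p] at htri
  have hctri := B.cost_metric.triangle q G.lt v hvn p hp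
  rw [B.cost_metric.symm v p] at hctri
  have hl := G.load_le
  have hkq : Function.update kept p 0 q = 0 := by
    rw [Function.update_of_ne hqp, G.root]
  -- By the triangle inequality `h p + h q + d q p ≤ sz p + (h q + d q v) ≤ s₁ + (2 * g - s₁) = 2 *
  -- g < 1`. This is why the largest child comes first.
  have F' := F.hang B hp hz (by simp) G.lt G.le hkq hqp (by linarith)
  refine ⟨F', hp, hz, ?_, h₃, h₁.symm, ?_, ?_, ?_, ?_, by linarith [G.nonneg]⟩
  · rw [Function.update_of_ne hqp.symm, Function.update_self]
  · rw [Function.update_self]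
    have := G.forest.h_nonneg p hp hz
    linarith
  -- The balance is even: the two copies of `c p v` released by detaching `p` pay for its part of
  -- the shortcut and for the new reserve, and the old reserve `c q v` pays for the other part.
  · rw [splitCost_hang G.lt hkq (by rw [G.par_eq]; omega),
      splitCost_detach hp hk (by rw [hpv, h₁]), hpv]
    have := G.cost_le
    linarith
  · intro r
    have e₁ := freeCount_hang (kept := Function.update kept p 0) (rt := rt) G.lt hkq r
    have e₂ := freeCount_detach (rt := rt) hp hk r
    have e₃ := G.count r
    rw [G.rt_eq] at e₁
    rw [h₃] at e₂
    omega
  · intro w hw hzw hkw hpw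
    have hwq : w ≠ q := by
      rintro rfl
      rw [Function.update_self] at hpw
      omega
    rw [Function.update_of_ne hwq] at hkw hpw ⊢
    have hwp : w ≠ p := by rintro rfl; simp at hkw
    rw [Function.update_of_ne hwp] at hkw
    exact G.old w hw hzw hkw hpw

/-- A finished group is one new tree and removes `g` from the remainder `M`. With `g ≥ 1/2` the
bound `1 + 2 * (L - M)` on the number of trees is maintained. If all children together weigh less
than `1/2`, the vertex is heavy, and the weaker alternative of `count` records this until the vertex
is settled. -/
theorem SplitInv.group (I : SplitInv n d c b par₀ kept₀ rt S K (v + 1) kept₁ par₁ acc sz M h ρ)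
    (B : RoundedForest n d c b par₀ kept₀ rt S) {h' : ℕ → ℝ} {ρ' : ℕ → ℤ}
    (G : GroupInv n d c b par₀ kept₀ rt K v s₁ kept₁ par₁ acc sz M kept par g q h' ρ')
    (hM : 1 < M (rt v)) (ha : 1 / 2 ≤ acc v ∨ 1 < b v + acc v)
    (hg : 1 / 2 ≤ g ∨ ∀ p < n, 1 ≤ kept p → par p ≠ v) :
    SplitInv n d c b par₀ kept₀ rt S K (v + 1) kept par (Function.update acc v (acc v - g)) sz
      (Function.update M (rt v) (M (rt v) - g)) h' ρ' := by
  have hvn : v < n := G.forest.le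
  have hrtn : rt v < n := (B.rt_le v hvn).trans_lt hvn
  have hg0 := G.nonneg
  have hMle : ∀ r, Function.update M (rt v) (M (rt v) - g) r ≤ M r := by
    intro r
    by_cases hr : r = rt v
    · subst hr; rw [Function.update_self]; linarith
    · rw [Function.update_of_ne hr]
  have hcnt : ∀ r, r ≠ rt v → freeCount n kept rt r = freeCount n kept₁ rt r := by
    intro r hr
    rw [G.count r, if_neg (Ne.symm hr), add_zero]
  have hcv : (freeCount n kept rt (rt v) : ℝ) = freeCount n kept₁ rt (rt v) + 1 := by
    rw [G.count, if_pos rfl]; push_cast; rfl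
  -- The weaker alternative cannot hold already: it demands `acc v = 0`, whereas an overloaded `v`
  -- has a positive `acc v` because `b v < 1`.
  have hold : (freeCount n kept₁ rt (rt v) : ℝ) ≤
      1 + 2 * (rootLoad n d b par₀ kept₀ rt (rt v) - M (rt v)) := by
    rcases I.count (rt v) hrtn (B.kept_rt v hvn) hM with h₁ | ⟨v', h₁, -, h₂, h₃⟩
    · exact h₁
    · obtain rfl : v = v' := by omega
      have := B.b_lt_one v hvn
      rcases ha with ha | ha <;> linarith
  have hv1 := B.vertex_le v hvn
  have hacc0 : (1 / 2 ≤ g) ∨ acc v - g = 0 := by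
    rcases hg with hg | hg
    · exact Or.inl hg
    · right
      have := G.forest.acc_eq v (Nat.lt_succ_self v)
      rw [Function.update_self] at this
      rw [this]
      refine Finset.sum_eq_zero fun x hx => if_neg fun hc => ?_
      exact hg x (Finset.mem_range.1 hx) hc.2.1 hc.2.2
  have hMge : acc v - g + b v ≤ M (rt v) - g := by
    by_cases hrv : rt v < v + 1
    · have h₁ := G.forest.M_eq (rt v) hrv (B.kept_rt v hvn)
      rw [Function.update_self] at h₁
      rw [h₁]
      have h₂ := Finset.single_le_sum (f := fun w => if rt w = rt v then
        ownLoad d b par₀ kept₀ w + Function.update acc v (acc v - g) w else 0) (s :=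
        Finset.range (v + 1)) ?_ (Finset.mem_range.2 (Nat.lt_succ_self v))
      · simp only [if_true, Function.update_self] at h₂
        have := ownLoad_ge B v
        linarith
      · intro w hw
        have hwv := Finset.mem_range.1 hw
        show 0 ≤ if rt w = rt v then _ else _
        split_ifs
        · have := ownLoad_ge B w
          have := B.b_nonneg w (by omega)
          have := G.forest.acc_nonneg B hwv
          linarith
        · exact le_rfl
    · have := B.rt_le v hvn
      omega
  refine ⟨G.forest, ?_, ?_, ?_, ?_, ?_⟩
  · intro w hw hzw hkw hpw hMw
    obtain ⟨h₁, h₂⟩ := G.old w hw hzw hkw hpw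
    exact I.small w hw hzw h₁ (by omega) (hMw.trans_le (hMle _))
  · intro r hr hzr hkr
    exact (hMle r).trans (I.M_le r hr hzr hkr)
  · linarith [G.cost_le, B.cost_metric.nonneg q v]
  · intro r hr hkr hMr
    by_cases hrv : r = rt v
    · subst hrv
      rw [Function.update_self] at hMr
      rw [hcv]
      -- This is the last cut from the tree. Before it `M` exceeded 1, so the new number of trees is
      -- at most `2 + 2 * (L - M) < 2 * L ≤ S`.
      rcases hacc0 with h₁ | h₁
      · have := B.load_le (rt v) hr hkr
        linarith
      · rcases ha with ha | ha
        · have := B.load_le (rt v) hr hkr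
          linarith
        · have := B.load_le (rt v) hr hkr
          linarith
    · rw [hcnt r hrv]
      rw [Function.update_of_ne hrv] at hMr
      exact I.count_le r hr hkr hMr
  · intro r hr hkr hMr
    by_cases hrv : r = rt v
    · subst hrv
      rw [Function.update_self] at hMr ⊢
      rw [hcv]
      rcases hacc0 with h₁ | h₁
      · left; linarith
      · rcases ha with ha | ha
        · left; linarith
        -- Here `g` is all of `acc v` and `g + b v > 1`, so the new tree is paid for by `2 * g + 2 *
        -- b v > 2`.
        · right
          exact ⟨v, rfl, rfl, by rwa [Function.update_self], by linarith⟩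
    · rw [hcnt r hrv]
      rw [Function.update_of_ne hrv] at hMr ⊢
      rcases I.count r hr hkr hMr with h₁ | ⟨v', h₁, h₂, -⟩
      · exact Or.inl h₁
      · obtain rfl : v = v' := by omega
        exact absurd h₂ hrv

/-- When a root is about to be settled, every other vertex of its rounded tree is already settled,
so only its own load and its pending children remain. -/
theorem SplitInv.load_root (I : SplitInv n d c b par₀ kept₀ rt S K (v + 1) kept par acc sz M h ρ)
    (B : RoundedForest n d c b par₀ kept₀ rt S) (hk : kept v = 0) :
    rt v = v ∧ M v = b v + acc v := by
  have hvn : v < n := I.forest.le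
  have hk₀ : kept₀ v = 0 := by rw [← I.forest.kept_eq v (Nat.lt_succ_self v), hk]
  have hrt : rt v = v := by rw [B.rt_eq v hvn, if_neg (by omega)]
  refine ⟨hrt, ?_⟩
  rw [I.forest.M_eq v (Nat.lt_succ_self v) hk₀, Finset.sum_eq_single v]
  · rw [if_pos hrt, ownLoad, if_neg (by omega), add_zero]
  · intro w hw hwv
    have := Finset.mem_range.1 hw
    have := B.rt_le w (by omega)
    rw [if_neg (by omega)]
  · simp

/-- A vertex that need not be cut off from its parent is settled. -/
theorem SplitInv.settle (I : SplitInv n d c b par₀ kept₀ rt S K (v + 1) kept par acc sz M h ρ)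
    (B : RoundedForest n d c b par₀ kept₀ rt S) {acc' : ℕ → ℝ}
    (hacc : ∀ x < v, acc' x = acc x +
      if 1 ≤ kept v ∧ par v = x then ownLoad d b par₀ kept₀ v + acc v else 0)
    (ha : 1 < M (rt v) → b v + acc v ≤ 1)
    (hs : 1 ≤ kept v → 1 < M (rt v) → ownLoad d b par₀ kept₀ v + acc v < 1 / 2) :
    SplitInv n d c b par₀ kept₀ rt S K v kept par acc'
      (Function.update sz v (ownLoad d b par₀ kept₀ v + acc v)) M
      (Function.update h v (b v + acc v)) ρ := by
  have hvn : v < n := I.forest.le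
  have hMv : kept v = 0 → M v ≤ 1 := by
    intro hk
    obtain ⟨h₁, h₂⟩ := I.load_root B hk
    by_contra hlt
    push Not at hlt
    have := ha (by rwa [h₁])
    linarith
  refine ⟨I.forest.settle B hacc ?_, ?_, ?_, I.cost_le, I.count_le, ?_⟩
  · intro hk
    rw [← (I.load_root B hk).2]
    exact hMv hk
  · intro w hw hzw hkw hpw hMw
    by_cases hwv : w = v
    · subst hwv
      rw [Function.update_self]
      exact hs hkw hMw
    · rw [Function.update_of_ne hwv]
      exact I.small w hw (by omega) hkw (by omega) hMw
  · intro r hr hzr hkr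
    by_cases hrv : r = v
    · subst hrv
      exact hMv (by rw [I.forest.kept_eq r (Nat.lt_succ_self r), hkr])
    · exact I.M_le r hr (by omega) hkr
  · intro r hr hkr hMr
    rcases I.count r hr hkr hMr with h₁ | ⟨v', h₁, h₂, h₃, h₄⟩
    · exact Or.inl h₁
    · left
      obtain rfl : v = v' := by omega
      by_cases hk : kept v = 0
      · obtain ⟨h₅, -⟩ := I.load_root B hk
        have := hMv hk
        rw [h₂, h₅] at hMr
        linarith
      -- The size of `v` is below `1/2`, hence so is `b v`, and the weaker alternative implies the
      -- standard bound.
      · have h₅ := hs (by omega) (by rwa [← h₂])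
        have := ownLoad_ge B v
        linarith

/-- A vertex is settled and becomes the root of its own tree. -/
theorem SplitInv.settle_cut (I : SplitInv n d c b par₀ kept₀ rt S K (v + 1) kept par acc sz M h ρ)
    (B : RoundedForest n d c b par₀ kept₀ rt S) (hk : 1 ≤ kept v) (hM : 1 < M (rt v))
    (ha : b v + acc v ≤ 1) (hs : 1 / 2 ≤ ownLoad d b par₀ kept₀ v + acc v) :
    SplitInv n d c b par₀ kept₀ rt S K v (Function.update kept v 0) par acc
      (Function.update sz v (ownLoad d b par₀ kept₀ v + acc v))
      (Function.update M (rt v) (M (rt v) - (ownLoad d b par₀ kept₀ v + acc v)))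
      (Function.update h v (b v + acc v)) ρ := by
  have hvn : v < n := I.forest.le
  have hrtn : rt v < n := (B.rt_le v hvn).trans_lt hvn
  have hkv := I.forest.kept_eq v (Nat.lt_succ_self v)
  have hpv := I.forest.par_eq v (Nat.lt_succ_self v)
  have hplt : par v < v := by rw [hpv]; exact B.par_lt v hvn (by rwa [← hkv])
  obtain ⟨σ, hσ⟩ : ∃ σ, σ = ownLoad d b par₀ kept₀ v + acc v := ⟨_, rfl⟩
  have hσb : b v + acc v ≤ σ := by have := ownLoad_ge B v; linarith
  have F := (I.forest.settle B (acc' := Function.update acc (par v) (acc (par v) + σ)) (by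
    intro x hx
    by_cases hxp : x = par v
    · subst hxp
      rw [Function.update_self, if_pos ⟨hk, rfl⟩, hσ]
    · rw [Function.update_of_ne hxp, if_neg (fun hc => hxp hc.2.symm), add_zero])
    (by omega)).detach hvn le_rfl hk hplt (by rwa [Function.update_self])
  rw [← hσ] at hs F ⊢
  rw [Function.update_self, Function.update_self, add_sub_cancel_right, Function.update_idem,
    Function.update_eq_self] at F
  have hMle : ∀ r, Function.update M (rt v) (M (rt v) - σ) r ≤ M r := by
    intro r
    by_cases hr : r = rt v
    · subst hr; rw [Function.update_self]; linarith
    · rw [Function.update_of_ne hr]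
  have hcnt : ∀ r, r ≠ rt v → freeCount n (Function.update kept v 0) rt r =
      freeCount n kept rt r := by
    intro r hr
    rw [freeCount_detach hvn hk, if_neg (Ne.symm hr), add_zero]
  have hcv : (freeCount n (Function.update kept v 0) rt (rt v) : ℝ) =
      freeCount n kept rt (rt v) + 1 := by
    rw [freeCount_detach hvn hk, if_pos rfl]; push_cast; rfl
  have hacc0 := I.forest.acc_nonneg B (Nat.lt_succ_self v)
  refine ⟨F, ?_, ?_, ?_, ?_, ?_⟩
  · intro w hw hzw hkw hpw hMw
    have hwv : w ≠ v := by rintro rfl; simp at hkw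
    rw [Function.update_of_ne hwv] at hkw ⊢
    exact I.small w hw (by omega) hkw (by omega) (hMw.trans_le (hMle _))
  · intro r hr hzr hkr
    have hrv : r ≠ v := by rintro rfl; omega
    exact (hMle r).trans (I.M_le r hr (by omega) hkr)
  · rw [splitCost_detach hvn hk hpv]
    linarith [I.cost_le, B.cost_metric.nonneg v (par v)]
  · intro r hr hkr hMr
    by_cases hrv : r = rt v
    · subst hrv
      rw [hcv]
      -- For the last cut from a tree, `M > 1` turns the standard bound into `2 * L ≤ S`, and the
      -- weaker alternative into `2 * L + 2 * b v - 1 ≤ S`. This is where `vertex_le` is needed.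
      rcases I.count _ hr hkr hM with h₁ | ⟨v', h₁, -, h₃, h₄⟩
      · have := B.load_le _ hr hkr
        linarith
      · obtain rfl : v = v' := by omega
        have := B.vertex_le v hvn
        linarith
    · rw [hcnt r hrv]
      rw [Function.update_of_ne hrv] at hMr
      exact I.count_le r hr hkr hMr
  · intro r hr hkr hMr
    left
    by_cases hrv : r = rt v
    · subst hrv
      rw [hcv, Function.update_self]
      -- The removed size is at least `1/2` and at least `b v`; these two facts restore the standard
      -- bound from the two alternatives.
      rcases I.count _ hr hkr hM with h₁ | ⟨v', h₁, -, h₃, h₄⟩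
      · linarith
      · obtain rfl : v = v' := by omega
        linarith
    · rw [hcnt r hrv]
      rw [Function.update_of_ne hrv] at hMr ⊢
      rcases I.count r hr hkr hMr with h₁ | ⟨v', h₁, h₂, -⟩
      · exact h₁
      · obtain rfl : v = v' := by omega
        exact absurd h₂ hrv

theorem SplitInv.initial (B : RoundedForest n d c b par₀ kept₀ rt S) {acc sz M : ℕ → ℝ}
    (hacc : ∀ v < n, acc v = 0) (hM : ∀ r < n, M r = rootLoad n d b par₀ kept₀ rt r)
    (hK : splitCost n c par₀ kept₀ par₀ ≤ K) :
    SplitInv n d c b par₀ kept₀ rt S K n kept₀ par₀ acc sz M (fun _ => 0) (fun p => p) := by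
  have hcount : ∀ r < n, freeCount n kept₀ rt r ≤ 1 := by
    intro r hr
    refine (Finset.card_le_card (t := {r}) fun x hx => ?_).trans (Finset.card_singleton r).le
    rw [Finset.mem_filter] at hx
    obtain ⟨h₁, h₂, h₃⟩ := hx
    rw [B.rt_eq x (Finset.mem_range.1 h₁), if_neg (by omega)] at h₃
    exact Finset.mem_singleton.2 h₃
  have hcast : ∀ r < n, (freeCount n kept₀ rt r : ℝ) ≤ 1 := by
    intro r hr
    exact_mod_cast hcount r hr
  refine ⟨⟨le_rfl, fun _ _ => rfl, fun _ _ => rfl, ?_, ?_, ?_, ?_, ?_, ?_, ?_⟩, ?_, ?_, hK, ?_, ?_⟩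
  · intro x hx hk
    have := B.par_lt x hx hk
    exact ⟨by omega, by exact_mod_cast this⟩
  · intro w hw hz; omega
  · intro w hw hz; exact le_rfl
  · intro w hw hz; omega
  · intro w hw hz; omega
  · intro v hv
    rw [hacc v hv, Finset.sum_eq_zero]
    intro x hx
    have := Finset.mem_range.1 hx
    rw [if_neg (by omega)]
  · intro r hr hk
    rw [hM r hr, rootLoad, Finset.sum_filter]
    refine Finset.sum_congr rfl fun v hv => ?_
    rw [hacc v (Finset.mem_range.1 hv), add_zero, ownLoad]
  · intro w hw hz; omega
  · intro w hw hz; omega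
  · intro r hr hk hMr
    exact (hcast r hr).trans (B.one_le r hr hk)
  · intro r hr hk hMr
    left
    rw [hM r hr]
    linarith [hcast r hr]

theorem card_free_eq_sum (B : RoundedForest n d c b par₀ kept₀ rt S) (kept : ℕ → ℕ) :
    ((Finset.range n).filter fun x => kept x = 0).card =
      ∑ r ∈ Finset.range n with kept₀ r = 0, freeCount n kept rt r := by
  rw [Finset.card_eq_sum_card_fiberwise (f := rt)
    (t := (Finset.range n).filter fun r => kept₀ r = 0)]
  · refine Finset.sum_congr rfl fun r _ => ?_
    rw [freeCount, Finset.filter_filter]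
  · intro x hx
    have hxn := Finset.mem_range.1 (Finset.mem_filter.1 hx).1
    exact Finset.mem_filter.2 ⟨Finset.mem_range.2 ((B.rt_le x hxn).trans_lt hxn), B.kept_rt x hxn⟩

/-- With everything settled, no remainder exceeds 1, so `count_le` applies to each rounded tree. -/
theorem SplitInv.card_free_le (I : SplitInv n d c b par₀ kept₀ rt S K 0 kept par acc sz M h ρ)
    (B : RoundedForest n d c b par₀ kept₀ rt S) :
    (((Finset.range n).filter fun x => kept x = 0).card : ℝ) ≤
      ∑ r ∈ Finset.range n with kept₀ r = 0, S r := by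
  rw [card_free_eq_sum B]
  push_cast
  refine Finset.sum_le_sum fun r hr => ?_
  rw [Finset.mem_filter, Finset.mem_range] at hr
  exact I.count_le r hr.1 hr.2 (I.M_le r hr.1 (Nat.zero_le _) hr.2)

end

/-! ## Splitting as a program -/

namespace RealRAM

open Program

/-- Condition that two natural numbers are equal. -/
abbrev natEq (p q : NExp) : Test := .and (.natLe p q) (.natLe q p)

/-- Roots and tree loads are obtained in one pass: parents precede their children, so the root of
the parent is known and its load cell is already initialised when a child adds its own load. -/
def splitInitBody : Program :=
  .seq (.ite (.natLe (.const 1) (.get 9 (nvar 12)))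
    (.seq (.setNat 10 (nvar 12) (.get 10 (.get 6 (nvar 12))))
      (.setReal 9 (nvar 12) (.add (.get 7 (nvar 12)) (.get 5 (nvar 12)))))
    (.seq (.setNat 10 (nvar 12) (nvar 12)) (.setReal 9 (nvar 12) (.get 7 (nvar 12)))))
  (.seq (.setReal 10 (nvar 12) (.const 0))
  (.seq (.setReal 12 (nvar 12) (.const 0))
    (.setReal 12 (.get 10 (nvar 12))
      (.add (.get 12 (.get 10 (nvar 12))) (.get 9 (nvar 12))))))

/-- Condition that the vertex in variable `12` is a pending child of the one in variable `16`. -/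
def isChild : Test :=
  .and (.natLe (.const 1) (.get 9 (nvar 12))) (natEq (.get 6 (nvar 12)) (nvar 16))

def findLargestBody : Program :=
  .ite isChild
    (.ite (.and (.natLe (.const 1) (nvar 13))
        (.not (.realLe (.get 11 (nvar 13)) (.get 11 (nvar 12)))))
      .skip (.setNat 13 (.const 0) (nvar 12)))
    .skip

/-- Real variable `14` holds the size `g` of the group and natural variable `14` its current root.
Collection stops as soon as `g` reaches `1/2`. -/
def collectBody : Program :=
  .ite (.and isChild (.not (.realLe (.const (1 / 2)) (rvar 14))))
    (.seq (.setNat 9 (nvar 12) (.const 0))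
    (.seq (.setNat 9 (nvar 14) (.const 1))
    (.seq (.setNat 6 (nvar 14) (nvar 12))
    (.seq (.setReal 14 (.const 0) (.add (rvar 14) (.get 11 (nvar 12))))
      (.setNat 14 (.const 0) (nvar 12))))))
    .skip

def splitGroup : Program :=
  .seq (.setNat 13 (.const 0) (.const 0))
  (.seq (forLoop 12 (.const 0) findLargestBody)
  (.seq (.seq (.setNat 9 (nvar 13) (.const 0))
    (.seq (.setReal 14 (.const 0) (.get 11 (nvar 13)))
      (.setNat 14 (.const 0) (nvar 13))))
  (.seq (forLoop 12 (.const 0) collectBody)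
    (.seq (.setReal 10 (nvar 16) (.sub (.get 10 (nvar 16)) (rvar 14)))
      (.setReal 12 (.get 10 (nvar 16)) (.sub (.get 12 (.get 10 (nvar 16))) (rvar 14)))))))

/-- If the vertex has a parent, its size either leaves the tree as a new part, when the remainder
exceeds 1 and the size is at least `1/2`, or is passed on to the parent. -/
def splitSettle : Program :=
  .seq (.setReal 11 (nvar 16) (.add (.get 9 (nvar 16)) (.get 10 (nvar 16))))
  (.seq (.ite (.natLe (.const 1) (.get 9 (nvar 16)))
    (.ite (.and (.not (.realLe (.get 12 (.get 10 (nvar 16))) (.const 1)))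
        (.realLe (.const (1 / 2)) (.get 11 (nvar 16))))
      (.seq (.setNat 9 (nvar 16) (.const 0))
        (.setReal 12 (.get 10 (nvar 16))
          (.sub (.get 12 (.get 10 (nvar 16))) (.get 11 (nvar 16)))))
      (.setReal 10 (.get 6 (nvar 16)) (.add (.get 10 (.get 6 (nvar 16))) (.get 11 (nvar 16)))))
    .skip)
    (.setNat 15 (.const 0) (nvar 16)))

/-- Condition that the pending children of the vertex in variable `16` have to be separated. -/
def isOverloaded : Test :=
  .and (.not (.realLe (.get 12 (.get 10 (nvar 16))) (.const 1)))
    (.not (.and (.not (.realLe (.const (1 / 2)) (.get 10 (nvar 16))))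
      (.realLe (.add (.get 7 (nvar 16)) (.get 10 (nvar 16))) (.const 1))))

def splitBody : Program :=
  .seq (.setNat 16 (.const 0) (.sub (nvar 15) (.const 1)))
    (.ite isOverloaded splitGroup splitSettle)

/-- Splitting of the rounded forest. -/
def split : Program :=
  .seq (forLoop 12 (.const 0) splitInitBody)
  (.seq (.setNat 15 (.const 0) (nvar 0))
    (.while (.natLe (.const 1) (nvar 15)) splitBody))

variable {n N : ℕ} {d c : ℕ → ℕ → ℝ} {b S : ℕ → ℝ} {γ K : ℝ} {par₀ kept₀ rt : ℕ → ℕ} {s : State}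

theorem reach_splitInit (hN : n ≤ N) (hs : HoldsTree n d c b γ par₀ s)
    (B : RoundedForest n d c b par₀ (s.nat 9) rt S) :
    Reach N (forLoop 12 (.const 0) splitInitBody) (fun s' =>
      (∀ p < n, s'.nat 10 p = rt p ∧ s'.real 9 p = ownLoad d b par₀ (s.nat 9) p ∧
        s'.real 10 p = 0) ∧
      ∀ r < n, s'.real 12 r = rootLoad n d b par₀ (s.nat 9) rt r) s := by
  refine Reach.forLoop (n := n) (fun i s' =>
      (∀ p < i, s'.nat 10 p = rt p ∧ s'.real 9 p = ownLoad d b par₀ (s.nat 9) p ∧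
        s'.real 10 p = 0) ∧
      ∀ r < i, s'.real 12 r =
        ∑ v ∈ Finset.range i, if rt v = r then ownLoad d b par₀ (s.nat 9) v else 0)
    (by decide) (by decide) (by decide) hs.size hN (Nat.zero_le _) ?_ ?_ ?_ ?_
  · intro i s' z h
    simpa [State.nat_setNat_of_ne] using h
  · exact ⟨fun p hp => absurd hp (Nat.not_lt_zero p), fun p hp => absurd hp (Nat.not_lt_zero p)⟩
  · intro i s' _ hin h12 hn' hf ⟨hI, hM⟩
    have e6 : s'.nat 6 = par₀ := (hf.nat 6 (by decide)).trans hs.par_eq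
    have e9 : s'.nat 9 = s.nat 9 := hf.nat 9 (by decide)
    have r5 : s'.real 5 = s.real 5 := hf.real 5 (by decide)
    have r7 : s'.real 7 = s.real 7 := hf.real 7 (by decide)
    have hrt := B.rt_eq i hin
    have hrle := B.rt_le i hin
    have hsum : ∀ r, r < i + 1 → Function.update (Function.update (s'.real 12) i 0) (rt i)
        (Function.update (s'.real 12) i 0 (rt i) + ownLoad d b par₀ (s.nat 9) i) r =
        ∑ v ∈ Finset.range (i + 1), if rt v = r then ownLoad d b par₀ (s.nat 9) v else 0 := by
      intro r hr
      rw [Finset.sum_range_succ]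
      have hbase : Function.update (s'.real 12) i 0 r =
          ∑ v ∈ Finset.range i, if rt v = r then ownLoad d b par₀ (s.nat 9) v else 0 := by
        by_cases hri : r = i
        · subst hri
          rw [Function.update_self, Finset.sum_eq_zero]
          intro v hv
          have hv := Finset.mem_range.1 hv
          have := B.rt_le v (by omega)
          rw [if_neg (by omega)]
        · rw [Function.update_of_ne hri, hM r (by omega)]
      by_cases hri : r = rt i
      · rw [← hri, Function.update_self, hbase, if_pos rfl]
      · rw [Function.update_of_ne hri, hbase, if_neg (Ne.symm hri), add_zero]
    refine Reach.of_run (by simp [splitInitBody, Program.LoopFree]) ?_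
    simp only [splitInitBody, Program.run, Test.Holds, NExp.eval, RExp.eval, h12, e6, e9]
    split_ifs with hk
    · rw [if_pos hk] at hrt
      have hi1 : 1 ≤ i := by have := B.par_lt i hin hk; omega
      have hown : ownLoad d b par₀ (s.nat 9) i = s.real 7 i + s.real 5 i := by
        rw [ownLoad, if_pos hk, hs.load i hin hi1, hs.vertexLoad i hin]
      have hp := (hI (par₀ i) (B.par_lt i hin hk)).1
      rw [hown, hrt] at hsum
      simp [State.nat_setNat_of_ne, State.real_setReal_of_ne, h12, r5, r7, hp]
      refine ⟨fun p hpi => ?_, fun r hr => hsum r (by omega)⟩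
      by_cases hpi' : p = i
      · subst hpi'
        simp [hrt, hown]
      · have := hI p (by omega)
        simpa [hpi'] using this
    · rw [if_neg hk] at hrt
      have hown : ownLoad d b par₀ (s.nat 9) i = s.real 7 i := by
        rw [ownLoad, if_neg hk, hs.vertexLoad i hin, add_zero]
      rw [hown, hrt] at hsum
      simp [State.nat_setNat_of_ne, State.real_setReal_of_ne, h12, r7]
      simp only [Function.update_self, zero_add, Function.update_idem] at hsum
      refine ⟨fun p hpi => ?_, fun r hr => hsum r (by omega)⟩
      by_cases hpi' : p = i
      · subst hpi'
        simp [hrt, hown]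
      · have := hI p (by omega)
        simpa [hpi'] using this
  · rintro s' hf ⟨hI, hM⟩
    refine ⟨hI, fun r hr => ?_⟩
    rw [hM r hr, rootLoad, Finset.sum_filter]
    rfl

theorem isChild_holds_iff {v p : ℕ} (hv : s.nat 16 0 = v) (hp : s.nat 12 0 = p) :
    isChild.Holds s ↔ 1 ≤ s.nat 9 p ∧ s.nat 6 p = v := by
  simp only [isChild, natEq, Test.Holds, NExp.eval, hv, hp, le_antisymm_iff]

/-- Variable `13` uses 0 for "nothing found", so position 0 must not itself be a child of `v`; `hch`
excludes this. -/
theorem reach_findLargest {v : ℕ} (hN : n ≤ N) (hn : s.nat 0 0 = n) (hv : s.nat 16 0 = v)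
    (h0 : s.nat 13 0 = 0) (hch : ¬ (1 ≤ s.nat 9 0 ∧ s.nat 6 0 = v)) :
    Reach N (forLoop 12 (.const 0) findLargestBody) (fun s' =>
      (∀ p < n, 1 ≤ s.nat 9 p → s.nat 6 p ≠ v) ∨
      (s'.nat 13 0 < n ∧ 1 ≤ s.nat 9 (s'.nat 13 0) ∧ s.nat 6 (s'.nat 13 0) = v ∧
        ∀ p < n, 1 ≤ s.nat 9 p → s.nat 6 p = v → s.real 11 p ≤ s.real 11 (s'.nat 13 0))) s := by
  refine Reach.forLoop (n := n) (fun i s' =>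
      (s'.nat 13 0 = 0 ∧ ∀ p < i, 1 ≤ s.nat 9 p → s.nat 6 p ≠ v) ∨
      (s'.nat 13 0 < n ∧ 1 ≤ s.nat 9 (s'.nat 13 0) ∧ s.nat 6 (s'.nat 13 0) = v ∧
        ∀ p < i, 1 ≤ s.nat 9 p → s.nat 6 p = v → s.real 11 p ≤ s.real 11 (s'.nat 13 0)))
    (by decide) (by decide) (by decide) hn hN (Nat.zero_le _) ?_ ?_ ?_ ?_
  · intro i s' z h
    simpa [State.nat_setNat_of_ne] using h
  · exact Or.inl ⟨h0, fun p hp => absurd hp (Nat.not_lt_zero p)⟩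
  · intro i s' _ hin h12 hn' hf hI
    have e6 : s'.nat 6 = s.nat 6 := hf.nat 6 (by decide)
    have e9 : s'.nat 9 = s.nat 9 := hf.nat 9 (by decide)
    have e16 : s'.nat 16 0 = v := by rw [hf.nat 16 (by decide), hv]
    have r11 : s'.real 11 = s.real 11 := hf.real 11 (by decide)
    refine Reach.of_run (by simp [findLargestBody, Program.LoopFree]) ?_
    simp only [findLargestBody, Program.run, isChild_holds_iff e16 h12, e6, e9, Test.Holds,
      NExp.eval, RExp.eval, h12, r11]
    split_ifs with hc hw
    · rcases hI with ⟨h₁, h₂⟩ | ⟨h₁, h₂, h₃, h₄⟩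
      · omega
      · refine Or.inr ⟨h₁, h₂, h₃, fun p hp hk hpv => ?_⟩
        by_cases hpi : p = i
        · subst hpi; exact (not_le.1 hw.2).le
        · exact h₄ p (by omega) hk hpv
    · right
      simp only [State.nat_setNat_same, Function.update_self]
      refine ⟨hin, hc.1, hc.2, fun p hp hk hpv => ?_⟩
      by_cases hpi : p = i
      · subst hpi; exact le_rfl
      · rcases hI with ⟨h₁, h₂⟩ | ⟨h₁, h₂, h₃, h₄⟩
        · exact absurd hpv (h₂ p (by omega) hk)
        · have h13 : 1 ≤ s'.nat 13 0 := by
            by_contra h13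
            have : s'.nat 13 0 = 0 := by omega
            rw [this] at h₂ h₃
            exact hch ⟨h₂, h₃⟩
          have h₅ : s.real 11 (s'.nat 13 0) ≤ s.real 11 i := by
            by_contra hcon
            exact hw ⟨h13, hcon⟩
          exact (h₄ p (by omega) hk hpv).trans h₅
    · rcases hI with ⟨h₁, h₂⟩ | ⟨h₁, h₂, h₃, h₄⟩
      · refine Or.inl ⟨h₁, fun p hp hk hpv => ?_⟩
        by_cases hpi : p = i
        · subst hpi; exact hc ⟨hk, hpv⟩
        · exact h₂ p (by omega) hk hpv
      · refine Or.inr ⟨h₁, h₂, h₃, fun p hp hk hpv => ?_⟩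
        by_cases hpi : p = i
        · subst hpi; exact absurd ⟨hk, hpv⟩ hc
        · exact h₄ p (by omega) hk hpv
  · rintro s' hf (⟨-, h⟩ | h)
    · exact Or.inl h
    · exact Or.inr h

/-- One pass suffices. Adopted children are redirected or become the root of the group, so none of
them is a child of `v` any longer; the pass leaves either `g ≥ 1/2` or no child of `v`. -/
theorem reach_collect {v : ℕ} {s₁ : ℝ} {kept₁ par₁ : ℕ → ℕ} (hN : n ≤ N) (hn : s.nat 0 0 = n)
    (hv : s.nat 16 0 = v) (B : RoundedForest n d c b par₀ kept₀ rt S) (hs₁ : s₁ < 1 / 2)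
    (hs : ∀ p < n, 1 ≤ kept₁ p → par₁ p = v → s.real 11 p ≤ s₁)
    (hG : ∃ h ρ, GroupInv n d c b par₀ kept₀ rt K v s₁ kept₁ par₁ (s.real 10) (s.real 11)
      (s.real 12) (s.nat 9) (s.nat 6) (s.real 14 0) (s.nat 14 0) h ρ) :
    Reach N (forLoop 12 (.const 0) collectBody) (fun s' =>
      (∃ h ρ, GroupInv n d c b par₀ kept₀ rt K v s₁ kept₁ par₁ (s.real 10) (s.real 11)
        (s.real 12) (s'.nat 9) (s'.nat 6) (s'.real 14 0) (s'.nat 14 0) h ρ) ∧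
      (1 / 2 ≤ s'.real 14 0 ∨ ∀ p < n, 1 ≤ s'.nat 9 p → s'.nat 6 p ≠ v)) s := by
  refine Reach.forLoop (n := n) (fun i s' =>
      (∃ h ρ, GroupInv n d c b par₀ kept₀ rt K v s₁ kept₁ par₁ (s.real 10) (s.real 11)
        (s.real 12) (s'.nat 9) (s'.nat 6) (s'.real 14 0) (s'.nat 14 0) h ρ) ∧
      (1 / 2 ≤ s'.real 14 0 ∨ ∀ p < i, 1 ≤ s'.nat 9 p → s'.nat 6 p ≠ v))
    (by decide) (by decide) (by decide) hn hN (Nat.zero_le _) ?_ ?_ ?_ (fun s' _ h => h)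
  · intro i s' z h
    simpa [State.nat_setNat_of_ne] using h
  · exact ⟨hG, Or.inr fun p hp => absurd hp (Nat.not_lt_zero p)⟩
  · rintro i s' _ hin h12 hn' hf ⟨⟨h, ρ, G⟩, hI⟩
    have e16 : s'.nat 16 0 = v := by rw [hf.nat 16 (by decide), hv]
    have r11 : s'.real 11 = s.real 11 := hf.real 11 (by decide)
    refine Reach.of_run (by simp [collectBody, Program.LoopFree]) ?_
    have hiff : (Test.and isChild (.not (.realLe (.const (1 / 2)) (rvar 14)))).Holds s' ↔
        (1 ≤ s'.nat 9 i ∧ s'.nat 6 i = v) ∧ ¬ 1 / 2 ≤ s'.real 14 0 := by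
      show isChild.Holds s' ∧ _ ↔ _
      rw [isChild_holds_iff e16 h12]
      simp [Test.Holds, RExp.eval, NExp.eval]
    simp only [collectBody, Program.run, hiff]
    split_ifs with hc
    · obtain ⟨⟨hk, hpv⟩, hg⟩ := hc
      rw [not_le] at hg
      have hz := G.forest.settled_of_par B hin hk (by omega)
      have hold := G.old i hin hz hk (by omega)
      have G' := G.step B hs₁ hg hin hk hpv (hs i hin hold.1 (hold.2.trans hpv))
      have hi14 : i ≠ s'.nat 14 0 := by
        intro heq
        have := G.root
        rw [← heq] at this
        omega
      simp only [NExp.eval, RExp.eval, State.nat_setNat_same, State.nat_setReal, State.real_setNat,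
        State.real_setReal_same, Function.update_self, h12, r11,
        State.nat_setNat_of_ne _ _ _ (show (12 : ℕ) ≠ 9 by decide),
        State.nat_setNat_of_ne _ _ _ (show (12 : ℕ) ≠ 6 by decide),
        State.nat_setNat_of_ne _ _ _ (show (14 : ℕ) ≠ 9 by decide),
        State.nat_setNat_of_ne _ _ _ (show (14 : ℕ) ≠ 6 by decide),
        State.nat_setNat_of_ne _ _ _ (show (9 : ℕ) ≠ 14 by decide),
        State.nat_setNat_of_ne _ _ _ (show (9 : ℕ) ≠ 6 by decide),
        State.nat_setNat_of_ne _ _ _ (show (6 : ℕ) ≠ 14 by decide),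
        State.nat_setNat_of_ne _ _ _ (show (6 : ℕ) ≠ 9 by decide)]
      refine ⟨⟨_, _, G'⟩, ?_⟩
      rcases hI with hI | hI
      · linarith
      · right
        intro p hp hkp
        by_cases hpq : p = s'.nat 14 0
        · rw [hpq, Function.update_self]
          omega
        · rw [Function.update_of_ne hpq] at hkp ⊢
          have hpi : p ≠ i := by rintro rfl; simp at hkp
          rw [Function.update_of_ne hpi] at hkp
          exact hI p (by omega) hkp
    · refine ⟨⟨h, ρ, G⟩, ?_⟩
      rcases hI with hI | hI
      · exact Or.inl hI
      · by_cases hg : 1 / 2 ≤ s'.real 14 0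
        · exact Or.inl hg
        · right
          intro p hp hkp hpv
          by_cases hpi : p = i
          · subst hpi
            exact hc ⟨⟨hkp, hpv⟩, hg⟩
          · exact hI p (by omega) hkp hpv

end RealRAM

/-! ### The main loop of the splitting procedure -/

namespace RealRAM

open Program

variable {n N : ℕ} {d c : ℕ → ℕ → ℝ} {b S : ℕ → ℝ} {γ K : ℝ} {par₀ kept₀ rt : ℕ → ℕ} {s : State}

/-- The data that remain unchanged during the splitting. -/
structure HoldsForest (n : ℕ) (d : ℕ → ℕ → ℝ) (b : ℕ → ℝ) (par₀ kept₀ rt : ℕ → ℕ) (s : State) :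
    Prop where
  size : s.nat 0 0 = n
  root : ∀ p < n, s.nat 10 p = rt p
  vertexLoad : ∀ p < n, s.real 7 p = b p
  load : ∀ p < n, s.real 9 p = ownLoad d b par₀ kept₀ p

theorem HoldsForest.of_eq {s' : State} (h : HoldsForest n d b par₀ kept₀ rt s)
    (h0 : s'.nat 0 = s.nat 0) (h10 : s'.nat 10 = s.nat 10) (h7 : s'.real 7 = s.real 7)
    (h9 : s'.real 9 = s.real 9) : HoldsForest n d b par₀ kept₀ rt s' := by
  constructor
  · rw [h0]; exact h.size
  · rw [h10]; exact h.root
  · rw [h7]; exact h.vertexLoad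
  · rw [h9]; exact h.load

/-- The splitting invariant for the contents of the memory. -/
def SplitState (n : ℕ) (d c : ℕ → ℕ → ℝ) (b : ℕ → ℝ) (par₀ kept₀ rt : ℕ → ℕ) (S : ℕ → ℝ)
    (K : ℝ) (z : ℕ) (s : State) : Prop :=
  ∃ h ρ, SplitInv n d c b par₀ kept₀ rt S K z (s.nat 9) (s.nat 6) (s.real 10) (s.real 11)
    (s.real 12) h ρ

theorem reach_splitGroup {v : ℕ} (hN : n ≤ N) (hs : HoldsForest n d b par₀ kept₀ rt s)
    (hv : s.nat 16 0 = v) (B : RoundedForest n d c b par₀ kept₀ rt S)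
    (hI : SplitState n d c b par₀ kept₀ rt S K (v + 1) s) (hM : 1 < s.real 12 (rt v))
    (ha : 1 / 2 ≤ s.real 10 v ∨ 1 < b v + s.real 10 v) :
    Reach N splitGroup (fun s' => SplitState n d c b par₀ kept₀ rt S K (v + 1) s' ∧
      ∀ r, freeCount n (s'.nat 9) rt r =
        freeCount n (s.nat 9) rt r + if rt v = r then 1 else 0) s := by
  obtain ⟨h, ρ, I⟩ := hI
  have hvn : v < n := I.forest.le
  refine Reach.seq (Reach.of_run trivial ?_)
  simp only [Program.run, NExp.eval]
  -- Every pending child of `v` is settled and therefore lies after `v`, so it is not position 0.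
  have hch : ¬ (1 ≤ s.nat 9 0 ∧ s.nat 6 0 = v) := by
    rintro ⟨h₁, h₂⟩
    have := I.forest.settled_of_par B (by omega) h₁ (by omega)
    omega
  refine Reach.seq (Reach.mono (Reach.frame (reach_findLargest (v := v) hN
    (by rw [State.nat_setNat_of_ne _ _ _ (by decide), hs.size])
    (by rw [State.nat_setNat_of_ne _ _ _ (by decide), hv]) (by simp)
    (by simpa [State.nat_setNat_of_ne] using hch))) ?_)
  rintro s₁ ⟨hor, hf⟩
  simp only [State.nat_setNat_of_ne _ _ _ (show (9 : ℕ) ≠ 13 by decide),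
    State.nat_setNat_of_ne _ _ _ (show (6 : ℕ) ≠ 13 by decide), State.real_setNat] at hor
  have e0 : s₁.nat 0 0 = n := by
    rw [hf.nat 0 (by decide), State.nat_setNat_of_ne _ _ _ (by decide), hs.size]
  have e6 : s₁.nat 6 = s.nat 6 := by
    rw [hf.nat 6 (by decide), State.nat_setNat_of_ne _ _ _ (by decide)]
  have e9 : s₁.nat 9 = s.nat 9 := by
    rw [hf.nat 9 (by decide), State.nat_setNat_of_ne _ _ _ (by decide)]
  have e10 : s₁.nat 10 = s.nat 10 := by
    rw [hf.nat 10 (by decide), State.nat_setNat_of_ne _ _ _ (by decide)]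
  have e16 : s₁.nat 16 0 = v := by
    rw [hf.nat 16 (by decide), State.nat_setNat_of_ne _ _ _ (by decide), hv]
  have r10 : s₁.real 10 = s.real 10 := hf.real 10 (by decide)
  have r11 : s₁.real 11 = s.real 11 := hf.real 11 (by decide)
  have r12 : s₁.real 12 = s.real 12 := hf.real 12 (by decide)
  obtain ⟨w, hw⟩ : ∃ w, s₁.nat 13 0 = w := ⟨_, rfl⟩
  rw [hw] at hor
  -- Without pending children `acc v` would be 0, and `b v < 1` would contradict that `v` is
  -- overloaded.
  have hor' : w < n ∧ 1 ≤ s.nat 9 w ∧ s.nat 6 w = v ∧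
      ∀ p < n, 1 ≤ s.nat 9 p → s.nat 6 p = v → s.real 11 p ≤ s.real 11 w := by
    rcases hor with hor | hor
    · have h0 : s.real 10 v = 0 := by
        rw [I.forest.acc_eq v (Nat.lt_succ_self v)]
        exact Finset.sum_eq_zero fun x hx => if_neg fun hc =>
          hor x (Finset.mem_range.1 hx) hc.2.1 hc.2.2
      have := B.b_lt_one v hvn
      rcases ha with ha | ha <;> linarith
    · exact hor
  obtain ⟨hwn, hk, hpv, hmax⟩ := hor'
  have hz := I.forest.settled_of_par B hwn hk (by omega)
  have hrtw := (I.forest.pending w hwn hz hk (by omega)).2.2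
  rw [hpv] at hrtw
  have hsw := I.small w hwn hz hk (by omega) (by rwa [hrtw])
  have G := GroupInv.start I B hwn hk hpv hsw
  refine Reach.seq (Reach.of_run (by simp [Program.LoopFree]) ?_)
  simp only [Program.run, NExp.eval, RExp.eval]
  refine Reach.seq (Reach.mono (Reach.frame (reach_collect (K := K) (v := v) (s₁ := s.real 11 w)
    (kept₁ := s.nat 9) (par₁ := s.nat 6) hN ?_ ?_ B hsw ?_ ?_)) ?_)
  · simp [State.nat_setNat_of_ne, e0]
  · simp [State.nat_setNat_of_ne, e16]
  · simpa [State.real_setReal_of_ne, r11] using hmax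
  · refine ⟨h, ρ, ?_⟩
    simpa [State.nat_setNat_of_ne, State.real_setReal_of_ne, hw, e6, e9, r10, r11, r12] using G
  · rintro s₂ ⟨⟨⟨h', ρ', G'⟩, hg⟩, hf₂⟩
    have e10' : s₂.nat 10 v = rt v := by
      rw [hf₂.nat 10 (by decide)]
      simp [State.nat_setNat_of_ne, e10, hs.root v hvn]
    have e16' : s₂.nat 16 0 = v := by
      rw [hf₂.nat 16 (by decide)]
      simp [State.nat_setNat_of_ne, e16]
    have r10' : s₂.real 10 = s.real 10 := by
      rw [hf₂.real 10 (by decide)]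
      simp [State.real_setReal_of_ne, r10]
    have r11' : s₂.real 11 = s.real 11 := by
      rw [hf₂.real 11 (by decide)]
      simp [State.real_setReal_of_ne, r11]
    have r12' : s₂.real 12 = s.real 12 := by
      rw [hf₂.real 12 (by decide)]
      simp [State.real_setReal_of_ne, r12]
    simp only [State.nat_setReal, State.real_setNat,
      State.real_setReal_of_ne _ _ _ (show (10 : ℕ) ≠ 14 by decide),
      State.real_setReal_of_ne _ _ _ (show (11 : ℕ) ≠ 14 by decide),
      State.real_setReal_of_ne _ _ _ (show (12 : ℕ) ≠ 14 by decide), r10, r11, r12] at G'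
    have I' := I.group B G' hM ha hg
    refine Reach.of_run (by simp [Program.LoopFree]) ?_
    simp only [Program.run, NExp.eval, RExp.eval]
    refine ⟨⟨h', ρ', ?_⟩, ?_⟩
    · simpa [State.real_setReal_of_ne, e16', e10', r10', r11', r12'] using I'
    · simpa using G'.count

theorem reach_splitSettle {v : ℕ} (hs : HoldsForest n d b par₀ kept₀ rt s)
    (hv : s.nat 16 0 = v) (B : RoundedForest n d c b par₀ kept₀ rt S)
    (hI : SplitState n d c b par₀ kept₀ rt S K (v + 1) s)
    (ha : 1 < s.real 12 (rt v) → s.real 10 v < 1 / 2 ∧ b v + s.real 10 v ≤ 1) :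
    Reach N splitSettle (fun s' => s'.nat 15 0 = v ∧
      SplitState n d c b par₀ kept₀ rt S K v s' ∧ ∀ x < n, s.nat 9 x = 0 → s'.nat 9 x = 0) s := by
  obtain ⟨h, ρ, I⟩ := hI
  have hvn : v < n := I.forest.le
  refine Reach.of_run (by simp [splitSettle, Program.LoopFree]) ?_
  simp only [splitSettle, Program.run, Test.Holds, NExp.eval, RExp.eval, hv, State.nat_setReal,
    State.real_setReal_same, Function.update_self, hs.load v hvn, hs.root v hvn,
    State.real_setReal_of_ne _ _ _ (show (12 : ℕ) ≠ 11 by decide), Rat.cast_one]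
  split_ifs with hk hc
  · rw [not_le] at hc
    have hhalf : ((1 / 2 : ℚ) : ℝ) = 1 / 2 := by norm_num
    rw [hhalf] at hc
    have I' := I.settle_cut B hk hc.1 (ha hc.1).2 hc.2
    simp [State.nat_setNat_of_ne, State.real_setReal_of_ne, hs.root v hvn, hv]
    refine ⟨⟨Function.update h v (b v + s.real 10 v), ρ, ?_⟩, ?_⟩
    · simpa [State.nat_setNat_of_ne, State.real_setReal_of_ne] using I'
    · intro x _ hx
      by_cases hxv : x = v
      · subst hxv; simp
      · rw [Function.update_of_ne hxv, hx]
  · have hhalf : ((1 / 2 : ℚ) : ℝ) = 1 / 2 := by norm_num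
    rw [not_le, hhalf] at hc
    have I' := I.settle (acc' := Function.update (s.real 10) (s.nat 6 v)
      (s.real 10 (s.nat 6 v) + (ownLoad d b par₀ kept₀ v + s.real 10 v))) B (by
        intro x hx
        by_cases hxp : x = s.nat 6 v
        · subst hxp
          rw [Function.update_self, if_pos ⟨hk, rfl⟩]
        · rw [Function.update_of_ne hxp, if_neg (fun hc => hxp hc.2.symm), add_zero])
      (fun hM => (ha hM).2) (fun _ hM => by
        by_contra hcon
        exact hc ⟨hM, not_lt.1 hcon⟩)
    simp [State.nat_setNat_of_ne, State.real_setReal_of_ne, hv]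
    refine ⟨Function.update h v (b v + s.real 10 v), ρ, ?_⟩
    simpa [State.nat_setNat_of_ne, State.real_setReal_of_ne] using I'
  · have I' := I.settle (acc' := s.real 10) B (by
        intro x hx
        rw [if_neg (fun hc => hk hc.1), add_zero]) (fun hM => (ha hM).2)
        (fun h _ => absurd h hk)
    simp [State.nat_setNat_of_ne, hv]
    refine ⟨Function.update h v (b v + s.real 10 v), ρ, ?_⟩
    simpa [State.nat_setNat_of_ne, State.real_setReal_of_ne] using I'

theorem isOverloaded_holds_iff {v : ℕ} (hs : HoldsForest n d b par₀ kept₀ rt s)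
    (hv : s.nat 16 0 = v) (hvn : v < n) :
    isOverloaded.Holds s ↔ 1 < s.real 12 (rt v) ∧
      (1 / 2 ≤ s.real 10 v ∨ 1 < b v + s.real 10 v) := by
  have hhalf : ((1 / 2 : ℚ) : ℝ) = 1 / 2 := by norm_num
  simp only [isOverloaded, Test.Holds, NExp.eval, RExp.eval, hv, hs.root v hvn,
    hs.vertexLoad v hvn, Rat.cast_one, hhalf, not_and_or, not_le, not_lt]

/-- The measure adds the number of unsettled vertices and the number of vertices that are not roots.
Forming a group creates exactly one root and settles nothing; settling decreases the first summand
and never destroys a root. -/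
theorem reach_splitBody (hN : n ≤ N) (hs : HoldsForest n d b par₀ kept₀ rt s)
    (B : RoundedForest n d c b par₀ kept₀ rt S) (hz : 1 ≤ s.nat 15 0)
    (hI : SplitState n d c b par₀ kept₀ rt S K (s.nat 15 0) s) :
    Reach N splitBody (fun s' => (SplitState n d c b par₀ kept₀ rt S K (s'.nat 15 0) s' ∧
      HoldsForest n d b par₀ kept₀ rt s') ∧
      s'.nat 15 0 + (n - ((Finset.range n).filter fun x => s'.nat 9 x = 0).card) <
      s.nat 15 0 + (n - ((Finset.range n).filter fun x => s.nat 9 x = 0).card)) s := by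
  obtain ⟨v, hv⟩ : ∃ v, s.nat 15 0 = v + 1 := ⟨s.nat 15 0 - 1, by omega⟩
  rw [hv] at hI ⊢
  have hvn : v < n := by
    obtain ⟨h, ρ, I⟩ := hI
    exact I.forest.le
  refine Reach.seq (Reach.of_run trivial ?_)
  simp only [Program.run, NExp.eval, hv, Nat.add_sub_cancel]
  have hs' : HoldsForest n d b par₀ kept₀ rt (s.setNat 16 0 v) := by
    refine hs.of_eq ?_ ?_ ?_ ?_ <;> simp [State.nat_setNat_of_ne]
  have hv' : (s.setNat 16 0 v).nat 16 0 = v := by simp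
  have hI' : SplitState n d c b par₀ kept₀ rt S K (v + 1) (s.setNat 16 0 v) := by
    obtain ⟨h, ρ, I⟩ := hI
    refine ⟨h, ρ, ?_⟩
    simpa [State.nat_setNat_of_ne] using I
  refine Reach.ite ?_ ?_
  · intro hc
    rw [isOverloaded_holds_iff hs' hv' hvn] at hc
    refine Reach.mono (Reach.frame (reach_splitGroup hN hs' hv' B hI' hc.1 hc.2)) ?_
    rintro s₁ ⟨⟨hI₁, hcount⟩, hf⟩
    have e15 : s₁.nat 15 0 = v + 1 := by
      rw [hf.nat 15 (by decide), State.nat_setNat_of_ne _ _ _ (by decide), hv]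
    rw [e15]
    refine ⟨⟨hI₁, hs'.of_eq (hf.nat 0 (by decide)) (hf.nat 10 (by decide))
      (hf.real 7 (by decide)) (hf.real 9 (by decide))⟩, ?_⟩
    have hle : ((Finset.range n).filter fun x => s₁.nat 9 x = 0).card ≤ n := by
      simpa using Finset.card_filter_le (Finset.range n) fun x => s₁.nat 9 x = 0
    have hsum : ((Finset.range n).filter fun x => s₁.nat 9 x = 0).card =
        ((Finset.range n).filter fun x => s.nat 9 x = 0).card + 1 := by
      have hmem : rt v ∈ (Finset.range n).filter fun r => kept₀ r = 0 :=
        Finset.mem_filter.2 ⟨Finset.mem_range.2 ((B.rt_le v hvn).trans_lt hvn), B.kept_rt v hvn⟩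
      rw [card_free_eq_sum B, card_free_eq_sum B, Finset.sum_congr rfl fun r _ => hcount r,
        Finset.sum_add_distrib, Finset.sum_ite_eq, if_pos hmem,
        State.nat_setNat_of_ne _ _ _ (show (9 : ℕ) ≠ 16 by decide)]
    omega
  · intro hc
    rw [isOverloaded_holds_iff hs' hv' hvn] at hc
    refine Reach.mono (Reach.frame (reach_splitSettle hs' hv' B hI' ?_)) ?_
    · intro hM
      constructor
      · by_contra hcon
        exact hc ⟨hM, Or.inl (not_lt.1 hcon)⟩
      · by_contra hcon
        exact hc ⟨hM, Or.inr (not_le.1 hcon)⟩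
    · rintro s₁ ⟨⟨e15, hI₁, hk⟩, hf⟩
      rw [e15]
      refine ⟨⟨hI₁, hs'.of_eq (hf.nat 0 (by decide)) (hf.nat 10 (by decide))
        (hf.real 7 (by decide)) (hf.real 9 (by decide))⟩, ?_⟩
      rw [State.nat_setNat_of_ne _ _ _ (show (9 : ℕ) ≠ 16 by decide)] at hk
      have : ((Finset.range n).filter fun x => s.nat 9 x = 0).card ≤
          ((Finset.range n).filter fun x => s₁.nat 9 x = 0).card := by
        refine Finset.card_le_card fun x hx => ?_
        rw [Finset.mem_filter] at hx ⊢
        exact ⟨hx.1, hk x (Finset.mem_range.1 hx.1) hx.2⟩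
      omega

/-- The measure of the loop is at most `2 * n` initially, which is why `N` has to be twice the
number of vertices. -/
theorem reach_split (hN : 2 * n ≤ N) (hs : HoldsTree n d c b γ par₀ s)
    (B : RoundedForest n d c b par₀ (s.nat 9) rt S) (hK : splitCost n c par₀ (s.nat 9) par₀ ≤ K) :
    Reach N split (fun s' => s'.nat 0 0 = n ∧
      SplitState n d c b par₀ (s.nat 9) rt S K 0 s') s := by
  refine Reach.seq (Reach.mono (Reach.frame (reach_splitInit (by omega) hs B)) ?_)
  rintro s₁ ⟨⟨hI, hM⟩, hf⟩
  have e0 : s₁.nat 0 0 = n := by rw [hf.nat 0 (by decide), hs.size]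
  have e6 : s₁.nat 6 = par₀ := (hf.nat 6 (by decide)).trans hs.par_eq
  have e9 : s₁.nat 9 = s.nat 9 := hf.nat 9 (by decide)
  have hs₁ : HoldsForest n d b par₀ (s.nat 9) rt s₁ :=
    ⟨e0, fun p hp => (hI p hp).1,
      by rw [hf.real 7 (by decide)]; exact hs.vertexLoad, fun p hp => (hI p hp).2.1⟩
  refine Reach.seq (Reach.of_run trivial ?_)
  simp only [Program.run, NExp.eval, e0]
  refine Reach.mono (Reach.loop (Q := fun s' => SplitState n d c b par₀ (s.nat 9) rt S K 0 s' ∧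
      HoldsForest n d b par₀ (s.nat 9) rt s')
    (fun s' => SplitState n d c b par₀ (s.nat 9) rt S K (s'.nat 15 0) s' ∧
      HoldsForest n d b par₀ (s.nat 9) rt s')
    (fun s' => s'.nat 15 0 + (n - ((Finset.range n).filter fun x => s'.nat 9 x = 0).card))
    ?_ ?_ ?_ ?_) fun s' h => ⟨h.2.size, h.1⟩
  · simp only [State.nat_setNat_same, Function.update_self]
    omega
  · refine ⟨⟨fun _ => 0, fun p => p, ?_⟩, ?_⟩
    · have := SplitInv.initial B (acc := s₁.real 10) (sz := s₁.real 11) (M := s₁.real 12)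
        (fun p hp => (hI p hp).2.2) hM hK
      simpa [State.nat_setNat_of_ne, e6, e9] using this
    · refine hs₁.of_eq ?_ ?_ ?_ ?_ <;> simp [State.nat_setNat_of_ne]
  · rintro s' ⟨h₁, h₂⟩ hb -
    exact reach_splitBody (by omega) h₂ B hb h₁
  · rintro s' ⟨h₁, h₂⟩ hb -
    simp only [Test.Holds, NExp.eval] at hb
    have : s'.nat 15 0 = 0 := by omega
    rw [this] at h₁
    exact ⟨h₁, h₂⟩

end RealRAM

/-! ## Forests given by parent functions -/

/-- The graph with edges from the elements `x` of `K` to their parents `f x`. -/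
def parentGraph {V : Type*} (K : Finset V) (f : V → V) : SimpleGraph V :=
  SimpleGraph.fromRel fun x y => x ∈ K ∧ f x = y

/-- The function `ρ` decreases from the elements of `K` to their parents. -/
def IsRank {V : Type*} (K : Finset V) (f : V → V) (ρ : V → ℤ) : Prop := ∀ x ∈ K, ρ (f x) < ρ x

namespace IsRank

variable {V : Type*} {K : Finset V} {f : V → V} {ρ : V → ℤ}

theorem ne (h : IsRank K f ρ) {x : V} (hx : x ∈ K) : f x ≠ x := by
  intro he
  have := h x hx
  rw [he] at this
  exact lt_irrefl _ this

theorem adj_iff (h : IsRank K f ρ) {x y : V} :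
    (parentGraph K f).Adj x y ↔ (x ∈ K ∧ f x = y) ∨ (y ∈ K ∧ f y = x) := by
  rw [parentGraph, SimpleGraph.fromRel_adj]
  constructor
  · exact fun h => h.2
  · intro hor
    refine ⟨?_, hor⟩
    rintro rfl
    rcases hor with ⟨h₁, h₂⟩ | ⟨h₁, h₂⟩ <;> exact h.ne h₁ h₂

theorem adj (h : IsRank K f ρ) {x : V} (hx : x ∈ K) : (parentGraph K f).Adj x (f x) :=
  h.adj_iff.2 (Or.inl ⟨hx, rfl⟩)

/-- At a vertex of maximum rank on a cycle, both neighbours on the cycle have to be its parent and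
hence coincide. -/
theorem isAcyclic (h : IsRank K f ρ) : (parentGraph K f).IsAcyclic := by
  classical
  intro v c hc
  obtain ⟨x, hx, hmax⟩ := c.support.toFinset.exists_max_image ρ
    ⟨v, by simp⟩
  rw [List.mem_toFinset] at hx
  have hc' := hc.rotate hx
  have hle : ∀ y ∈ (c.rotate x hx).support, ρ y ≤ ρ x := by
    intro y hy
    refine hmax y (List.mem_toFinset.2 ?_)
    exact (SimpleGraph.Walk.mem_support_rotate_iff c x hx).1 hy
  have hpar : ∀ y, (parentGraph K f).Adj x y → ρ y ≤ ρ x → f x = y := by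
    intro y hadj hy
    rcases h.adj_iff.1 hadj with ⟨-, h₂⟩ | ⟨h₁, h₂⟩
    · exact h₂
    · have := h y h₁
      rw [h₂] at this
      omega
  have hnil := hc'.not_nil
  have h₁ := hpar _ ((c.rotate x hx).adj_snd hnil)
    (hle _ ((c.rotate x hx).getVert_mem_support _))
  have h₂ := hpar _ ((c.rotate x hx).adj_penultimate hnil).symm
    (hle _ ((c.rotate x hx).getVert_mem_support _))
  exact hc'.snd_ne_penultimate (h₁.symm.trans h₂)

/-- Following parents terminates because the rank decreases on a finite set; the end point `R x`
lies outside `K` and characterises the component of `x`. -/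
theorem exists_root [Finite V] (h : IsRank K f ρ) :
    ∃ R : V → V, (∀ x ∉ K, R x = x) ∧ (∀ x ∈ K, R x = R (f x)) ∧ (∀ x, R x ∉ K) ∧
      ∀ x y, (parentGraph K f).Reachable x y ↔ R x = R y := by
  classical
  have wf : WellFounded fun y x : V => ρ y < ρ x := by
    have : IsTrans V fun y x : V => ρ y < ρ x := ⟨fun _ _ _ => lt_trans⟩
    have : Std.Irrefl fun y x : V => ρ y < ρ x := ⟨fun _ => lt_irrefl _⟩
    exact Finite.wellFounded_of_trans_of_irrefl _
  obtain ⟨R, hR⟩ : ∃ R : V → V, ∀ x, R x = if x ∈ K then R (f x) else x := by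
    refine ⟨wf.fix fun x IH => if hx : x ∈ K then IH (f x) (h x hx) else x, fun x => ?_⟩
    rw [wf.fix_eq]
    split_ifs <;> rfl
  have h₁ : ∀ x ∉ K, R x = x := fun x hx => by rw [hR, if_neg hx]
  have h₂ : ∀ x ∈ K, R x = R (f x) := fun x hx => by rw [hR, if_pos hx]
  have h₃ : ∀ x, R x ∉ K ∧ (parentGraph K f).Reachable x (R x) := by
    intro x
    induction x using wf.induction with
    | _ x ih =>
      by_cases hx : x ∈ K
      · obtain ⟨i₁, i₂⟩ := ih (f x) (h x hx)
        rw [h₂ x hx]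
        exact ⟨i₁, (h.adj hx).reachable.trans i₂⟩
      · rw [h₁ x hx]
        exact ⟨hx, .rfl⟩
  refine ⟨R, h₁, h₂, fun x => (h₃ x).1, fun x y => ⟨?_, fun he => ?_⟩⟩
  · rintro ⟨p⟩
    induction p with
    | nil => rfl
    | cons hadj _ ih =>
      rw [← ih]
      rcases h.adj_iff.1 hadj with ⟨h₄, h₅⟩ | ⟨h₄, h₅⟩
      · rw [h₂ _ h₄, h₅]
      · rw [h₂ _ h₄, h₅]
  · exact (h₃ x).2.trans (he ▸ (h₃ y).2.symm)

theorem sum_edgeFinset [Fintype V] (h : IsRank K f ρ) [Fintype (parentGraph K f).edgeSet]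
    (g : Sym2 V → ℝ) :
    ∑ e ∈ (parentGraph K f).edgeFinset, g e = ∑ x ∈ K, g s(x, f x) := by
  classical
  have himg : (parentGraph K f).edgeFinset = K.image fun x => s(x, f x) := by
    ext e
    induction e with
    | _ x y =>
      rw [SimpleGraph.mem_edgeFinset, SimpleGraph.mem_edgeSet, h.adj_iff, Finset.mem_image]
      constructor
      · rintro (⟨h₁, h₂⟩ | ⟨h₁, h₂⟩)
        · exact ⟨x, h₁, by rw [h₂]⟩
        · exact ⟨y, h₁, by rw [h₂, Sym2.eq_swap]⟩
      · rintro ⟨z, h₁, h₂⟩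
        rw [Sym2.eq_iff] at h₂
        rcases h₂ with ⟨rfl, h₂⟩ | ⟨rfl, h₂⟩
        · exact Or.inl ⟨h₁, h₂⟩
        · exact Or.inr ⟨h₁, h₂⟩
  rw [himg, Finset.sum_image]
  intro x hx y hy hxy
  rw [Sym2.eq_iff] at hxy
  rcases hxy with ⟨h₁, -⟩ | ⟨h₁, h₂⟩
  · exact h₁
  · have i₁ := h x hx
    have i₂ := h y hy
    rw [h₂] at i₁
    rw [← h₁] at i₂
    omega

theorem card_edgeSet [Fintype V] (h : IsRank K f ρ) :
    Nat.card (parentGraph K f).edgeSet = K.card := by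
  classical
  have := h.sum_edgeFinset fun _ => 1
  simp only [Finset.sum_const, nsmul_eq_mul, mul_one, Nat.cast_inj] at this
  rw [Nat.card_eq_fintype_card, ← SimpleGraph.edgeFinset_card, this]

/-- Each component contains exactly one vertex outside `K`, its root. -/
theorem card_connectedComponent [Fintype V] (h : IsRank K f ρ) :
    Nat.card (parentGraph K f).ConnectedComponent + K.card = Fintype.card V := by
  classical
  obtain ⟨R, h₁, h₂, h₃, h₄⟩ := h.exists_root
  have hbij : Function.Bijective fun x : {x // x ∉ K} =>
      (parentGraph K f).connectedComponentMk x.1 := by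
    constructor
    · intro x y hxy
      have := (h₄ _ _).1 (SimpleGraph.ConnectedComponent.exact hxy)
      rw [h₁ _ x.2, h₁ _ y.2] at this
      exact Subtype.ext this
    · intro T
      induction T using SimpleGraph.ConnectedComponent.ind with
      | _ v =>
        refine ⟨⟨R v, h₃ v⟩, SimpleGraph.ConnectedComponent.sound ((h₄ _ _).2 ?_)⟩
        rw [h₁ _ (h₃ v)]
  rw [← Nat.card_eq_of_bijective _ hbij, Nat.card_eq_fintype_card, Fintype.card_subtype_compl]
  have : Fintype.card {x // x ∈ K} = K.card := by simp
  rw [this]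
  have := Finset.card_le_univ K
  omega

theorem cost_eq [Fintype V] (h : IsRank K f ρ) (I : TreeCoverInstance V) :
    I.cost (parentGraph K f) =
      ∑ x ∈ K, I.c s(x, f x) + I.γ * ((Fintype.card V : ℝ) - K.card) := by
  classical
  rw [TreeCoverInstance.cost, h.sum_edgeFinset, ← h.card_connectedComponent]
  push_cast
  ring

theorem mk_parent (h : IsRank K f ρ) {x : V} (hx : x ∈ K) :
    (parentGraph K f).connectedComponentMk (f x) = (parentGraph K f).connectedComponentMk x :=
  SimpleGraph.ConnectedComponent.sound (h.adj hx).symm.reachable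

open Classical in
theorem load_eq [Fintype V] (h : IsRank K f ρ) (I : TreeCoverInstance V)
    (T : (parentGraph K f).ConnectedComponent) :
    I.load (parentGraph K f) T =
      ∑ x ∈ K with (parentGraph K f).connectedComponentMk x = T, I.u s(x, f x) +
      ∑ v : V with (parentGraph K f).connectedComponentMk v = T, I.b v := by
  rw [TreeCoverInstance.load, Finset.sum_filter, h.sum_edgeFinset]
  congr 1
  rw [Finset.sum_filter]
  refine Finset.sum_congr rfl fun x hx => ?_
  have : (∀ v ∈ s(x, f x), (parentGraph K f).connectedComponentMk v = T) ↔
      (parentGraph K f).connectedComponentMk x = T := by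
    rw [Sym2.ball, h.mk_parent hx, and_self]
  by_cases hc : (parentGraph K f).connectedComponentMk x = T
  · rw [if_pos hc, if_pos (this.2 hc)]
  · rw [if_neg hc, if_neg (fun h' => hc (this.1 h'))]

open Classical in
/-- The load of a tree equals the load below its root. -/
theorem exists_load_eq [Fintype V] [DecidableEq V] (h : IsRank K f ρ) (I : TreeCoverInstance V) {H : V → ℝ}
    (hH : ∀ w, H w = I.b w + ∑ x ∈ K, if f x = w then H x + I.u s(x, w) else 0)
    (T : (parentGraph K f).ConnectedComponent) :
    ∃ r ∉ K, I.load (parentGraph K f) T = H r := by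
  obtain ⟨R, h₁, h₂, h₃, h₄⟩ := h.exists_root
  obtain ⟨v, rfl⟩ := T.exists_rep
  refine ⟨R v, h₃ v, ?_⟩
  change I.load _ ((parentGraph K f).connectedComponentMk v) = _
  have hT : ∀ x, (parentGraph K f).connectedComponentMk x =
      (parentGraph K f).connectedComponentMk v ↔ R x = R v := by
    intro x
    rw [SimpleGraph.ConnectedComponent.eq, h₄]
  -- The sum of `H` over the component is computed twice: once by the recursion and once by
  -- separating the root. All terms `H x` with `x ∈ K` cancel.
  have e₁ : ∑ w : V with R w = R v, H w =
      ∑ w : V with R w = R v, I.b w + ∑ x ∈ K with R x = R v, (H x + I.u s(x, f x)) := by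
    rw [Finset.sum_congr rfl fun w _ => hH w, Finset.sum_add_distrib, Finset.sum_comm]
    congr 1
    rw [Finset.sum_filter]
    refine Finset.sum_congr rfl fun x hx => ?_
    rw [Finset.sum_ite_eq]
    simp [h₂ x hx]
  have e₂ : ∑ w : V with R w = R v, H w = H (R v) + ∑ x ∈ K with R x = R v, H x := by
    have : (Finset.univ.filter fun w => R w = R v) =
        insert (R v) (K.filter fun x => R x = R v) := by
      ext x
      simp only [Finset.mem_filter, Finset.mem_univ, true_and, Finset.mem_insert]
      constructor
      · intro hx
        by_cases hK : x ∈ K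
        · exact Or.inr ⟨hK, hx⟩
        · rw [h₁ x hK] at hx
          exact Or.inl hx
      · rintro (rfl | hx)
        · exact h₁ _ (h₃ v)
        · exact hx.2
    rw [this, Finset.sum_insert]
    exact fun hmem => h₃ v (Finset.mem_filter.1 hmem).1
  rw [h.load_eq]
  simp only [hT]
  rw [Finset.sum_add_distrib] at e₁
  linarith

end IsRank

/-- Every finite forest is given by a parent function. -/
theorem SimpleGraph.IsAcyclic.exists_parent {V : Type*} [Fintype V] {F : SimpleGraph V}
    (hF : F.IsAcyclic) : ∃ (K : Finset V) (f : V → V) (ρ : V → ℤ), IsRank K f ρ ∧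
      F = parentGraph K f := by
  classical
  have hreach : ∀ x, F.Reachable (F.connectedComponentMk x).out x := fun x =>
    SimpleGraph.ConnectedComponent.exact (F.connectedComponentMk x).out_eq
  obtain ⟨D, hD⟩ : ∃ D : V → ℕ, ∀ x, D x = F.dist (F.connectedComponentMk x).out x := ⟨_, fun _ => rfl⟩
  -- Orient every edge towards a chosen representative of its component. In a forest the neighbour
  -- closer to the representative is unique, being the last vertex before `x` on the path from it.
  have huniq : ∀ x y y', F.Adj x y → F.Adj x y' → D y < D x → D y' < D x → y = y' := by
    intro x
    obtain ⟨p, hp, hp'⟩ := (hreach x).exists_path_of_dist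
    rw [← hD] at hp'
    have key : ∀ y, F.Adj x y → D y < D x → y = p.penultimate := by
      intro y hadj hlt
      have hc : F.connectedComponentMk y = F.connectedComponentMk x :=
        SimpleGraph.ConnectedComponent.sound hadj.symm.reachable
      have hry := hreach y
      have hDy := hD y
      rw [hc] at hry hDy
      obtain ⟨q, hq, hq'⟩ := hry.exists_path_of_dist
      rw [← hDy] at hq'
      refine hF.eq_penultimate_of_adj_end hp hadj ?_
      refine hF.mem_support_of_ne_mem_support_of_adj_of_isPath hp hq hadj fun hmem => ?_
      have := congrArg SimpleGraph.Walk.length (hF.path_concat hp hq hadj hmem)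
      rw [SimpleGraph.Walk.length_concat] at this
      omega
    intro y y' h₁ h₂ h₃ h₄
    rw [key y h₁ h₃, key y' h₂ h₄]
  have hne : ∀ x y, F.Adj x y → D x ≠ D y := by
    intro x y hadj
    have hc : F.connectedComponentMk y = F.connectedComponentMk x :=
      SimpleGraph.ConnectedComponent.sound hadj.symm.reachable
    rw [hD, hD, hc]
    exact hF.dist_ne_of_adj hadj (hreach x)
  have hf : ∃ f : V → V, ∀ x, (∃ y, F.Adj x y ∧ D y < D x) → F.Adj x (f x) ∧ D (f x) < D x := by
    refine ⟨fun x => if h : ∃ y, F.Adj x y ∧ D y < D x then h.choose else x, fun x hx => ?_⟩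
    simp only [dif_pos hx]
    exact hx.choose_spec
  obtain ⟨f, hf⟩ := hf
  have hrank : IsRank (Finset.univ.filter fun x => ∃ y, F.Adj x y ∧ D y < D x) f
      (fun x => (D x : ℤ)) := by
    intro x hx
    exact Nat.cast_lt.2 (hf x (Finset.mem_filter.1 hx).2).2
  refine ⟨_, f, _, hrank, ?_⟩
  ext x y
  rw [hrank.adj_iff]
  simp only [Finset.mem_filter, Finset.mem_univ, true_and]
  constructor
  · intro hadj
    rcases lt_or_gt_of_ne (hne x y hadj) with hlt | hlt
    · right
      have hex : ∃ z, F.Adj y z ∧ D z < D y := ⟨x, hadj.symm, hlt⟩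
      exact ⟨hex, huniq y _ _ (hf y hex).1 hadj.symm (hf y hex).2 hlt⟩
    · left
      have hex : ∃ z, F.Adj x z ∧ D z < D x := ⟨y, hadj, hlt⟩
      exact ⟨hex, huniq x _ _ (hf x hex).1 hadj (hf x hex).2 hlt⟩
  · rintro (⟨h₁, rfl⟩ | ⟨h₁, rfl⟩)
    · exact (hf x h₁).1
    · exact (hf y h₁).1.symm

/-! ## The linear program -/

theorem mem_edgesWithin {V : Type*} [Fintype V] {A : Finset V} {x y : V} :
    s(x, y) ∈ edgesWithin A ↔ x ≠ y ∧ x ∈ A ∧ y ∈ A := by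
  classical
  rw [edgesWithin, Finset.mem_filter, SimpleGraph.mem_edgeFinset, SimpleGraph.mem_edgeSet,
    SimpleGraph.top_adj, Sym2.ball]

namespace IsRank

variable {V : Type*} [DecidableEq V] {K : Finset V} {f : V → V} {ρ : V → ℤ}

/-- A vertex of minimum rank in `A` cannot have its parent in `A`. -/
theorem card_within_lt (h : IsRank K f ρ) {A : Finset V} (hA : A.Nonempty) :
    (K.filter fun x => x ∈ A ∧ f x ∈ A).card + 1 ≤ A.card := by
  obtain ⟨r, hr, hmin⟩ := A.exists_min_image ρ hA
  refine Finset.card_lt_card (Finset.ssubset_iff_of_subset ?_ |>.2 ⟨r, hr, fun hmem => ?_⟩)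
  · intro x hx
    exact (Finset.mem_filter.1 hx).2.1
  · obtain ⟨h₁, -, h₂⟩ := Finset.mem_filter.1 hmem
    have := hmin _ h₂
    have := h r h₁
    omega

open Classical in
theorem sum_edgesWithin [Fintype V] (h : IsRank K f ρ) (A : Finset V) (g : Sym2 V → ℝ) :
    ∑ e ∈ edgesWithin A, g e * (if e ∈ (parentGraph K f).edgeSet then 1 else 0) =
      ∑ x ∈ K with x ∈ A ∧ f x ∈ A, g s(x, f x) := by
  have h₁ : (edgesWithin A).filter (fun e => e ∈ (parentGraph K f).edgeSet) =
      (parentGraph K f).edgeFinset.filter fun e => ∀ v ∈ e, v ∈ A := by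
    ext e
    induction e with
    | _ x y =>
      rw [Finset.mem_filter, Finset.mem_filter, mem_edgesWithin, SimpleGraph.mem_edgeFinset,
        Sym2.ball]
      constructor
      · exact fun h => ⟨h.2, h.1.2⟩
      · exact fun h => ⟨⟨((SimpleGraph.mem_edgeSet _).1 h.1).ne, h.2⟩, h.1⟩
  simp only [mul_ite, mul_one, mul_zero]
  rw [← Finset.sum_filter, h₁, Finset.sum_filter, h.sum_edgeFinset, Finset.sum_filter]
  refine Finset.sum_congr rfl fun x _ => ?_
  by_cases hc : x ∈ A ∧ f x ∈ A
  · rw [if_pos hc, if_pos (Sym2.ball.2 hc)]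
  · rw [if_neg hc, if_neg fun h' => hc (Sym2.ball.1 h')]

/-- The inequality is proved for each component separately. A component meeting `A` has at least one
edge fewer than vertices within `A`, and this missing 1 pays for the load of the component.
Nonnegativity of the loads allows the restriction to `A`. -/
theorem load_within_le [Fintype V] (h : IsRank K f ρ) (I : TreeCoverInstance V)
    (hF : I.IsSolution (parentGraph K f)) (A : Finset V) :
    ∑ x ∈ K with x ∈ A ∧ f x ∈ A, (1 + I.u s(x, f x)) ≤ (A.card : ℝ) - ∑ v ∈ A, I.b v := by
  classical
  have hu : ∀ x ∈ K, 0 ≤ I.u s(x, f x) := fun x hx =>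
    I.u_nonneg _ (by simpa using (h.ne hx).symm)
  have e₁ := Finset.sum_fiberwise A (parentGraph K f).connectedComponentMk fun v => 1 - I.b v
  have e₂ := Finset.sum_fiberwise (K.filter fun x => x ∈ A ∧ f x ∈ A)
    (parentGraph K f).connectedComponentMk fun x => 1 + I.u s(x, f x)
  have e₃ : (A.card : ℝ) - ∑ v ∈ A, I.b v = ∑ v ∈ A, (1 - I.b v) := by
    rw [Finset.sum_sub_distrib]; simp
  rw [e₃, ← e₁, ← e₂]
  refine Finset.sum_le_sum fun T _ => ?_
  rcases (A.filter fun v => (parentGraph K f).connectedComponentMk v = T).eq_empty_or_nonempty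
    with hE | hE
  · rw [hE, Finset.sum_empty]
    refine (Finset.sum_eq_zero fun x hx => ?_).le
    simp only [Finset.mem_filter] at hx
    have : x ∈ A.filter fun v => (parentGraph K f).connectedComponentMk v = T :=
      Finset.mem_filter.2 ⟨hx.1.2.1, hx.2⟩
    rw [hE] at this
    exact absurd this (Finset.notMem_empty x)
  · have hcard := h.card_within_lt hE
    have hload := hF.2 T
    rw [h.load_eq] at hload
    have hsub : (K.filter fun x => x ∈ A ∧ f x ∈ A).filter
        (fun x => (parentGraph K f).connectedComponentMk x = T) =
        K.filter fun x => x ∈ A.filter (fun v => (parentGraph K f).connectedComponentMk v = T) ∧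
          f x ∈ A.filter fun v => (parentGraph K f).connectedComponentMk v = T := by
      ext x
      simp only [Finset.mem_filter]
      constructor
      · rintro ⟨⟨h₁, h₂, h₃⟩, h₄⟩
        exact ⟨h₁, ⟨h₂, h₄⟩, h₃, (h.mk_parent h₁).trans h₄⟩
      · rintro ⟨h₁, ⟨h₂, h₄⟩, h₃, -⟩
        exact ⟨⟨h₁, h₂, h₃⟩, h₄⟩
    have hcard' : (((K.filter fun x => x ∈ A ∧ f x ∈ A).filter
        (fun x => (parentGraph K f).connectedComponentMk x = T)).card : ℝ) + 1 ≤
        (A.filter fun v => (parentGraph K f).connectedComponentMk v = T).card := by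
      rw [hsub]
      exact_mod_cast hcard
    have hu' : ∑ x ∈ (K.filter fun x => x ∈ A ∧ f x ∈ A).filter
        (fun x => (parentGraph K f).connectedComponentMk x = T), I.u s(x, f x) ≤
        ∑ x ∈ K with (parentGraph K f).connectedComponentMk x = T, I.u s(x, f x) := by
      refine Finset.sum_le_sum_of_subset_of_nonneg ?_ ?_
      · intro x hx
        simp only [Finset.mem_filter] at hx ⊢
        exact ⟨hx.1.1, hx.2⟩
      · intro x hx _
        exact hu x (Finset.mem_filter.1 hx).1
    have hb' : ∑ v ∈ A with (parentGraph K f).connectedComponentMk v = T, I.b v ≤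
        ∑ v : V with (parentGraph K f).connectedComponentMk v = T, I.b v := by
      refine Finset.sum_le_sum_of_subset_of_nonneg ?_ fun v _ _ => I.b_nonneg v
      intro x hx
      simp only [Finset.mem_filter] at hx ⊢
      exact ⟨Finset.mem_univ _, hx.2⟩
    rw [Finset.sum_add_distrib, Finset.sum_sub_distrib, Finset.sum_const, Finset.sum_const,
      nsmul_eq_mul, nsmul_eq_mul, mul_one, mul_one]
    linarith

end IsRank

/-- Feasible solutions correspond to integral points of the linear program. -/
theorem TreeCoverInstance.IsSolution.exists_lpFeasible {V : Type*} [Fintype V]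
    {I : TreeCoverInstance V} {F : SimpleGraph V} (hF : I.IsSolution F) :
    ∃ x, I.LPFeasible x ∧ I.lpCost x = I.cost F := by
  classical
  obtain ⟨K, f, ρ, h, rfl⟩ := hF.1.exists_parent
  refine ⟨fun e => if e ∈ (parentGraph K f).edgeSet then 1 else 0, ⟨?_, ?_, ?_⟩, ?_⟩
  · intro A hA
    have h₁ := h.sum_edgesWithin A fun _ => 1
    have h₂ : (((K.filter fun x => x ∈ A ∧ f x ∈ A).card + 1 : ℕ) : ℝ) ≤ A.card :=
      Nat.cast_le.2 (h.card_within_lt hA)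
    simp only [one_mul, Finset.sum_const, nsmul_eq_mul, mul_one] at h₁
    push_cast at h₂
    rw [h₁]
    linarith
  · intro A
    have h₁ := h.sum_edgesWithin A fun e => 1 + I.u e
    rw [h₁]
    exact h.load_within_le I hF A
  · intro e _
    split_ifs <;> norm_num
  · have h₁ := h.sum_edgesWithin Finset.univ fun _ => 1
    have h₂ := h.sum_edgesWithin Finset.univ I.c
    simp only [one_mul, Finset.mem_univ, and_self, Finset.filter_true, Finset.sum_const,
      nsmul_eq_mul, mul_one] at h₁ h₂
    rw [TreeCoverInstance.lpCost, h₁, h₂, h.cost_eq]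

/-! ## The instance in terms of positions -/

/-- Edge weights in terms of positions. -/
noncomputable def positionWeight {n : ℕ} (g : Sym2 (Fin n) → ℝ) (τ : ℕ → Fin n) (i j : ℕ) : ℝ :=
  if i < n ∧ j < n ∧ i ≠ j then g s(τ i, τ j) else 0

section

variable {n : ℕ} {I : TreeCoverInstance (Fin n)} {τ : ℕ → Fin n}

theorem positionWeight_of_lt {g : Sym2 (Fin n) → ℝ} {i j : ℕ} (hij : i < j) (hj : j < n) :
    positionWeight g τ i j = g s(τ i, τ j) := by
  rw [positionWeight, if_pos ⟨by omega, hj, by omega⟩]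

theorem positionWeight_of_ne {g : Sym2 (Fin n) → ℝ} {i j : ℕ} (hi : i < n) (hj : j < n)
    (hij : i ≠ j) : positionWeight g τ i j = g s(τ i, τ j) := by
  rw [positionWeight, if_pos ⟨hi, hj, hij⟩]

/-- The triangle inequality is given only for distinct vertices and diagonal entries are arbitrary;
with zeros on the diagonal it extends to coinciding points. -/
theorem finiteMetric_positionWeight (hτ : ∀ i < n, ∀ j < n, τ i = τ j → i = j)
    {g : Sym2 (Fin n) → ℝ} (h0 : ∀ e : Sym2 (Fin n), ¬ e.IsDiag → 0 ≤ g e)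
    (ht : ∀ x y z, x ≠ y → y ≠ z → x ≠ z → g s(x, z) ≤ g s(x, y) + g s(y, z)) :
    FiniteMetric n (positionWeight g τ) where
  nonneg i j := by
    rw [positionWeight]
    split_ifs with h
    · exact h0 _ (by simpa using fun he => h.2.2 (hτ i h.1 j h.2.1 he))
    · exact le_rfl
  symm i j := by
    simp only [positionWeight]
    rw [Sym2.eq_swap]
    congr 1
    rw [eq_iff_iff]
    constructor <;> rintro ⟨h₁, h₂, h₃⟩ <;> exact ⟨h₂, h₁, h₃.symm⟩
  triangle i hi j hj k hk := by
    have hnn : ∀ i j, 0 ≤ positionWeight g τ i j := by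
      intro i j
      rw [positionWeight]
      split_ifs with h
      · exact h0 _ (by simpa using fun he => h.2.2 (hτ i h.1 j h.2.1 he))
      · exact le_rfl
    by_cases hik : i = k
    · subst hik
      have : positionWeight g τ i i = 0 := by rw [positionWeight, if_neg (by simp)]
      rw [this]
      exact add_nonneg (hnn _ _) (hnn _ _)
    · by_cases hij : i = j
      · subst hij
        linarith [hnn i i]
      · by_cases hjk : j = k
        · subst hjk
          linarith [hnn j j]
        · rw [positionWeight_of_ne hi hk hik, positionWeight_of_ne hi hj hij,
            positionWeight_of_ne hj hk hjk]
          exact ht _ _ _ (fun he => hij (hτ i hi j hj he)) (fun he => hjk (hτ j hj k hk he))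
            (fun he => hik (hτ i hi k hk he))

theorem sum_edgesWithin_image (hτ : ∀ i < n, ∀ j < n, τ i = τ j → i = j) {A : Finset ℕ}
    (hA : A ⊆ Finset.range n) (g : Sym2 (Fin n) → ℝ) :
    ∑ e ∈ edgesWithin (A.image τ), g e = ∑ p ∈ pairsIn A, g s(τ p.1, τ p.2) := by
  have hlt : ∀ i ∈ A, i < n := fun i hi => Finset.mem_range.1 (hA hi)
  symm
  refine Finset.sum_bij (fun p _ => s(τ p.1, τ p.2)) ?_ ?_ ?_ (fun _ _ => rfl)
  · intro p hp
    obtain ⟨h₁, h₂, h₃⟩ := mem_pairsIn.1 hp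
    exact mem_edgesWithin.2 ⟨fun he => h₃.ne (hτ _ (hlt _ h₁) _ (hlt _ h₂) he),
      Finset.mem_image_of_mem _ h₁, Finset.mem_image_of_mem _ h₂⟩
  · intro p hp q hq he
    obtain ⟨h₁, h₂, h₃⟩ := mem_pairsIn.1 hp
    obtain ⟨h₄, h₅, h₆⟩ := mem_pairsIn.1 hq
    rw [Sym2.eq_iff] at he
    rcases he with ⟨e₁, e₂⟩ | ⟨e₁, e₂⟩
    · exact Prod.ext (hτ _ (hlt _ h₁) _ (hlt _ h₄) e₁) (hτ _ (hlt _ h₂) _ (hlt _ h₅) e₂)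
    · have := hτ _ (hlt _ h₁) _ (hlt _ h₅) e₁
      have := hτ _ (hlt _ h₂) _ (hlt _ h₄) e₂
      omega
  · intro e he
    induction e with
    | _ x y =>
      obtain ⟨hne, hx, hy⟩ := mem_edgesWithin.1 he
      obtain ⟨i, hi, rfl⟩ := Finset.mem_image.1 hx
      obtain ⟨j, hj, rfl⟩ := Finset.mem_image.1 hy
      rcases lt_trichotomy i j with hij | rfl | hij
      · exact ⟨(i, j), mem_pairsIn.2 ⟨hi, hj, hij⟩, rfl⟩
      · exact absurd rfl hne
      · exact ⟨(j, i), mem_pairsIn.2 ⟨hj, hi, hij⟩, Sym2.eq_swap⟩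

theorem image_range (hτ : ∀ i < n, ∀ j < n, τ i = τ j → i = j) :
    (Finset.range n).image τ = Finset.univ := by
  refine Finset.eq_univ_of_card _ ?_
  rw [Finset.card_image_of_injOn, Finset.card_range, Fintype.card_fin]
  intro i hi j hj
  exact hτ i (Finset.mem_range.1 hi) j (Finset.mem_range.1 hj)

theorem TreeCoverInstance.LPFeasible.pairFeasible (hτ : ∀ i < n, ∀ j < n, τ i = τ j → i = j)
    {x : Sym2 (Fin n) → ℝ} (hx : I.LPFeasible x) :
    PairFeasible n (positionWeight I.u τ) (fun p => I.b (τ p)) fun i j => x s(τ i, τ j) where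
  nonneg j hj i hi := by
    refine (hx.bounds _ (mem_edgesWithin.2 ⟨fun he => ?_, Finset.mem_univ _, Finset.mem_univ _⟩)).1
    have := hτ i (by omega) j hj he
    omega
  forest A hA hne := by
    have h := hx.forest (A.image τ) (hne.image τ)
    rw [sum_edgesWithin_image hτ hA, Finset.card_image_of_injOn] at h
    · exact h
    · intro i hi j hj
      exact hτ i (Finset.mem_range.1 (hA hi)) j (Finset.mem_range.1 (hA hj))
  load A hA := by
    have hinj : Set.InjOn τ A := fun i hi j hj =>
      hτ i (Finset.mem_range.1 (hA hi)) j (Finset.mem_range.1 (hA hj))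
    have h := hx.load (A.image τ)
    rw [sum_edgesWithin_image hτ hA fun e => (1 + I.u e) * x e, Finset.card_image_of_injOn hinj,
      Finset.sum_image hinj] at h
    rw [Finset.sum_sub_distrib, Finset.sum_const, nsmul_eq_mul, mul_one]
    refine le_of_eq_of_le (Finset.sum_congr rfl fun p hp => ?_) h
    obtain ⟨-, h₂, h₃⟩ := mem_pairsIn.1 hp
    rw [positionWeight_of_lt h₃ (Finset.mem_range.1 (hA h₂))]

/-- Minimising the cost amounts to maximising the profit `∑ (γ - c) * x` over pairs of positions,
the form in which `GreedyInv.optimal` is stated. -/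
theorem lpCost_eq (hτ : ∀ i < n, ∀ j < n, τ i = τ j → i = j) (x : Sym2 (Fin n) → ℝ) :
    I.lpCost x = I.γ * n - ∑ p ∈ pairsIn (Finset.range n),
      (I.γ - positionWeight I.c τ p.1 p.2) * x s(τ p.1, τ p.2) := by
  rw [TreeCoverInstance.lpCost, ← image_range hτ, sum_edgesWithin_image hτ subset_rfl,
    sum_edgesWithin_image hτ subset_rfl x, Fintype.card_fin]
  have : ∑ p ∈ pairsIn (Finset.range n),
      (I.γ - positionWeight I.c τ p.1 p.2) * x s(τ p.1, τ p.2) =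
      I.γ * ∑ p ∈ pairsIn (Finset.range n), x s(τ p.1, τ p.2) -
      ∑ p ∈ pairsIn (Finset.range n), I.c s(τ p.1, τ p.2) * x s(τ p.1, τ p.2) := by
    rw [Finset.mul_sum, ← Finset.sum_sub_distrib]
    refine Finset.sum_congr rfl fun p hp => ?_
    obtain ⟨-, h₂, h₃⟩ := mem_pairsIn.1 hp
    rw [positionWeight_of_lt h₃ (Finset.mem_range.1 h₂)]
    ring
  rw [this]
  ring

/-- If one of the two quantities were ordered strictly against the sum, the other would have to
follow it in the weak sense, and the sums would compare the other way. -/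
theorem edge_mono (I : TreeCoverInstance (Fin n)) {e f : Sym2 (Fin n)} (he : ¬ e.IsDiag)
    (hf : ¬ f.IsDiag) (h : I.u e + I.c e ≤ I.u f + I.c f) : I.u e ≤ I.u f ∧ I.c e ≤ I.c f := by
  constructor
  · by_contra hlt
    push Not at hlt
    have := I.c_le_of_u_lt f e hf he hlt
    linarith
  · by_contra hlt
    push Not at hlt
    have : ¬ I.u e < I.u f := fun hu => by
      have := I.c_le_of_u_lt e f he hf hu
      linarith
    linarith

end

/-! ## The output of the algorithm -/

namespace RealRAM

open Program

def outputBody : Program :=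
  .ite (.natLe (.const 1) (.get 9 (nvar 12)))
    (.seq (.setNat 2 (nvar 16) (.get 5 (nvar 12)))
    (.seq (.setNat 3 (nvar 16) (.get 5 (.get 6 (nvar 12))))
      (.setNat 16 (.const 0) (.add (nvar 16) (.const 1)))))
    (.setNat 17 (.const 0) (.add (nvar 17) (.const 1)))

/-- Output of the edges to the parents and of the number of roots. -/
def output : Program :=
  .seq (.seq (.setNat 16 (.const 0) (.const 0)) (.setNat 17 (.const 0) (.const 0)))
  (.seq (forLoop 12 (.const 0) outputBody)
    (.seq (.setNat 1 (.const 0) (nvar 17)) (.setNat 1 (.const 1) (nvar 16))))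

variable {n N : ℕ} {s : State}

/-- The edges from the vertices `p < i` to their parents are listed. -/
structure ListsEdges (ord par kept : ℕ → ℕ) (i k l : ℕ) (out₁ out₂ : ℕ → ℕ) : Prop where
  roots : k = ((Finset.range i).filter fun p => kept p = 0).card
  edges : l = ((Finset.range i).filter fun p => 1 ≤ kept p).card
  edge : ∀ r < l, ∃ p < i, 1 ≤ kept p ∧ out₁ r = ord p ∧ out₂ r = ord (par p)
  index : ∀ p < i, 1 ≤ kept p → ∃ r < l, out₁ r = ord p ∧ out₂ r = ord (par p)

theorem reach_output (hN : n ≤ N) (hn : s.nat 0 0 = n) :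
    Reach N output (fun s' => ListsEdges (s.nat 5) (s.nat 6) (s.nat 9) n (s'.nat 1 0) (s'.nat 1 1)
      (s'.nat 2) (s'.nat 3)) s := by
  refine Reach.seq (Reach.of_run (by simp [Program.LoopFree]) ?_)
  simp only [Program.run, NExp.eval]
  refine Reach.seq (Reach.forLoop (n := n)
    (fun i s' => ListsEdges (s.nat 5) (s.nat 6) (s.nat 9) i (s'.nat 17 0) (s'.nat 16 0)
      (s'.nat 2) (s'.nat 3)) (by decide) (by decide) (by decide)
    (by simp [State.nat_setNat_of_ne, hn]) hN (Nat.zero_le _) ?_ ?_ ?_ ?_)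
  · intro i s' z h
    simpa [State.nat_setNat_of_ne] using h
  · constructor <;> simp [State.nat_setNat_of_ne, NExp.eval]
  · intro i s' _ hin h12 hn' hf hI
    have e5 : s'.nat 5 = s.nat 5 := by
      rw [hf.nat 5 (by decide)]; simp [State.nat_setNat_of_ne]
    have e6 : s'.nat 6 = s.nat 6 := by
      rw [hf.nat 6 (by decide)]; simp [State.nat_setNat_of_ne]
    have e9 : s'.nat 9 = s.nat 9 := by
      rw [hf.nat 9 (by decide)]; simp [State.nat_setNat_of_ne]
    have hni : ∀ P : ℕ → Prop, ∀ _ : DecidablePred P, i ∉ (Finset.range i).filter P := by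
      intro P _ hmem
      exact lt_irrefl i (Finset.mem_range.1 (Finset.mem_filter.1 hmem).1)
    refine Reach.of_run (by simp [outputBody, Program.LoopFree]) ?_
    simp only [outputBody, Program.run, Test.Holds, NExp.eval, h12, e9]
    split_ifs with hk
    · simp only [State.nat_setNat_same, Function.update_self, h12, e5, e6,
        State.nat_setNat_of_ne _ _ _ (show (16 : ℕ) ≠ 2 by decide),
        State.nat_setNat_of_ne _ _ _ (show (16 : ℕ) ≠ 3 by decide),
        State.nat_setNat_of_ne _ _ _ (show (12 : ℕ) ≠ 2 by decide),
        State.nat_setNat_of_ne _ _ _ (show (5 : ℕ) ≠ 2 by decide),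
        State.nat_setNat_of_ne _ _ _ (show (6 : ℕ) ≠ 2 by decide),
        State.nat_setNat_of_ne _ _ _ (show (17 : ℕ) ≠ 16 by decide),
        State.nat_setNat_of_ne _ _ _ (show (17 : ℕ) ≠ 3 by decide),
        State.nat_setNat_of_ne _ _ _ (show (17 : ℕ) ≠ 2 by decide),
        State.nat_setNat_of_ne _ _ _ (show (2 : ℕ) ≠ 16 by decide),
        State.nat_setNat_of_ne _ _ _ (show (2 : ℕ) ≠ 3 by decide),
        State.nat_setNat_of_ne _ _ _ (show (3 : ℕ) ≠ 16 by decide),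
        State.nat_setNat_of_ne _ _ _ (show (3 : ℕ) ≠ 2 by decide)]
      constructor
      · rw [Finset.range_add_one, Finset.filter_insert, if_neg (by omega)]
        exact hI.roots
      · rw [Finset.range_add_one, Finset.filter_insert, if_pos hk,
          Finset.card_insert_of_notMem (hni _ _), ← hI.edges]
      · intro r hr
        by_cases hrl : r = s'.nat 16 0
        · subst hrl
          exact ⟨i, by omega, hk, by rw [Function.update_self], by rw [Function.update_self]⟩
        · obtain ⟨p, hp, h⟩ := hI.edge r (by omega)
          rw [Function.update_of_ne hrl, Function.update_of_ne hrl]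
          exact ⟨p, by omega, h⟩
      · intro p hp hkp
        by_cases hpi : p = i
        · subst hpi
          exact ⟨s'.nat 16 0, by omega, by rw [Function.update_self], by rw [Function.update_self]⟩
        · obtain ⟨r, hr, h⟩ := hI.index p (by omega) hkp
          refine ⟨r, by omega, ?_⟩
          rw [Function.update_of_ne (by omega), Function.update_of_ne (by omega)]
          exact h
    · simp only [State.nat_setNat_same, Function.update_self,
        State.nat_setNat_of_ne _ _ _ (show (16 : ℕ) ≠ 17 by decide),
        State.nat_setNat_of_ne _ _ _ (show (2 : ℕ) ≠ 17 by decide),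
        State.nat_setNat_of_ne _ _ _ (show (3 : ℕ) ≠ 17 by decide)]
      constructor
      · rw [Finset.range_add_one, Finset.filter_insert, if_pos (by omega),
          Finset.card_insert_of_notMem (hni _ _), ← hI.roots]
      · rw [Finset.range_add_one, Finset.filter_insert, if_neg hk]
        exact hI.edges
      · intro r hr
        obtain ⟨p, hp, h⟩ := hI.edge r hr
        exact ⟨p, by omega, h⟩
      · intro p hp hkp
        have : p ≠ i := by rintro rfl; exact hk hkp
        exact hI.index p (by omega) hkp
  · intro s' _ hI
    refine Reach.of_run (by simp [Program.LoopFree]) ?_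
    simpa [Program.run, State.nat_setNat_of_ne, NExp.eval] using hI

end RealRAM

section

variable {n : ℕ} {I : TreeCoverInstance (Fin n)} {τ : ℕ → Fin n}

theorem sum_univ_eq_sum_range (hτ : ∀ i < n, ∀ j < n, τ i = τ j → i = j) (g : Fin n → ℝ) :
    ∑ x, g x = ∑ p ∈ Finset.range n, g (τ p) := by
  rw [← image_range hτ, Finset.sum_image]
  intro i hi j hj
  exact hτ i (Finset.mem_range.1 hi) j (Finset.mem_range.1 hj)

open RealRAM in
/-- The split forest is a feasible solution and the output describes it. -/
theorem exists_solution {S : ℕ → ℝ} {K₀ : ℝ} {par₀ kept₀ rt kept par : ℕ → ℕ}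
    {acc sz M h : ℕ → ℝ} {ρ : ℕ → ℤ} (hτ : ∀ i < n, ∀ j < n, τ i = τ j → i = j)
    (B : RoundedForest n (positionWeight I.u τ) (positionWeight I.c τ) (fun p => I.b (τ p))
      par₀ kept₀ rt S)
    (J : SplitInv n (positionWeight I.u τ) (positionWeight I.c τ) (fun p => I.b (τ p))
      par₀ kept₀ rt S K₀ 0 kept par acc sz M h ρ) :
    ∃ F : SimpleGraph (Fin n), I.IsSolution F ∧
      I.cost F ≤ K₀ + I.γ * ∑ r ∈ Finset.range n with kept₀ r = 0, S r ∧
      ∀ (s : State) (ord : ℕ → ℕ), (∀ p < n, ord p = τ p) →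
        ListsEdges ord par kept n (s.nat 1 0) (s.nat 1 1) (s.nat 2) (s.nat 3) →
        HoldsOutput (Nat.card F.ConnectedComponent) F s := by
  classical
  have hpos : ∀ x : Fin n, ∃ p < n, τ p = x := by
    intro x
    have hx : x ∈ (Finset.range n).image τ := by rw [image_range hτ]; exact Finset.mem_univ x
    obtain ⟨p, hp, hpx⟩ := Finset.mem_image.1 hx
    exact ⟨p, Finset.mem_range.1 hp, hpx⟩
  choose pos pos_lt τ_pos using hpos
  have pos_τ : ∀ p < n, pos (τ p) = p := fun p hp => hτ _ (pos_lt _) _ hp (τ_pos _)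
  obtain ⟨K, hKdef⟩ : ∃ K : Finset (Fin n), ∀ x, x ∈ K ↔ 1 ≤ kept (pos x) :=
    ⟨Finset.univ.filter fun x => 1 ≤ kept (pos x), by simp⟩
  obtain ⟨f, hf⟩ : ∃ f : Fin n → Fin n, ∀ x, f x = τ (par (pos x)) := ⟨_, fun _ => rfl⟩
  have hrank : IsRank K f fun x => ρ (pos x) := by
    intro x hx
    obtain ⟨h₁, h₂⟩ := J.forest.rank _ (pos_lt x) ((hKdef x).1 hx)
    show ρ (pos (f x)) < ρ (pos x)
    rwa [hf, pos_τ _ h₁]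
  have hsum : ∀ g : Fin n → ℝ, ∑ x ∈ K, g x =
      ∑ p ∈ Finset.range n, if 1 ≤ kept p then g (τ p) else 0 := by
    intro g
    have : ∑ x ∈ K, g x = ∑ x, if 1 ≤ kept (pos x) then g x else 0 := by
      rw [← Finset.sum_filter]
      refine Finset.sum_congr ?_ fun _ _ => rfl
      ext x
      simp [hKdef]
    rw [this, sum_univ_eq_sum_range hτ]
    refine Finset.sum_congr rfl fun p hp => ?_
    rw [pos_τ p (Finset.mem_range.1 hp)]
  have hne : ∀ p < n, 1 ≤ kept p → p ≠ par p := by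
    intro p hp hk he
    have := (J.forest.rank p hp hk).2
    rw [← he] at this
    exact lt_irrefl _ this
  have hH : ∀ w, h (pos w) = I.b w +
      ∑ x ∈ K, if f x = w then h (pos x) + I.u s(x, w) else 0 := by
    intro w
    rw [J.forest.h_eq _ (pos_lt w) (Nat.zero_le _), hsum, τ_pos]
    congr 1
    refine Finset.sum_congr rfl fun p hp => ?_
    have hpn := Finset.mem_range.1 hp
    by_cases hk : 1 ≤ kept p
    · have hpar := (J.forest.rank p hpn hk).1
      rw [if_pos hk, hf, pos_τ p hpn]
      by_cases hw : par p = pos w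
      · rw [if_pos ⟨hk, hw⟩, if_pos (by rw [hw, τ_pos]),
          positionWeight_of_ne hpn (pos_lt w) (by rw [← hw]; exact hne p hpn hk), τ_pos]
      · rw [if_neg (fun hc => hw hc.2), if_neg]
        intro he
        rw [← he, pos_τ _ hpar] at hw
        exact hw rfl
    · rw [if_neg hk, if_neg (fun hc => hk hc.1)]
  have hcardK : K.card = ((Finset.range n).filter fun p => 1 ≤ kept p).card := by
    have := hsum fun _ => 1
    rw [← Finset.sum_filter] at this
    simp only [Finset.sum_const, nsmul_eq_mul, mul_one, Nat.cast_inj] at this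
    exact this
  have hcard : ((Finset.range n).filter fun p => kept p = 0).card + K.card = n := by
    have := Finset.card_filter_add_card_filter_not (s := Finset.range n) fun p => kept p = 0
    rw [Finset.card_range] at this
    rw [hcardK]
    convert this using 4
    omega
  refine ⟨parentGraph K f, ⟨hrank.isAcyclic, fun T => ?_⟩, ?_, ?_⟩
  · obtain ⟨r, hr, hload⟩ := hrank.exists_load_eq I hH T
    rw [hload]
    refine J.forest.h_le _ (pos_lt r) (Nat.zero_le _) ?_
    rw [hKdef] at hr
    omega
  · rw [hrank.cost_eq, Fintype.card_fin]
    -- The actual edge cost is at most `splitCost`, where the edges to original parents are counted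
    -- twice.
    have h₁ : ∑ x ∈ K, I.c s(x, f x) ≤ K₀ := by
      refine le_trans ?_ J.cost_le
      rw [hsum, splitCost]
      refine Finset.sum_le_sum fun p hp => ?_
      have hpn := Finset.mem_range.1 hp
      split_ifs with hk hpp
      · rw [hf, pos_τ p hpn, ← positionWeight_of_ne (g := I.c) (τ := τ) hpn (J.forest.rank p hpn hk).1 (hne p hpn hk)]
        linarith [B.cost_metric.nonneg p (par p)]
      · rw [hf, pos_τ p hpn, ← positionWeight_of_ne (g := I.c) (τ := τ) hpn (J.forest.rank p hpn hk).1 (hne p hpn hk)]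
        linarith
      · exact le_rfl
    have h₂ : (n : ℝ) - K.card ≤ ∑ r ∈ Finset.range n with kept₀ r = 0, S r := by
      refine le_trans (le_of_eq ?_) (J.card_free_le B)
      have : ((((Finset.range n).filter fun p => kept p = 0).card + K.card : ℕ) : ℝ) = n := by
        rw [hcard]
      push_cast at this
      linarith
    have := mul_le_mul_of_nonneg_left h₂ I.γ_nonneg
    linarith
  · intro s ord hord hL
    have hcc := hrank.card_connectedComponent
    rw [Fintype.card_fin] at hcc
    have hadj : ∀ v w, (parentGraph K f).Adj v w ↔ ∃ p < n, 1 ≤ kept p ∧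
        ((τ p = v ∧ τ (par p) = w) ∨ (τ p = w ∧ τ (par p) = v)) := by
      intro v w
      rw [hrank.adj_iff, hKdef, hKdef, hf, hf]
      constructor
      · rintro (⟨h₁, h₂⟩ | ⟨h₁, h₂⟩)
        · exact ⟨pos v, pos_lt v, h₁, Or.inl ⟨τ_pos v, h₂⟩⟩
        · exact ⟨pos w, pos_lt w, h₁, Or.inr ⟨τ_pos w, h₂⟩⟩
      · rintro ⟨p, hp, hk, ⟨rfl, h₂⟩ | ⟨rfl, h₂⟩⟩
        · left; rw [pos_τ p hp]; exact ⟨hk, h₂⟩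
        · right; rw [pos_τ p hp]; exact ⟨hk, h₂⟩
    have hout : ∀ r < s.nat 1 1, ∃ p < n, 1 ≤ kept p ∧ s.nat 2 r = τ p ∧ s.nat 3 r = τ (par p) := by
      intro r hr
      obtain ⟨p, hp, hk, h₁, h₂⟩ := hL.edge r hr
      exact ⟨p, hp, hk, by rw [h₁, hord p hp],
        by rw [h₂, hord _ (J.forest.rank p hp hk).1]⟩
    refine ⟨?_, ?_, ?_, ?_⟩
    · rw [hL.roots]
      omega
    · rw [hrank.card_edgeSet, hcardK, hL.edges]
    · intro r hr
      obtain ⟨p, -, -, h₁, h₂⟩ := hout r hr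
      rw [h₁, h₂]
      exact ⟨(τ p).2, (τ (par p)).2⟩
    · intro v w
      rw [hadj]
      constructor
      · rintro ⟨p, hp, hk, hor⟩
        obtain ⟨r, hr, h₁, h₂⟩ := hL.index p hp hk
        rw [hord p hp] at h₁
        rw [hord _ (J.forest.rank p hp hk).1] at h₂
        refine ⟨r, hr, ?_⟩
        rw [h₁, h₂]
        rcases hor with ⟨h₃, h₄⟩ | ⟨h₃, h₄⟩
        · exact Or.inl ⟨by rw [h₃], by rw [h₄]⟩
        · exact Or.inr ⟨by rw [h₃], by rw [h₄]⟩
      · rintro ⟨r, hr, hor⟩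
        obtain ⟨p, hp, hk, h₁, h₂⟩ := hout r hr
        rw [h₁, h₂] at hor
        refine ⟨p, hp, hk, ?_⟩
        rcases hor with ⟨h₃, h₄⟩ | ⟨h₃, h₄⟩
        · exact Or.inl ⟨Fin.ext h₃, Fin.ext h₄⟩
        · exact Or.inr ⟨Fin.ext h₃, Fin.ext h₄⟩

end

/-! ## The algorithm -/

namespace RealRAM

/-- The approximation algorithm for the capacitated tree cover problem with edge loads. -/
def treeCover : Program := .seq prim (.seq greedy (.seq split output))

theorem depth_treeCover : treeCover.depth = 2 := by decide

variable {n N : ℕ} {I : TreeCoverInstance (Fin n)} {s : State}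

theorem HoldsInput.pairWeight_eq (hs : HoldsInput I s) (v w : Fin n) :
    pairWeight n s v w = I.u s(v, w) + I.c s(v, w) := by
  rw [pairWeight, hs.edgeCost, hs.edgeLoad]

theorem HoldsInput.primTree {τ : ℕ → Fin n} {ord par : ℕ → ℕ} {key : ℕ → ℝ} (hs : HoldsInput I s)
    (h : PrimInv n (pairWeight n s) n n ord par key) (hord : ∀ p < n, ord p = τ p)
    (hτ : ∀ i < n, ∀ j < n, τ i = τ j → i = j) :
    PrimTree n (positionWeight I.u τ) (positionWeight I.c τ) (fun p => I.b (τ p)) par := by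
  have hdiag : ∀ j < n, ∀ i < j, ¬ (s(τ i, τ j)).IsDiag := by
    intro j hj i hi
    rw [Sym2.mk_isDiag_iff]
    intro he
    have := hτ i (by omega) j hj he
    omega
  refine ⟨?_, ?_, ?_, fun v _ => I.b_nonneg _, fun v _ => I.b_lt_one _, h.par_lt, ?_⟩
  · intro j hj i hi
    rw [positionWeight_of_lt hi hj]
    exact I.u_nonneg _ (hdiag j hj i hi)
  · intro j hj i hi
    rw [positionWeight_of_lt hi hj]
    exact I.c_nonneg _ (hdiag j hj i hi)
  · intro j hj i hi j' hj' i' hi'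
    rw [positionWeight_of_lt hi hj, positionWeight_of_lt hi hj, positionWeight_of_lt hi' hj',
      positionWeight_of_lt hi' hj']
    exact edge_mono I (hdiag j hj i hi) (hdiag j' hj' i' hi')
  · intro m hm hm1 i hi j hj hmj
    have h₁ := h.key_le m hm hm1 i hi j hj hmj
    have hp := h.par_lt m hm hm1
    rw [h.key_eq m hm hm1, hord m hm, hord _ (by omega), hord j hj, hord i (by omega),
      hs.pairWeight_eq, hs.pairWeight_eq, Sym2.eq_swap, Sym2.eq_swap (a := τ j)] at h₁
    rwa [positionWeight_of_lt hp hm, positionWeight_of_lt hp hm,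
      positionWeight_of_lt (by omega) hj, positionWeight_of_lt (by omega) hj]

/-- The bound 3 comes together here: `cost_le` covers the edges and `sum_le` the openings, each by
three times the corresponding part of the objective value of `x`, and `x` is optimal. -/
theorem GreedyState.exists_roundedForest {d c : ℕ → ℕ → ℝ} {b : ℕ → ℝ} {γ : ℝ}
    {par done kept lab : ℕ → ℕ} {ld : ℕ → ℝ} (h : GreedyState n d c b γ par done kept lab ld)
    (T : PrimTree n d c b par) (hd : FiniteMetric n d) (hc : FiniteMetric n c)
    (hdone : ∀ p < n, 1 ≤ p → 1 ≤ done p) (hγ : 0 ≤ γ) :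
    ∃ rt S K, RoundedForest n d c b par kept rt S ∧ splitCost n c par kept par ≤ K ∧
      ∀ y, PairFeasible n d b y → K + γ * ∑ r ∈ Finset.range n with kept r = 0, S r ≤
        3 * (γ * n - ∑ p ∈ pairsIn (Finset.range n), (γ - c p.1 p.2) * y p.1 p.2) := by
  obtain ⟨x, S, rt, G, B⟩ := h
  refine ⟨rt, S, 3 * ∑ p ∈ Finset.range n, c (par p) p * x p, ⟨hd, hc, T.b_nonneg, T.b_lt_one,
    fun p hp hk => T.par_lt p hp (G.joined hp (B.kept_joined p hp hk).1).1, B.rt_eq, B.rt_le,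
    B.kept_rt, B.one_le, B.load_le, B.vertex_le⟩, ?_, ?_⟩
  · refine le_of_eq_of_le ?_ B.cost_le
    rw [splitCost, Finset.sum_filter]
    refine Finset.sum_congr rfl fun p _ => ?_
    rw [if_pos rfl, hc.symm p]
    split_ifs <;> ring
  · intro y hy
    have h₁ := G.optimal T hdone hy
    have h₂ := mul_le_mul_of_nonneg_left B.sum_le hγ
    have h₃ : ∑ p ∈ Finset.range n, (γ - c (par p) p) * x p =
        γ * ∑ p ∈ Finset.range n, x p - ∑ p ∈ Finset.range n, c (par p) p * x p := by
      rw [Finset.mul_sum, ← Finset.sum_sub_distrib]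
      exact Finset.sum_congr rfl fun p _ => by ring
    rw [h₃] at h₁
    linarith

theorem reach_treeCover (hN : 2 * n ≤ N) (h1 : 1 ≤ n) (hs : HoldsInput I s) :
    Reach N treeCover (fun s' => ∃ F : SimpleGraph (Fin n),
      HoldsOutput (Nat.card F.ConnectedComponent) F s' ∧ I.IsSolution F ∧
      ∀ x, I.LPFeasible x → I.cost F ≤ 3 * I.lpCost x) s := by
  refine Reach.seq (Reach.mono (Reach.frame (reach_prim hs.size h1 (by omega))) ?_)
  rintro s₁ ⟨⟨h4, P⟩, hf₁⟩
  -- The list of vertices computed by Prim's algorithm, as a total function; the default vertex is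
  -- never used at positions below `n`.
  obtain ⟨τ, hord⟩ : ∃ τ : ℕ → Fin n, ∀ p < n, s₁.nat 5 p = τ p := by
    refine ⟨fun p => if h : s₁.nat 5 p < n then ⟨_, h⟩ else ⟨0, h1⟩, fun p hp => ?_⟩
    simp only [dif_pos (P.ord_lt p hp)]
  have hτ : ∀ i < n, ∀ j < n, τ i = τ j → i = j := by
    intro i hi j hj he
    exact P.ord_inj i hi j hj (by rw [hord i hi, hord j hj, he])
  have T := hs.primTree P hord hτ
  have hw : ∀ p < n, 1 ≤ p → ∀ g : Sym2 (Fin n) → ℝ,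
      g s(τ p, τ (s₁.nat 6 p)) = positionWeight g τ (s₁.nat 6 p) p := by
    intro p hp hp1 g
    rw [positionWeight_of_lt (P.par_lt p hp hp1) hp, Sym2.eq_swap]
  have hpar : ∀ p < n, 1 ≤ p → s₁.nat 6 p < n := fun p hp hp1 => (P.par_lt p hp hp1).trans hp
  refine Reach.seq (Reach.mono (Reach.frame (reach_greedy (γ := I.γ) (by omega) h1 T
    (by rw [hf₁.nat 0 (by decide), hs.size]) (by rw [hf₁.real 0 (by decide), hs.opening]) rfl
    ?_ ?_ ?_ ?_)) ?_)
  · intro p hp hp1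
    rw [P.key_eq p hp hp1, hord p hp, hord _ (hpar p hp hp1), hs.pairWeight_eq, hw p hp hp1 I.u,
      hw p hp hp1 I.c]
  · intro p hp hp1
    rw [h4 _ (P.ord_lt p hp), hord p hp, hord _ (hpar p hp hp1), hf₁.real 3 (by decide),
      hs.edgeLoad, hw p hp hp1 I.u]
  · intro p hp hp1
    rw [h4 _ (P.ord_lt p hp), hord p hp, hord _ (hpar p hp hp1), hf₁.real 2 (by decide),
      hs.edgeCost, hw p hp hp1 I.c]
  · intro p hp
    rw [hord p hp, hf₁.real 1 (by decide), hs.vertexLoad]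
  rintro s₂ ⟨⟨hT, done, lab, ld, hG, hdone⟩, hf₂⟩
  obtain ⟨rt, S, K, B, hK, hbound⟩ := hG.exists_roundedForest T
    (finiteMetric_positionWeight hτ I.u_nonneg I.u_triangle)
    (finiteMetric_positionWeight hτ I.c_nonneg I.c_triangle) hdone I.γ_nonneg
  refine Reach.seq (Reach.mono (Reach.frame (reach_split hN hT B hK)) ?_)
  rintro s₃ ⟨⟨e0, h, ρ, J⟩, hf₃⟩
  obtain ⟨F, hF, hcost, hout⟩ := exists_solution hτ B J
  refine Reach.mono (reach_output (by omega) e0) fun s₄ hL => ⟨F, hout s₄ _ ?_ hL, hF, ?_⟩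
  · intro p hp
    rw [hf₃.nat 5 (by decide), hf₂.nat 5 (by decide), hord p hp]
  · intro x hx
    rw [lpCost_eq hτ]
    exact hcost.trans (hbound _ (hx.pairFeasible hτ))

end RealRAM

/-! ### Approximation guarantee and running time in terms of the number of edges -/

theorem card_edgeSet_top_fin (n : ℕ) (hn : 2 ≤ n) :
    (n : ℝ) ^ 2 ≤ 4 * (Nat.card (⊤ : SimpleGraph (Fin n)).edgeSet : ℝ) := by
  classical
  rw [Nat.card_eq_fintype_card, ← SimpleGraph.edgeFinset_card,
    SimpleGraph.card_edgeFinset_top_eq_card_choose_two, Fintype.card_fin, Nat.cast_choose_two]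
  have : (2 : ℝ) ≤ n := by exact_mod_cast hn
  nlinarith

theorem theorem1 :
    ∃ (P : RealRAM.Program) (C : ℝ), ∀ (n : ℕ), 1 ≤ n → ∀ (I : TreeCoverInstance (Fin n))
      (s : RealRAM.State), RealRAM.HoldsInput I s →
      ∃ (t : ℕ) (s' : RealRAM.State) (k : ℕ) (F : SimpleGraph (Fin n)),
        RealRAM.Exec P s t s' ∧ RealRAM.HoldsOutput k F s' ∧
        (2 ≤ n → (t : ℝ) ≤
          C * ((Nat.card (⊤ : SimpleGraph (Fin n)).edgeSet : ℝ) * Real.log (n : ℝ))) ∧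
        (n = 1 → (t : ℝ) ≤ C) ∧
        I.IsSolution F ∧ k = Nat.card F.ConnectedComponent ∧
        (∀ F' : SimpleGraph (Fin n), I.IsSolution F' → I.cost F ≤ 3 * I.cost F') ∧
        (∀ x : Sym2 (Fin n) → ℝ, I.LPFeasible x → I.cost F ≤ 3 * I.lpCost x) := by
  have hlog : 0 < Real.log 2 := Real.log_pos (by norm_num)
  have hlog1 : Real.log 2 ≤ 1 := by
    have := Real.log_le_sub_one_of_pos (show (0 : ℝ) < 2 by norm_num)
    linarith
  -- With loop bound `2 * n` and nesting depth 2, the time is at most `size * (2 * n + 1) ^ 2 ≤ 9 *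
  -- size * n ^ 2`. Moreover `n ^ 2 ≤ 4 * m` for `n ≥ 2`, whence `36`; dividing by `Real.log 2`
  -- accounts for the smallest value of the logarithm.
  refine ⟨RealRAM.treeCover, 36 * RealRAM.treeCover.size / Real.log 2, fun n hn I s hs => ?_⟩
  obtain ⟨t, s', hexec, ht, F, hout, hF, hlp⟩ :=
    RealRAM.reach_treeCover (N := 2 * n) le_rfl hn hs
  rw [RealRAM.depth_treeCover] at ht
  have ht' : (t : ℝ) ≤ 9 * RealRAM.treeCover.size * (n : ℝ) ^ 2 := by
    have h₁ : (t : ℝ) ≤ RealRAM.treeCover.size * (2 * n + 1) ^ 2 := by exact_mod_cast ht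
    have h₂ : (2 * (n : ℝ) + 1) ^ 2 ≤ 9 * (n : ℝ) ^ 2 := by
      have : (1 : ℝ) ≤ n := by exact_mod_cast hn
      nlinarith
    have := mul_le_mul_of_nonneg_left h₂ (Nat.cast_nonneg (α := ℝ) RealRAM.treeCover.size)
    linarith
  have hsize : (0 : ℝ) ≤ RealRAM.treeCover.size := Nat.cast_nonneg _
  refine ⟨t, s', _, F, hexec, hout, ?_, ?_, hF, rfl, ?_, hlp⟩
  · intro hn2
    have hl : Real.log 2 ≤ Real.log n :=
      Real.log_le_log (by norm_num) (by exact_mod_cast hn2)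
    have hm := card_edgeSet_top_fin n hn2
    obtain ⟨m, hm'⟩ : ∃ m, m = (Nat.card (⊤ : SimpleGraph (Fin n)).edgeSet : ℝ) := ⟨_, rfl⟩
    rw [← hm'] at hm ⊢
    have hm0 : 0 ≤ m := by rw [hm']; exact Nat.cast_nonneg _
    calc (t : ℝ) ≤ 9 * RealRAM.treeCover.size * (4 * m) := ht'.trans (by gcongr)
      _ = 36 * RealRAM.treeCover.size / Real.log 2 * (m * Real.log 2) := by
        field_simp
        ring
      _ ≤ 36 * RealRAM.treeCover.size / Real.log 2 * (m * Real.log n) := by gcongr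
  · rintro rfl
    rw [le_div_iff₀ hlog]
    have h₁ : (t : ℝ) ≤ 9 * RealRAM.treeCover.size := by simpa using ht'
    have h₂ := mul_le_mul h₁ hlog1 hlog.le (by linarith)
    linarith
  · intro F' hF'
    obtain ⟨x, hx, hcost⟩ := hF'.exists_lpFeasible
    rw [← hcost]
    exact hlp x hx
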